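/- **Model.** A network is a connected undirected simple graph on $n$ nodes in which every node $v$ numbers its incident edges by ports $1,\dots,\deg v$ (arbitrarily, not symmetrically) and has a unique ID from $\{1,\dots,n^4\}$. Computation is synchronous: all nodes start simultaneously, and in every round each node may send one message (a finite bit string of any length) through each of its ports. A randomized algorithm determines the messages that a node sends, and the current value of its leader flag, from $n$, the node's ID and degree, its private infinite string of independent fair random bits, and the messages received so far through its ports. It solves (implicit) leader election in an execution if from some round on no messages are sent and exactly one node, always the same, has its flag raised. For a graph $G=(V,E)$ the conductance is $$\phi(G)=\min_{\emptyset\ne U\subsetneq V}\frac{|E(U,V\setminus U)|}{\min\{\mathrm{Vol}(U),\mathrm{Vol}(V\setminus U)\}},\qquad \mathrm{Vol}(U)=\sum_{v\in U}\deg v .$$ **Theorem.** There are absolute constants $c_1,\dots,c_5>0$ with the following property. Let $\mathcal A$ be a randomized algorithm that solves leader election with probability at least $1-\delta(n)$ on every $n$-node network, where $\delta(n)\to0$ as $n\to\infty$. Then for all sufficiently large $n$ (depending on $\mathcal A$) and every real $\alpha$ with $\frac1{n^2}<\alpha<\frac1{12^2}$ there is a graph $G$ such that * the number of nodes of $G$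 lies between $c_1n$ and $c_2n$; * $c_3\alpha\le\phi(G)\le c_4\alpha$; * for some port numbering and some assignment of unique IDs on $G$, the expected number of messages sent by $\mathcal A$ is at least $c_5\sqrt n/\phi(G)^{3/4}$. Moreover, $G$ can be taken from the support of the following random construction: take a random 4-regular simple graph $H$ and replace each vertex of $H$ by a clique on $k$ nodes (for some $k$); for each edge $st$ of $H$ join a node of the clique of $s$ to a node of the clique of $t$, using four distinct nodes in every clique for its four edges; in each clique, pair up these four nodes and delete the clique edge inside each of the two pairs. -/

import Mathlib

open MeasureTheory Filter Topology

namespace LeaderElection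

section Conductance

variable {V : Type} [Fintype V]

/-- The volume of a set of nodes: the sum of their degrees. -/
noncomputable def vol (G : SimpleGraph V) (U : Finset V) : ℕ :=
  ∑ v ∈ U, (G.neighborSet v).ncard

open Classical in
/-- The number of edges across the cut `(U, V \ U)`; each such edge is counted once, as the
ordered pair (endpoint in `U`, endpoint outside `U`). -/
noncomputable def cutSize (G : SimpleGraph V) (U : Finset V) : ℕ :=
  ((U ×ˢ Uᶜ).filter fun e => G.Adj e.1 e.2).card

open Classical in
/-- The cut-conductance of the cut `(U, V \ U)`. -/
noncomputable def cutConductance (G : SimpleGraph V) (U : Finset V) : ℝ :=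
  (cutSize G U : ℝ) / (min (vol G U) (vol G Uᶜ) : ℕ)

/-- The conductance of a graph: the minimum of the cut-conductance over all cuts with two
nonempty sides. (The infimum is over a finite family, nonempty as soon as there are two nodes.) -/
noncomputable def conductance (G : SimpleGraph V) : ℝ :=
  ⨅ U : {U : Finset V // U.Nonempty ∧ U ≠ Finset.univ}, cutConductance G U.1

end Conductance

/-- The choices made when every vertex `s` of a graph `H` is replaced by a clique with node set
`{s} × Fin k`. -/
structure CliqueSubstitution {W : Type} (H : SimpleGraph W) (k : ℕ) where
  /-- `ext s t` is the node of the clique of `s` that carries the edge `s t` of `H`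
  (irrelevant if `s`, `t` are not adjacent). -/
  ext : W → W → Fin k
  /-- The edges of `H` at `s` are attached to distinct nodes of the clique of `s`. -/
  ext_injOn : ∀ s, Set.InjOn (ext s) (H.neighborSet s)
  /-- `mate s` pairs up the neighbours of `s`, that is, the external-edged nodes of the clique
  of `s`; the clique edge inside each pair is removed. -/
  mate : W → W → W
  mate_adj : ∀ s t, H.Adj s t → H.Adj s (mate s t)
  mate_ne : ∀ s t, H.Adj s t → mate s t ≠ t
  mate_mate : ∀ s t, H.Adj s t → mate s (mate s t) = t

/-- The graph obtained from `H` by replacing every vertex by a clique on `k` nodes: the edges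
inside a clique, except those between paired external-edged nodes, and one inter-clique edge for
every edge of `H`. -/
def CliqueSubstitution.graph {W : Type} {H : SimpleGraph W} {k : ℕ}
    (S : CliqueSubstitution H k) : SimpleGraph (W × Fin k) where
  Adj x y :=
    (x.1 = y.1 ∧ x.2 ≠ y.2 ∧
      ¬ ∃ t, H.Adj x.1 t ∧ x.2 = S.ext x.1 t ∧ y.2 = S.ext x.1 (S.mate x.1 t)) ∨
    (H.Adj x.1 y.1 ∧ x.2 = S.ext x.1 y.1 ∧ y.2 = S.ext y.1 x.1)
  symm := by
    constructor
    rintro ⟨s, i⟩ ⟨t, j⟩ (⟨h, hij, hne⟩ | ⟨h, hi, hj⟩)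
    · left
      dsimp only at h hij hne ⊢
      subst h
      refine ⟨rfl, hij.symm, ?_⟩
      rintro ⟨t, hst, hj, hi⟩
      exact hne ⟨S.mate s t, S.mate_adj s t hst, hi, by rw [S.mate_mate s t hst, hj]⟩
    · exact Or.inr ⟨h.symm, hj, hi⟩
  loopless := by
    constructor
    rintro ⟨s, i⟩ (⟨_, h, _⟩ | ⟨h, _⟩)
    · exact h rfl
    · exact H.loopless.irrefl s h

/-- A network: a connected graph with a port numbering at every node (not assumed to be
symmetric) and unique IDs from `{1, …, n ^ 4}`, where `n` is the number of nodes. -/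
structure Network (V : Type) [Fintype V] where
  graph : SimpleGraph V
  connected : graph.Connected
  /-- The degree of a node, that is, its number of ports. -/
  deg : V → ℕ
  /-- The neighbour behind each port. -/
  port : ∀ v, Fin (deg v) ≃ graph.neighborSet v
  id : V → ℕ
  id_injective : Function.Injective id
  id_mem : ∀ v, id v ∈ Finset.Icc 1 (Fintype.card V ^ 4)

/-- A message is a finite bit string (of any length). -/
abbrev Msg : Type := List Bool

/-- What passes through the `d` ports of a node in one round, in one direction; `none` means
that there is no message on that port. -/
abbrev PortMsgs (d : ℕ) : Type := Fin d → Option Msg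

/-- A randomized distributed algorithm. What a node does in a round may depend on all it knows:
the network size `n`, its own ID, its degree `d`, its private infinite string of random bits, and
the messages it received in all previous rounds (listed from the latest round to the first one).
`send` gives the messages that it sends, `flag` the current value of its leader flag. -/
structure Algorithm where
  send : (n id d : ℕ) → (ℕ → Bool) → List (PortMsgs d) → PortMsgs d
  flag : (n id d : ℕ) → (ℕ → Bool) → List (PortMsgs d) → Bool
  measurableSet_send : ∀ (n id d : ℕ) (h : List (PortMsgs d)) (p : Fin d) (m : Option Msg),
    MeasurableSet {r : ℕ → Bool | send n id d r h p = m}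
  measurableSet_flag : ∀ (n id d : ℕ) (h : List (PortMsgs d)),
    MeasurableSet {r : ℕ → Bool | flag n id d r h = true}

/-- The law of an infinite string of independent fair bits. -/
noncomputable def bitsLaw : Measure (ℕ → Bool) :=
  Measure.infinitePi fun _ => (PMF.uniformOfFintype Bool).toMeasure

/-- The law of the private random strings of all nodes: they are independent. -/
noncomputable def randomLaw (V : Type) [Fintype V] : Measure (V → ℕ → Bool) :=
  Measure.pi fun _ => bitsLaw

section Execution

variable {V : Type} [Fintype V] (A : Algorithm) (net : Network V)

/-- The port of the neighbour behind port `p` of `v` that leads back to `v`. -/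
def Network.backPort {V : Type} [Fintype V] (net : Network V) (v : V) (p : Fin (net.deg v)) :
    Fin (net.deg (net.port v p : V)) :=
  (net.port (net.port v p : V)).symm ⟨v, (net.port v p).2.symm⟩

/-- The messages that each node received in the first `t` rounds of the synchronous execution
with random strings `r`, latest round first. In every round, what a node receives on port `p` is
what the neighbour behind `p` sends in that round over the same edge. -/
def received (r : V → ℕ → Bool) : ℕ → (v : V) → List (PortMsgs (net.deg v))
  | 0, _ => []
  | t + 1, v =>
    (fun p =>
      A.send (Fintype.card V) (net.id (net.port v p : V)) (net.deg (net.port v p : V))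
        (r (net.port v p : V)) (received r t (net.port v p : V)) (net.backPort v p))
    :: received r t v

/-- The messages that node `v` sends in round `t` (rounds are numbered from `0`). -/
def sent (r : V → ℕ → Bool) (t : ℕ) (v : V) : PortMsgs (net.deg v) :=
  A.send (Fintype.card V) (net.id v) (net.deg v) (r v) (received A net r t v)

/-- The leader flag of node `v` after `t` rounds. -/
def flagAt (r : V → ℕ → Bool) (t : ℕ) (v : V) : Bool :=
  A.flag (Fintype.card V) (net.id v) (net.deg v) (r v) (received A net r t v)

/-- The execution with random strings `r` solves implicit leader election: from some round on no
messages are sent, and one node has its flag raised while all the others have not. -/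
def ElectsLeader (r : V → ℕ → Bool) : Prop :=
  ∃ (T : ℕ) (leader : V), ∀ t ≥ T,
    (∀ v p, sent A net r t v p = none) ∧ ∀ v, flagAt A net r t v = true ↔ v = leader

/-- The probability that the algorithm solves implicit leader election on the network. -/
noncomputable def successProb : ℝ :=
  (randomLaw V).real {r | ElectsLeader A net r}

/-- The total number of messages sent in the execution with random strings `r`, possibly `∞`. -/
noncomputable def messageCount (r : V → ℕ → Bool) : ENNReal :=
  ∑' t : ℕ, ∑ v : V, ∑ p : Fin (net.deg v), if (sent A net r t v p).isSome then 1 else 0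

/-- The expected number of messages that the algorithm sends on the network, possibly `∞`. -/
noncomputable def expectedMessages : ENNReal :=
  ∫⁻ r, messageCount A net r ∂(randomLaw V)

end Execution

/-- The algorithm solves implicit leader election with probability `1 - o(1)` on `n`-node
networks. -/
def Algorithm.SucceedsWHP (A : Algorithm) : Prop :=
  ∃ δ : ℕ → ℝ, Tendsto δ atTop (𝓝 0) ∧
    ∀ (V : Type) [Fintype V] (net : Network V), 1 - δ (Fintype.card V) ≤ successProb A net

end LeaderElection

/-! Place cliques of size k = 4q, with k of order 1/√α, on the N vertices of a 4-regular expander,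
with N of order n/k. Cutting off one clique shows that the conductance φ is at most of order 1/k²,
and expansion gives a matching lower bound, so φ is of order α (`conductance_le`, `conductance_ge`).
As √N·k² is of order √n·k^(3/2), hence of order √n/φ^(3/4), it suffices to force √N·q² messages up
to a constant. This is done on average over random positions of the external nodes (one in each of
four blocks of q nodes of a clique), random IDs and random bits; some fixed choice is then at least
as bad.

First, every clique communicates with other cliques with probability a ≥ 1/(4√N)
(`measure_active_ge`). Consider two independent executions. By symmetry a is the same for all
cliques, and a given clique contains the leader with probability at most 1/N. If N·a² were small,
then typically no clique would communicate in both executions, and the clique of either leader would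
not communicate in the other execution. The cliques reachable from the second leader along edges
used in either execution then do not include the clique of the first leader, and exchanging the data
of these cliques between the executions produces two leaders (`leadersAre_splice`). The exchange
preserves the measure, so this is no likelier than a failed election (`measure_electApart_le`), a
contradiction.

Second, communication costs order q² messages (`sum_opened_le`). Every node has k - 1 ports, as in a
full clique; removing a clique edge only rematches its two half-edges with those of neighbouring
cliques. Until a message uses such a half-edge, the execution is the same as if the edge were still
there, and that execution carries no information on which of q² candidate edges is the removed one.
Removed edges can only be restored along a whole closed trail of external edges, so the edges of the
expander are organised in cycles of at most 15 vertices, which keeps the loss bounded.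

The expander is a Cayley graph of a group of 3 × 3 matrices over 𝔽₅[X]/(X^d), generated by x of
order five and t of order three. It is vertex-transitive with short generator cycles. The conjugates
of x under t pairwise generate Heisenberg groups, which makes the angle between their fixed spaces
have cosine at most 1/√5 < 1/2; three subspaces with pairwise cosines below 1/2 yield a spectral gap
(`angleLE_inf_inf`, `exists_fixed_near`). Increasing d by one multiplies the order of the group by a
bounded factor, so all sizes are reached up to a constant (`exists_cycleExpander`). -/

namespace LeaderElection

set_option linter.unusedSectionVars false

/-! ### Angles between subspaces and distance to intersections -/

section Subspaces

variable {E : Type*} [NormedAddCommGroup E] [InnerProductSpace ℝ E] [FiniteDimensional ℝ E]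

/-- The cosine of the angle between `A` and `B`, measured modulo `A ⊓ B`, is at most `ε`. -/
def AngleLE (A B : Submodule ℝ E) (ε : ℝ) : Prop :=
  ∀ v ∈ A, ∀ w ∈ B, (∀ u ∈ A ⊓ B, inner ℝ v u = 0) → (∀ u ∈ A ⊓ B, inner ℝ w u = 0) →
    inner ℝ v w ≤ ε * (‖v‖ * ‖w‖)

lemma AngleLE.symm {A B : Submodule ℝ E} {ε : ℝ} (h : AngleLE A B ε) : AngleLE B A ε := by
  intro v hv w hw hv' hw'
  rw [inf_comm] at hv' hw'
  rw [real_inner_comm, mul_comm ‖v‖]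
  exact h w hw v hv hw' hv'

lemma inner_sub_starProjection (A : Submodule ℝ E) (f u : E) (hu : u ∈ A) :
    inner ℝ (f - A.starProjection f) u = 0 := by
  have := Submodule.starProjection_inner_eq_zero (K := A) f u hu
  simpa using this

lemma norm_sub_starProjection_le (A : Submodule ℝ E) (f a : E) (ha : a ∈ A) :
    ‖f - A.starProjection f‖ ≤ ‖f - a‖ := by
  have h0 : inner ℝ (f - A.starProjection f) (A.starProjection f - a) = 0 :=
    inner_sub_starProjection A f _ (A.sub_mem (Submodule.starProjection_apply_mem A f) ha)
  have h1 : ‖f - a‖ ^ 2 = ‖f - A.starProjection f‖ ^ 2 + ‖A.starProjection f - a‖ ^ 2 := by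
    have : f - a = (f - A.starProjection f) + (A.starProjection f - a) := by abel
    rw [this, norm_add_sq_real, h0]; ring
  exact le_of_sq_le_sq (by nlinarith [sq_nonneg ‖A.starProjection f - a‖]) (norm_nonneg _)

/-- A vector close to two subspaces at a positive angle is close to their intersection. -/
lemma AngleLE.exists_mem_inf {A B : Submodule ℝ E} {ε : ℝ} (h : AngleLE A B ε) (hε : 0 ≤ ε)
    (f : E) {a b : E} (ha : a ∈ A) (hb : b ∈ B) :
    ∃ c ∈ A ⊓ B, (1 - ε) * ‖f - c‖ ≤ ‖f - a‖ + ‖f - b‖ := by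
  refine ⟨(A ⊓ B).starProjection f, Submodule.starProjection_apply_mem _ f, ?_⟩
  set c := (A ⊓ B).starProjection f with hc
  have hcm : c ∈ A ⊓ B := Submodule.starProjection_apply_mem _ f
  set g := f - c with hg
  set a' := A.starProjection g with ha'
  set b' := B.starProjection g with hb'
  have hgo : ∀ u ∈ A ⊓ B, inner ℝ g u = 0 := fun u hu => inner_sub_starProjection _ f u hu
  have hda : ‖g - a'‖ ≤ ‖f - a‖ := by
    have := norm_sub_starProjection_le A g (a - c) (A.sub_mem ha hcm.1)
    rwa [show g - (a - c) = f - a by rw [hg]; abel] at this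
  have hdb : ‖g - b'‖ ≤ ‖f - b‖ := by
    have := norm_sub_starProjection_le B g (b - c) (B.sub_mem hb hcm.2)
    rwa [show g - (b - c) = f - b by rw [hg]; abel] at this
  have hoa : ∀ u ∈ A, inner ℝ (g - a') u = 0 := fun u hu => inner_sub_starProjection _ g u hu
  have hob : ∀ u ∈ B, inner ℝ (g - b') u = 0 := fun u hu => inner_sub_starProjection _ g u hu
  have ham : a' ∈ A := Submodule.starProjection_apply_mem _ g
  have hbm : b' ∈ B := Submodule.starProjection_apply_mem _ g
  have e1 : inner ℝ g b' = ‖b'‖ ^ 2 := by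
    have := hob b' hbm
    rw [inner_sub_left, real_inner_self_eq_norm_sq] at this; linarith
  have e2 : inner ℝ a' b' ≤ ε * (‖a'‖ * ‖b'‖) := by
    refine h a' ham b' hbm (fun u hu => ?_) (fun u hu => ?_)
    · have := hoa u hu.1
      rw [inner_sub_left, hgo u hu] at this; linarith
    · have := hob u hu.2
      rw [inner_sub_left, hgo u hu] at this; linarith
  have e3 : ‖g‖ ^ 2 = ‖g - b'‖ ^ 2 + ‖b'‖ ^ 2 := by
    have : g = (g - b') + b' := by abel
    conv_lhs => rw [this]
    rw [norm_add_sq_real, hob b' hbm]; ring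
  have e4 : ‖g‖ ^ 2 = ‖g - a'‖ ^ 2 + ‖a'‖ ^ 2 := by
    have : g = (g - a') + a' := by abel
    conv_lhs => rw [this]
    rw [norm_add_sq_real, hoa a' ham]; ring
  have na : ‖a'‖ ≤ ‖g‖ := le_of_sq_le_sq (by nlinarith [sq_nonneg ‖g - a'‖]) (norm_nonneg _)
  have nb : ‖b'‖ ≤ ‖g‖ := le_of_sq_le_sq (by nlinarith [sq_nonneg ‖g - b'‖]) (norm_nonneg _)
  have nb' : ‖g - b'‖ ≤ ‖g‖ := le_of_sq_le_sq (by nlinarith [sq_nonneg ‖b'‖]) (norm_nonneg _)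
  have e5 : inner ℝ (g - a') b' ≤ ‖g - a'‖ * ‖b'‖ := real_inner_le_norm _ _
  rw [inner_sub_left] at e5
  -- Here ‖g‖² = ‖g - b'‖² + ⟨g - a', b'⟩ + ⟨a', b'⟩. Both projections are orthogonal to `A ⊓ B`
  -- because `g` is, so the angle bounds the last term; the distances bound the other two.
  have e6 : ‖g‖ ^ 2 ≤ ε * ‖g‖ ^ 2 + (‖f - a‖ + ‖f - b‖) * ‖g‖ := by
    have t1 : ‖a'‖ * ‖b'‖ ≤ ‖g‖ ^ 2 := by
      rw [sq]; exact mul_le_mul na nb (norm_nonneg _) (norm_nonneg _)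
    have t2 : ‖g - a'‖ * ‖b'‖ ≤ ‖f - a‖ * ‖g‖ := mul_le_mul hda nb (norm_nonneg _) (norm_nonneg _)
    have t3 : ‖g - b'‖ ^ 2 ≤ ‖f - b‖ * ‖g‖ := by
      rw [sq]; exact mul_le_mul hdb nb' (norm_nonneg _) (norm_nonneg _)
    have t4 := mul_le_mul_of_nonneg_left t1 hε
    nlinarith
  rcases (norm_nonneg g).eq_or_lt with h0 | h0
  · rw [← h0]; simp; positivity
  · have : ((1 - ε) * ‖g‖) * ‖g‖ ≤ (‖f - a‖ + ‖f - b‖) * ‖g‖ := by nlinarith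
    exact le_of_mul_le_mul_right this h0

/-- One step of the bootstrap for three subspaces: vectors of `A ⊓ B` and `A ⊓ C` are compared
through their projections to `B ⊓ C`. -/
lemma inner_le_of_angle {A B C : Submodule ℝ E} {ε μ : ℝ} (hε1 : ε ≤ 1) (hε0 : 0 ≤ ε)
    (h : AngleLE B C ε) {v w : E} (hv : v ∈ B) (hw : w ∈ C)
    (hv1 : ‖v‖ = 1) (hw1 : ‖w‖ = 1)
    (hvA : ∀ u ∈ A ⊓ B ⊓ C, inner ℝ v u = 0) (hwA : ∀ u ∈ A ⊓ B ⊓ C, inner ℝ w u = 0)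
    (hμv : ∀ u ∈ B ⊓ C, (∀ i ∈ A ⊓ B ⊓ C, inner ℝ u i = 0) → inner ℝ v u ≤ μ * ‖u‖)
    (hμw : ∀ u ∈ B ⊓ C, (∀ i ∈ A ⊓ B ⊓ C, inner ℝ u i = 0) → inner ℝ w u ≤ μ * ‖u‖) :
    inner ℝ v w ≤ ε + (1 - ε) * μ ^ 2 := by
  have key : ∀ v : E, ‖v‖ = 1 → (∀ u ∈ A ⊓ B ⊓ C, inner ℝ v u = 0) →
      (∀ u ∈ B ⊓ C, (∀ i ∈ A ⊓ B ⊓ C, inner ℝ u i = 0) → inner ℝ v u ≤ μ * ‖u‖) →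
      ‖(B ⊓ C).starProjection v‖ ^ 2 ≤ μ ^ 2 ∧
      ‖v - (B ⊓ C).starProjection v‖ ^ 2 = 1 - ‖(B ⊓ C).starProjection v‖ ^ 2 := by
    intro v hv1 hvA hμ
    set u := (B ⊓ C).starProjection v with hu
    have hum : u ∈ B ⊓ C := Submodule.starProjection_apply_mem _ v
    have ho : ∀ i ∈ B ⊓ C, inner ℝ (v - u) i = 0 := fun i hi => inner_sub_starProjection _ v i hi
    have h1 : inner ℝ v u = ‖u‖ ^ 2 := by
      have := ho u hum
      rw [inner_sub_left, real_inner_self_eq_norm_sq] at this; linarith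
    have h2 := hμ u hum (fun i hi => by
      have := ho i ⟨hi.1.2, hi.2⟩
      rw [inner_sub_left, hvA i hi] at this; linarith)
    rw [h1] at h2
    constructor
    · rcases (norm_nonneg u).eq_or_lt with h0 | h0
      · rw [← h0]; simp; positivity
      · have : ‖u‖ ≤ μ := by
          have : ‖u‖ * ‖u‖ ≤ μ * ‖u‖ := by nlinarith
          exact le_of_mul_le_mul_right this h0
        nlinarith
    · have : v = (v - u) + u := by abel
      have e : ‖v‖ ^ 2 = ‖v - u‖ ^ 2 + ‖u‖ ^ 2 := by
        conv_lhs => rw [this]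
        rw [norm_add_sq_real, ho u hum]; ring
      rw [hv1] at e; linarith
  obtain ⟨kv, kv'⟩ := key v hv1 hvA hμv
  obtain ⟨kw, kw'⟩ := key w hw1 hwA hμw
  set Pv := (B ⊓ C).starProjection v
  set Pw := (B ⊓ C).starProjection w
  have hPv : Pv ∈ B ⊓ C := Submodule.starProjection_apply_mem _ v
  have hPw : Pw ∈ B ⊓ C := Submodule.starProjection_apply_mem _ w
  have ov : ∀ i ∈ B ⊓ C, inner ℝ (v - Pv) i = 0 := fun i hi => inner_sub_starProjection _ v i hi
  have ow : ∀ i ∈ B ⊓ C, inner ℝ (w - Pw) i = 0 := fun i hi => inner_sub_starProjection _ w i hi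
  have e1 : inner ℝ (v - Pv) (w - Pw) ≤ ε * (‖v - Pv‖ * ‖w - Pw‖) :=
    h _ (B.sub_mem hv hPv.1) _ (C.sub_mem hw hPw.2) ov ow
  have e2 : inner ℝ v w = inner ℝ Pv Pw + inner ℝ (v - Pv) (w - Pw) := by
    have a1 := ov Pw hPw
    have a2 := ow Pv hPv
    rw [real_inner_comm] at a2
    simp only [inner_sub_left, inner_sub_right] at a1 a2 ⊢
    linarith
  have e3 : inner ℝ Pv Pw ≤ ‖Pv‖ * ‖Pw‖ := real_inner_le_norm _ _
  have e4 : ‖v - Pv‖ * ‖w - Pw‖ ≤ (2 - ‖Pv‖ ^ 2 - ‖Pw‖ ^ 2) / 2 := by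
    nlinarith [sq_nonneg (‖v - Pv‖ - ‖w - Pw‖)]
  have e5 := mul_le_mul_of_nonneg_left e4 hε0
  have e6 : (1 - ε) * (‖Pv‖ ^ 2 + ‖Pw‖ ^ 2) ≤ (1 - ε) * (2 * μ ^ 2) :=
    mul_le_mul_of_nonneg_left (by linarith) (by linarith)
  nlinarith [sq_nonneg (‖Pv‖ - ‖Pw‖)]

/-- Let μ be the largest cosine, modulo the triple intersection, between any two of the three
pairwise intersections. Projecting an extremal pair to the third one gives μ ≤ ε + (1 - ε)μ², which
forces μ ≤ ε/(1 - ε) once μ < 1 is known. Compactness supplies the extremal pair. -/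
lemma angleLE_inf_inf {A B C : Submodule ℝ E} {ε : ℝ} (hε0 : 0 ≤ ε) (hε : ε < 1 / 2)
    (hAB : AngleLE A B ε) (hAC : AngleLE A C ε) (hBC : AngleLE B C ε) :
    AngleLE (A ⊓ B) (A ⊓ C) (ε / (1 - ε)) := by
  set I := A ⊓ B ⊓ C with hI
  let Q : Submodule ℝ E → Submodule ℝ E → Set (E × E) := fun X Y =>
    {z | z.1 ∈ X ∧ z.2 ∈ Y ∧ z.1 ∈ Iᗮ ∧ z.2 ∈ Iᗮ ∧ ‖z.1‖ = 1 ∧ ‖z.2‖ = 1}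
  have hQc : ∀ X Y, IsCompact (Q X Y) := by
    intro X Y
    have hc : IsCompact (Metric.sphere (0 : E) 1 ×ˢ Metric.sphere (0 : E) 1) :=
      (isCompact_sphere _ _).prod (isCompact_sphere _ _)
    refine hc.of_isClosed_subset ?_ (fun z hz => ?_)
    · refine IsClosed.inter (X.closed_of_finiteDimensional.preimage continuous_fst) <|
        IsClosed.inter (Y.closed_of_finiteDimensional.preimage continuous_snd) <|
        IsClosed.inter (Iᗮ.closed_of_finiteDimensional.preimage continuous_fst) <|
        IsClosed.inter (Iᗮ.closed_of_finiteDimensional.preimage continuous_snd) <|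
        IsClosed.inter (isClosed_eq (by fun_prop) (by fun_prop))
          (isClosed_eq (by fun_prop) (by fun_prop))
    · simp only [Q, Set.mem_ofPred_eq] at hz
      simp [hz.2.2.2.2.1, hz.2.2.2.2.2]
  -- All three pairs enter one maximum, so that the estimate for each pair may use the same μ for
  -- the other two.
  set S : Set (E × E) := Q (A ⊓ B) (A ⊓ C) ∪ Q (A ⊓ B) (B ⊓ C) ∪ Q (A ⊓ C) (B ⊓ C) with hS
  have hSc : IsCompact S := ((hQc _ _).union (hQc _ _)).union (hQc _ _)
  suffices hmain : ∀ z ∈ S, inner ℝ z.1 z.2 ≤ ε / (1 - ε) by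
    intro v hv w hw hvo hwo
    have hII : A ⊓ B ⊓ (A ⊓ C) = I := by
      rw [hI]; ext x; simp only [Submodule.mem_inf]; tauto
    rw [hII] at hvo hwo
    rcases eq_or_ne v 0 with rfl | hv0
    · simp
    rcases eq_or_ne w 0 with rfl | hw0
    · simp
    have hn : ‖v‖ ≠ 0 := by simpa using hv0
    have hn' : ‖w‖ ≠ 0 := by simpa using hw0
    have := hmain (‖v‖⁻¹ • v, ‖w‖⁻¹ • w) (by
      refine Or.inl (Or.inl ⟨(A ⊓ B).smul_mem _ hv, (A ⊓ C).smul_mem _ hw,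
        Iᗮ.smul_mem _ ?_, Iᗮ.smul_mem _ ?_, ?_, ?_⟩)
      · exact (Submodule.mem_orthogonal' _ _).2 hvo
      · exact (Submodule.mem_orthogonal' _ _).2 hwo
      · rw [norm_smul]; simp [hn]
      · rw [norm_smul]; simp [hn'])
    simp only [inner_smul_left, inner_smul_right, conj_trivial] at this
    have hp : 0 < ‖v‖ * ‖w‖ := by positivity
    calc inner ℝ v w = (‖w‖⁻¹ * (‖v‖⁻¹ * inner ℝ v w)) * (‖v‖ * ‖w‖) := by field_simp
      _ ≤ _ := mul_le_mul_of_nonneg_right this hp.le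
  rcases S.eq_empty_or_nonempty with hE | hne
  · rw [hE]; simp
  obtain ⟨z₀, hz₀, hmax⟩ := hSc.exists_isMaxOn hne
    (f := fun z : E × E => inner ℝ z.1 z.2) (by fun_prop)
  set μ : ℝ := inner ℝ z₀.1 z₀.2 with hμ
  have hmax' : ∀ z ∈ S, inner ℝ z.1 z.2 ≤ μ := fun z hz => hmax hz
  have hμ0 : 0 ≤ μ := by
    have : (-z₀.1, z₀.2) ∈ S := by
      have hQ : ∀ X Y, z₀ ∈ Q X Y → (-z₀.1, z₀.2) ∈ Q X Y := by
        rintro X Y ⟨h1, h2, h3, h4, h5, h6⟩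
        exact ⟨X.neg_mem h1, h2, Iᗮ.neg_mem h3, h4, by simpa using h5, h6⟩
      rcases hz₀ with (h | h) | h
      · exact Or.inl (Or.inl (hQ _ _ h))
      · exact Or.inl (Or.inr (hQ _ _ h))
      · exact Or.inr (hQ _ _ h)
    have := hmax' _ this
    simp only [inner_neg_left] at this
    linarith
  have hunit : ‖z₀.1‖ = 1 ∧ ‖z₀.2‖ = 1 := by
    rcases hz₀ with (h | h) | h <;> exact ⟨h.2.2.2.2.1, h.2.2.2.2.2⟩
  have hlt : μ < 1 := by
    refine lt_of_le_of_ne ?_ ?_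
    · have := real_inner_le_norm z₀.1 z₀.2
      rw [hunit.1, hunit.2] at this; simpa using this
    · intro h1
      have heq : z₀.1 = z₀.2 := (inner_eq_one_iff_of_norm_eq_one hunit.1 hunit.2).1 h1
      have hzI : z₀.1 ∈ I ∧ z₀.1 ∈ Iᗮ := by
        rcases hz₀ with (h | h) | h <;>
        · obtain ⟨h1, h2, h3, -⟩ := h
          rw [← heq] at h2
          simp only [hI, Submodule.mem_inf] at h1 h2 ⊢
          tauto
      have : inner ℝ z₀.1 z₀.1 = 0 := (Submodule.mem_orthogonal _ _).1 hzI.2 _ hzI.1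
      rw [inner_self_eq_zero] at this
      rw [this] at hunit; simp at hunit
  have hQb : ∀ X Y : Submodule ℝ E, (Q X Y ⊆ S ∨ Q Y X ⊆ S) → ∀ v ∈ X, ‖v‖ = 1 → v ∈ Iᗮ →
      ∀ u ∈ Y, (∀ i ∈ I, inner ℝ u i = 0) → inner ℝ v u ≤ μ * ‖u‖ := by
    intro X Y hXY v hv hv1 hvI u hu huI
    rcases eq_or_ne u 0 with rfl | hu0
    · simp
    have hn : ‖u‖ ≠ 0 := by simpa using hu0
    have hu1 : ‖(‖u‖⁻¹ • u)‖ = 1 := by rw [norm_smul]; simp [hn]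
    have huI' : ‖u‖⁻¹ • u ∈ Iᗮ := Iᗮ.smul_mem _ ((Submodule.mem_orthogonal' _ _).2 huI)
    have : inner ℝ v (‖u‖⁻¹ • u) ≤ μ := by
      rcases hXY with h | h
      · exact hmax' (v, ‖u‖⁻¹ • u) (h ⟨hv, Y.smul_mem _ hu, hvI, huI', hv1, hu1⟩)
      · rw [real_inner_comm]
        exact hmax' (‖u‖⁻¹ • u, v) (h ⟨Y.smul_mem _ hu, hv, huI', hvI, hu1, hv1⟩)
    rw [inner_smul_right] at this
    have hp : 0 < ‖u‖ := by positivity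
    calc inner ℝ v u = (‖u‖⁻¹ * inner ℝ v u) * ‖u‖ := by field_simp
      _ ≤ _ := mul_le_mul_of_nonneg_right this hp.le
  have s1 : Q (A ⊓ B) (A ⊓ C) ⊆ S := fun z hz => Or.inl (Or.inl hz)
  have s2 : Q (A ⊓ B) (B ⊓ C) ⊆ S := fun z hz => Or.inl (Or.inr hz)
  have s3 : Q (A ⊓ C) (B ⊓ C) ⊆ S := fun z hz => Or.inr hz
  have hb : μ ≤ ε + (1 - ε) * μ ^ 2 := by
    rcases hz₀ with (h | h) | h
    · obtain ⟨h1, h2, h3, h4, h5, h6⟩ := h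
      exact inner_le_of_angle (A := A) (by linarith) hε0 hBC h1.2 h2.2 h5 h6
        ((Submodule.mem_orthogonal' _ _).1 h3) ((Submodule.mem_orthogonal' _ _).1 h4)
        (hQb _ _ (Or.inl s2) _ h1 h5 h3) (hQb _ _ (Or.inl s3) _ h2 h6 h4)
    · obtain ⟨h1, h2, h3, h4, h5, h6⟩ := h
      have hI' : B ⊓ A ⊓ C = I := by rw [hI, inf_comm B A]
      exact inner_le_of_angle (A := B) (by linarith) hε0 hAC h1.1 h2.2 h5 h6
        (hI' ▸ (Submodule.mem_orthogonal' _ _).1 h3) (hI' ▸ (Submodule.mem_orthogonal' _ _).1 h4)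
        (hI' ▸ hQb _ _ (Or.inl s1) _ h1 h5 h3) (hI' ▸ hQb _ _ (Or.inr s3) _ h2 h6 h4)
    · obtain ⟨h1, h2, h3, h4, h5, h6⟩ := h
      have hI' : C ⊓ A ⊓ B = I := by
        rw [hI]; ext x; simp only [Submodule.mem_inf]; tauto
      exact inner_le_of_angle (A := C) (by linarith) hε0 hAB h1.1 h2.1 h5 h6
        (hI' ▸ (Submodule.mem_orthogonal' _ _).1 h3) (hI' ▸ (Submodule.mem_orthogonal' _ _).1 h4)
        (hI' ▸ hQb _ _ (Or.inr s1) _ h1 h5 h3) (hI' ▸ hQb _ _ (Or.inr s2) _ h2 h6 h4)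
  intro z hz
  refine (hmax' z hz).trans ?_
  rw [le_div_iff₀ (by linarith)]
  -- The quadratic inequality for μ has the roots 1 and ε/(1 - ε).
  have : 0 ≤ (1 - μ) * (ε - μ * (1 - ε)) := by nlinarith
  have := nonneg_of_mul_nonneg_right this (by linarith)
  linarith

/-- A vector close to three subspaces with pairwise large angles is close to their intersection. -/
lemma exists_mem_inf_inf {A B C : Submodule ℝ E} {ε : ℝ} (hε0 : 0 ≤ ε) (hε : ε < 1 / 2)
    (hAB : AngleLE A B ε) (hAC : AngleLE A C ε) (hBC : AngleLE B C ε) (f : E) {a b c : E}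
    (ha : a ∈ A) (hb : b ∈ B) (hc : c ∈ C) :
    ∃ i ∈ A ⊓ B ⊓ C, (1 - 2 * ε) * ‖f - i‖ ≤ 2 * ‖f - a‖ + ‖f - b‖ + ‖f - c‖ := by
  obtain ⟨u, hu, hu'⟩ := hAB.exists_mem_inf hε0 f ha hb
  obtain ⟨w, hw, hw'⟩ := hAC.exists_mem_inf hε0 f ha hc
  obtain ⟨i, hi, hi'⟩ := (angleLE_inf_inf hε0 hε hAB hAC hBC).exists_mem_inf
    (div_nonneg hε0 (by linarith)) f hu hw
  refine ⟨i, ⟨⟨hi.1.1, hi.1.2⟩, hi.2.2⟩, ?_⟩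
  have h1 : (1 - 2 * ε) = (1 - ε) * (1 - ε / (1 - ε)) := by
    have : 1 - ε ≠ 0 := by linarith
    field_simp; ring
  have h2 := mul_le_mul_of_nonneg_left hi' (show 0 ≤ 1 - ε by linarith)
  rw [h1]
  linarith

end Subspaces

/-! ### Fixed vectors of isometries of finite order, and a spectral gap -/

section Isometries

variable {E : Type*} [NormedAddCommGroup E] [InnerProductSpace ℝ E]

lemma isometry_mul_apply (x y : E ≃ₗᵢ[ℝ] E) (v : E) : (x * y) v = x (y v) := rfl

lemma isometry_one_apply (v : E) : (1 : E ≃ₗᵢ[ℝ] E) v = v := rfl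

/-- The vectors fixed by a linear isometry. -/
def fixedSpace (x : E ≃ₗᵢ[ℝ] E) : Submodule ℝ E where
  carrier := {v | x v = v}
  add_mem' {a b} ha hb := by
    change x (a + b) = a + b
    rw [map_add, show x a = a from ha, show x b = b from hb]
  zero_mem' := map_zero x
  smul_mem' c a ha := by
    change x (c • a) = c • a
    rw [map_smul, show x a = a from ha]

lemma mem_fixedSpace {x : E ≃ₗᵢ[ℝ] E} {v : E} : v ∈ fixedSpace x ↔ x v = v := Iff.rfl

/-- The sum of the first `p` translates of a vector under the powers of an isometry. -/
def orbitSum (p : ℕ) (x : E ≃ₗᵢ[ℝ] E) (v : E) : E := ∑ i ∈ Finset.range p, (x ^ i) v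

lemma apply_orbitSum {p : ℕ} {x : E ≃ₗᵢ[ℝ] E} (hx : x ^ p = 1) (v : E) :
    x (orbitSum p x v) = orbitSum p x v := by
  have h1 : x (orbitSum p x v) = ∑ i ∈ Finset.range p, (x ^ (i + 1)) v := by
    simp [orbitSum, map_sum, pow_succ', isometry_mul_apply]
  have h2 := Finset.sum_range_succ (fun i => (x ^ i) v) p
  rw [Finset.sum_range_succ', hx] at h2
  rw [h1, orbitSum]
  simpa using h2

lemma pow_apply_of_fixed {x : E ≃ₗᵢ[ℝ] E} {v : E} (h : x v = v) (i : ℕ) : (x ^ i) v = v := by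
  induction i with
  | zero => simp
  | succ i ih => rw [pow_succ', isometry_mul_apply, ih, h]

lemma orbitSum_of_fixed {p : ℕ} {x : E ≃ₗᵢ[ℝ] E} {v : E} (h : x v = v) :
    orbitSum p x v = (p : ℝ) • v := by
  simp [orbitSum, pow_apply_of_fixed h, Nat.cast_smul_eq_nsmul]

lemma inner_orbitSum_right {p : ℕ} {x : E ≃ₗᵢ[ℝ] E} {w : E} (hw : x w = w) (v : E) :
    inner ℝ w (orbitSum p x v) = p * inner ℝ w v := by
  rw [orbitSum, inner_sum]
  have : ∀ i ∈ Finset.range p, inner ℝ w ((x ^ i) v) = inner ℝ w v := by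
    intro i _
    conv_lhs => rw [← pow_apply_of_fixed hw i]
    exact (x ^ i).inner_map_map w v
  rw [Finset.sum_congr rfl this]; simp

lemma norm_pow_apply_sub_le (x : E ≃ₗᵢ[ℝ] E) (v : E) (i : ℕ) :
    ‖(x ^ i) v - v‖ ≤ i * ‖x v - v‖ := by
  induction i with
  | zero => simp
  | succ i ih =>
    have : (x ^ (i + 1)) v - v = x ((x ^ i) v - v) + (x v - v) := by
      rw [pow_succ', isometry_mul_apply, map_sub]; abel
    rw [this]
    refine (norm_add_le _ _).trans ?_
    rw [LinearIsometryEquiv.norm_map]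
    push_cast
    linarith

lemma exists_mem_fixedSpace {p : ℕ} (hp : 0 < p) {x : E ≃ₗᵢ[ℝ] E} (hx : x ^ p = 1) (f : E) :
    ∃ a ∈ fixedSpace x, ‖f - a‖ ≤ p * ‖x f - f‖ := by
  have hp' : (0 : ℝ) < p := by exact_mod_cast hp
  refine ⟨(p : ℝ)⁻¹ • orbitSum p x f, ?_, ?_⟩
  · rw [mem_fixedSpace, map_smul, apply_orbitSum hx]
  · have : f - (p : ℝ)⁻¹ • orbitSum p x f
        = (p : ℝ)⁻¹ • ∑ i ∈ Finset.range p, (f - (x ^ i) f) := by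
      rw [Finset.sum_sub_distrib, smul_sub]
      congr 1
      simp [← Nat.cast_smul_eq_nsmul ℝ, smul_smul, hp'.ne']
    rw [this, norm_smul, Real.norm_of_nonneg (by positivity)]
    have h2 : ‖∑ i ∈ Finset.range p, (f - (x ^ i) f)‖ ≤ ∑ i ∈ Finset.range p, p * ‖x f - f‖ := by
      refine norm_sum_le_of_le _ fun i hi => ?_
      rw [norm_sub_rev]
      refine (norm_pow_apply_sub_le x f i).trans ?_
      gcongr
      exact (Finset.mem_range.1 hi).le
    rw [Finset.sum_const, Finset.card_range, nsmul_eq_mul] at h2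
    calc (p : ℝ)⁻¹ * _ ≤ (p : ℝ)⁻¹ * (p * (p * ‖x f - f‖)) := by gcongr
      _ = _ := by field_simp

/-- Two isometries of prime order `p` whose commutator commutes with both: the fixed spaces meet
at an angle of cosine at most `1 / √p`. -/
lemma angleLE_fixedSpace {p : ℕ} (hp : p.Prime) {x y c : E ≃ₗᵢ[ℝ] E} (hx : x ^ p = 1)
    (hy : y ^ p = 1) (hxy : x * y = c * y * x) (hcx : Commute c x) (hcy : Commute c y)
    {ε : ℝ} (hε0 : 0 ≤ ε) (hε : 1 ≤ p * ε ^ 2) :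
    AngleLE (fixedSpace x) (fixedSpace y) ε := by
  have hp' : (0 : ℝ) < p := by exact_mod_cast hp.pos
  have hxy1 : ∀ i : ℕ, x ^ i * y = c ^ i * y * x ^ i := by
    intro i
    induction i with
    | zero => simp
    | succ i ih =>
      rw [pow_succ, mul_assoc, hxy, ← mul_assoc, ← mul_assoc, ((hcx.pow_right i).eq).symm,
        mul_assoc c, ih, pow_succ' c]
      simp only [mul_assoc]
  have hxyij : ∀ i j : ℕ, x ^ i * y ^ j = c ^ (i * j) * y ^ j * x ^ i := by
    intro i j
    induction j with
    | zero => simp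
    | succ j ih =>
      rw [pow_succ, ← mul_assoc, ih, mul_assoc, hxy1, ← mul_assoc, ← mul_assoc]
      have : c ^ (i * j) * y ^ j * c ^ i = c ^ (i * (j + 1)) * y ^ j := by
        rw [mul_assoc, ((hcy.pow_pow i j).eq).symm, ← mul_assoc, ← pow_add]; rfl
      rw [this]; simp only [mul_assoc]
  have hc : c ^ p = 1 := by
    have := hxy1 p
    rw [hx] at this
    simpa using this.symm
  intro v hv w hw _ hwo
  have hv : x v = v := hv
  have hw : y w = w := hw
  -- Averaging over the powers of `c` splits `v` into a part `v₀`, on whose translates `x` and `y`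
  -- commute, and a part `u` whose translates under `c` sum to zero.
  set v₀ := (p : ℝ)⁻¹ • orbitSum p c v with hv₀
  set u := v - v₀ with hu
  have hcv₀ : c v₀ = v₀ := by rw [hv₀, map_smul, apply_orbitSum hc]
  have hxv₀ : x v₀ = v₀ := by
    rw [hv₀, map_smul, orbitSum, map_sum]
    congr 1
    refine Finset.sum_congr rfl fun i _ => ?_
    rw [← isometry_mul_apply, ← (hcx.pow_left i).eq, isometry_mul_apply, hv]
  have hxu : x u = u := by rw [hu, map_sub, hv, hxv₀]
  have hSu : orbitSum p c u = 0 := by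
    have : orbitSum p c u = orbitSum p c v - orbitSum p c v₀ := by
      simp [orbitSum, hu, map_sub]
    rw [this, orbitSum_of_fixed hcv₀, hv₀, smul_smul, mul_inv_cancel₀ hp'.ne', one_smul, sub_self]
  -- As `x` fixes `u`, applying `x ^ i` to `(y ^ j) u` only inserts `c ^ (i * j)`, so the inner
  -- product with `u` does not depend on `i`. Summed over `i` it vanishes, because `c ^ j` generates
  -- the same group as `c`.
  have hyu : ∀ j, 0 < j → j < p → inner ℝ u ((y ^ j) u) = 0 := by
    intro j hj0 hjp
    have hcj : (c ^ j) ^ p = 1 := by rw [← pow_mul, mul_comm, pow_mul, hc, one_pow]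
    have hS : orbitSum p (c ^ j) u = 0 := by
      set S := orbitSum p (c ^ j) u with hS
      have h1 : (c ^ j) S = S := apply_orbitSum hcj u
      have h2 : c S = S := by
        have hcop : j.Coprime p :=
          Nat.Coprime.symm ((Nat.Prime.coprime_iff_not_dvd hp).2 (Nat.not_dvd_of_pos_of_lt hj0 hjp))
        obtain ⟨m, hm⟩ := Nat.exists_mul_mod_eq_one_of_coprime hcop hp.one_lt
        have h3 := pow_apply_of_fixed h1 m
        rw [← pow_mul] at h3
        have h4 : c ^ (j * m) = c := by
          conv_lhs => rw [← Nat.div_add_mod (j * m) p, hm.2, pow_add, pow_mul, hc]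
          simp
        rwa [h4] at h3
      have h5 : orbitSum p c S = ∑ i ∈ Finset.range p, ((c ^ j) ^ i) (orbitSum p c u) := by
        simp only [orbitSum, hS, map_sum]
        rw [Finset.sum_comm]
        refine Finset.sum_congr rfl fun i _ => Finset.sum_congr rfl fun l _ => ?_
        rw [← isometry_mul_apply, ← isometry_mul_apply, ← pow_mul,
          ← pow_add, ← pow_add, add_comm]
      rw [hSu, orbitSum_of_fixed h2] at h5
      simpa [hp'.ne'] using h5
    have h6 : ∀ i ∈ Finset.range p, inner ℝ u ((y ^ j) (((c ^ j) ^ i) u)) =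
        inner ℝ u ((y ^ j) u) := by
      intro i _
      have e : (x ^ i) ((y ^ j) u) = (y ^ j) (((c ^ j) ^ i) u) := by
        have := congrArg (fun g : E ≃ₗᵢ[ℝ] E => g u) (hxyij i j)
        simp only [isometry_mul_apply] at this
        rw [this, pow_apply_of_fixed hxu, ← pow_mul, mul_comm j i]
        exact congrArg (fun g : E ≃ₗᵢ[ℝ] E => g u) (hcy.pow_pow (i * j) j).eq
      rw [← e, ← (x ^ i).inner_map_map u ((y ^ j) u), pow_apply_of_fixed hxu]
    have h7 := Finset.sum_congr rfl h6
    rw [← inner_sum, ← map_sum] at h7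
    change inner ℝ u ((y ^ j) (orbitSum p (c ^ j) u)) = _ at h7
    rw [hS] at h7
    simp only [map_zero, inner_zero_right, Finset.sum_const, Finset.card_range, nsmul_eq_mul] at h7
    have := mul_eq_zero.1 h7.symm
    exact this.resolve_left hp'.ne'
  -- The translates of `u` under `y` are pairwise orthogonal; this is the source of the gain 1/√p.
  have hnorm : ‖orbitSum p y u‖ ^ 2 = p * ‖u‖ ^ 2 := by
    have h1 : inner ℝ (orbitSum p y u) (orbitSum p y u) = p * inner ℝ (orbitSum p y u) u :=
      inner_orbitSum_right (apply_orbitSum hy u) u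
    rw [real_inner_self_eq_norm_sq] at h1
    rw [h1, real_inner_comm, orbitSum, inner_sum]
    rw [Finset.sum_eq_single_of_mem 0 (Finset.mem_range.2 hp.pos) (fun j hj hj0 =>
      hyu j (Nat.pos_of_ne_zero hj0) (Finset.mem_range.1 hj))]
    simp
  have hnorm' : ‖orbitSum p y u‖ ≤ p * ε * ‖u‖ := by
    refine le_of_sq_le_sq ?_ (by positivity)
    rw [hnorm]
    nlinarith [mul_le_mul_of_nonneg_right hε (show 0 ≤ (p : ℝ) * ‖u‖ ^ 2 by positivity)]
  -- The sum of the `y`-translates of `v₀` is fixed by both `x` and `y`, hence orthogonal to `w`.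
  have hv₀w : inner ℝ w v₀ = 0 := by
    have h1 : inner ℝ w (orbitSum p y v₀) = p * inner ℝ w v₀ := inner_orbitSum_right hw v₀
    rw [hwo] at h1
    · have := mul_eq_zero.1 h1.symm
      exact this.resolve_left hp'.ne'
    · refine ⟨?_, apply_orbitSum hy v₀⟩
      change x _ = _
      rw [orbitSum, map_sum]
      refine Finset.sum_congr rfl fun j _ => ?_
      have := hxyij 1 j
      rw [pow_one, one_mul] at this
      rw [← isometry_mul_apply, this, (hcy.pow_pow j j).eq,
        isometry_mul_apply, hxv₀, isometry_mul_apply,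
        pow_apply_of_fixed hcv₀]
  have hwu : inner ℝ w u ≤ ε * (‖u‖ * ‖w‖) := by
    have h1 : inner ℝ w (orbitSum p y u) = p * inner ℝ w u := inner_orbitSum_right hw u
    have h2 := real_inner_le_norm w (orbitSum p y u)
    have h3 := mul_le_mul_of_nonneg_left hnorm' (norm_nonneg w)
    have : (p : ℝ) * inner ℝ w u ≤ p * (ε * (‖u‖ * ‖w‖)) := by nlinarith
    exact le_of_mul_le_mul_left this hp'
  have huv : ‖u‖ ≤ ‖v‖ := by
    have h1 : inner ℝ v₀ u = 0 := by
      have h1 : inner ℝ v₀ (orbitSum p c u) = p * inner ℝ v₀ u := inner_orbitSum_right hcv₀ u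
      rw [hSu, inner_zero_right] at h1
      exact (mul_eq_zero.1 h1.symm).resolve_left hp'.ne'
    have h2 : v = v₀ + u := by rw [hu]; abel
    have h3 : ‖v‖ ^ 2 = ‖v₀‖ ^ 2 + ‖u‖ ^ 2 := by rw [h2, norm_add_sq_real, h1]; ring
    exact le_of_sq_le_sq (by nlinarith [sq_nonneg ‖v₀‖]) (norm_nonneg _)
  calc inner ℝ v w = inner ℝ w u := by
        rw [real_inner_comm, hu, inner_sub_right, hv₀w, sub_zero]
    _ ≤ ε * (‖u‖ * ‖w‖) := hwu
    _ ≤ ε * (‖v‖ * ‖w‖) := by gcongr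

/-- A spectral gap for three conjugate isometries of order five that pairwise generate
a Heisenberg group, together with the isometry of order three that permutes them. -/
lemma exists_fixed_near [FiniteDimensional ℝ E] {x t c : E ≃ₗᵢ[ℝ] E} (hx : x ^ 5 = 1)
    (ht : t ^ 3 = 1) (hc : x * (t * x * t⁻¹) = c * (t * x * t⁻¹) * x) (hcx : Commute c x)
    (hcy : Commute c (t * x * t⁻¹)) (f : E) :
    ∃ a, x a = a ∧ t a = a ∧ ‖f - a‖ ≤ 1600 * (‖x f - f‖ + ‖t f - f‖) := by
  set y := t * x * t⁻¹ with hy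
  set z := t * y * t⁻¹ with hz
  have htz : t * z * t⁻¹ = x := by
    have : t * z * t⁻¹ = t ^ 3 * x * (t ^ 3)⁻¹ := by
      rw [hz, hy, pow_succ, pow_two]; simp only [mul_assoc, mul_inv_rev]
    rw [this, ht]; simp
  have conj5 : ∀ g : E ≃ₗᵢ[ℝ] E, g ^ 5 = 1 → (t * g * t⁻¹) ^ 5 = 1 := by
    intro g hg; rw [conj_pow, hg]; group
  have hy5 : y ^ 5 = 1 := conj5 x hx
  have hz5 : z ^ 5 = 1 := conj5 y hy5
  have hp5 : Nat.Prime 5 := by norm_num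
  -- The bound 9/20 lies between 1/√5 and 1/2, and leaves 1 - 2ε = 1/10.
  have hε0 : (0 : ℝ) ≤ 9 / 20 := by norm_num
  have hε : (1 : ℝ) ≤ (5 : ℕ) * (9 / 20) ^ 2 := by norm_num
  have conjc : ∀ {g h c : E ≃ₗᵢ[ℝ] E}, g * h = c * h * g →
      (t * g * t⁻¹) * (t * h * t⁻¹) = (t * c * t⁻¹) * (t * h * t⁻¹) * (t * g * t⁻¹) := by
    intro g h c e
    have : (t * g * t⁻¹) * (t * h * t⁻¹) = t * (g * h) * t⁻¹ := by group
    rw [this, e]; group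
  have conjm : ∀ {g h : E ≃ₗᵢ[ℝ] E}, Commute g h → Commute (t * g * t⁻¹) (t * h * t⁻¹) := by
    intro g h e
    rw [Commute, SemiconjBy, show t * g * t⁻¹ * (t * h * t⁻¹) = t * (g * h) * t⁻¹ by group, e.eq]
    group
  have aXY : AngleLE (fixedSpace x) (fixedSpace y) (9 / 20) :=
    angleLE_fixedSpace hp5 hx hy5 hc hcx hcy hε0 hε
  have aYZ : AngleLE (fixedSpace y) (fixedSpace z) (9 / 20) :=
    angleLE_fixedSpace hp5 hy5 hz5 (conjc hc) (conjm hcx) (conjm hcy) hε0 hε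
  have aZX : AngleLE (fixedSpace z) (fixedSpace x) (9 / 20) := by
    have h1 := conjc (conjc hc)
    have h2 := conjm (conjm hcx)
    have h3 := conjm (conjm hcy)
    rw [← hy, ← hz, htz] at h1
    rw [← hy, ← hz] at h2
    rw [← hz, htz] at h3
    exact angleLE_fixedSpace hp5 hz5 hx h1 h2 h3 hε0 hε
  have hconj : ∀ g : E ≃ₗᵢ[ℝ] E, ‖(t * g * t⁻¹) f - f‖ ≤ ‖g f - f‖ + 2 * ‖t f - f‖ := by
    intro g
    have e : (t * g * t⁻¹) f - f = t (g (t⁻¹ f - f)) + (t (g f - f) + (t f - f)) := by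
      simp only [isometry_mul_apply, map_sub]; abel
    have e2 : ‖t⁻¹ f - f‖ = ‖t f - f‖ := by
      rw [← t.norm_map (t⁻¹ f - f), map_sub, ← isometry_mul_apply, mul_inv_cancel,
        isometry_one_apply, norm_sub_rev]
    rw [e]
    refine (norm_add_le _ _).trans ?_
    have := norm_add_le (t (g f - f)) (t f - f)
    rw [LinearIsometryEquiv.norm_map, LinearIsometryEquiv.norm_map, e2]
    rw [LinearIsometryEquiv.norm_map] at this
    linarith
  have dy := hconj x
  have dz := hconj y
  rw [← hy] at dy
  rw [← hz] at dz
  obtain ⟨a, ha, ha'⟩ := exists_mem_fixedSpace (by norm_num) hx f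
  obtain ⟨b, hb, hb'⟩ := exists_mem_fixedSpace (by norm_num) hy5 f
  obtain ⟨d, hd, hd'⟩ := exists_mem_fixedSpace (by norm_num) hz5 f
  obtain ⟨i, hi, hi'⟩ := exists_mem_inf_inf hε0 (by norm_num) aXY aZX.symm aYZ f ha hb hd
  have hix : x i = i := hi.1.1
  have hiy : y i = i := hi.1.2
  have hiz : z i = i := hi.2
  -- Averaging over five powers costs a factor 5, and conjugating once or twice adds 2 or 4 times ‖t
  -- f - f‖. Dividing by 1/10 gives 10·5·(2 + 1 + 1) = 200 and 10·5·(2 + 4) = 300.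
  have hfi : ‖f - i‖ ≤ 200 * ‖x f - f‖ + 300 * ‖t f - f‖ := by
    norm_num at ha' hb' hd'
    linarith
  obtain ⟨j, hj, hj'⟩ := exists_mem_fixedSpace (by norm_num) ht i
  have htt : t⁻¹ = t ^ 2 := by
    rw [inv_eq_iff_mul_eq_one, ← pow_succ']; exact ht
  -- Averaging over `t` preserves invariance under `x`: conjugation by `t` permutes `x`, `y`, `z`
  -- cyclically, and all three fix `i`.
  refine ⟨(3 : ℝ)⁻¹ • orbitSum 3 t i, ?_, ?_, ?_⟩
  · rw [map_smul]
    congr 1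
    have h1 : x (t i) = t i := by
      conv_lhs => rw [← htz]
      simp only [isometry_mul_apply]
      rw [← isometry_mul_apply t⁻¹, inv_mul_cancel, isometry_one_apply, hiz]
    have h2 : x (t (t i)) = t (t i) := by
      have : x = t * (t * y * t⁻¹) * t⁻¹ := htz.symm
      conv_lhs => rw [this]
      simp only [isometry_mul_apply]
      rw [← isometry_mul_apply t⁻¹ t, inv_mul_cancel, isometry_one_apply,
        ← isometry_mul_apply t⁻¹ t, inv_mul_cancel, isometry_one_apply, hiy]
    simp [orbitSum, Finset.sum_range_succ, pow_succ, isometry_mul_apply, map_add, hix,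
      h1, h2]
  · rw [map_smul, apply_orbitSum ht]
  · have h3 : i - (3 : ℝ)⁻¹ • orbitSum 3 t i
        = (3 : ℝ)⁻¹ • ((i - t i) + (i - (t ^ 2) i)) := by
      simp only [orbitSum, Finset.sum_range_succ, Finset.sum_range_zero, pow_zero, pow_one,
        isometry_one_apply, zero_add]
      module
    have h4 : ‖i - (3 : ℝ)⁻¹ • orbitSum 3 t i‖ ≤ ‖t i - i‖ := by
      rw [h3, norm_smul]
      have a1 := norm_pow_apply_sub_le t i 2
      have a2 := norm_add_le (i - t i) (i - (t ^ 2) i)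
      rw [norm_sub_rev i, norm_sub_rev i] at a2
      norm_num at a1 ⊢
      linarith
    have h5 : ‖t i - i‖ ≤ ‖t f - f‖ + 2 * ‖f - i‖ := by
      have e : t i - i = -t (f - i) + ((t f - f) + (f - i)) := by rw [map_sub]; abel
      rw [e]
      refine (norm_add_le _ _).trans ?_
      have := norm_add_le (t f - f) (f - i)
      rw [norm_neg, LinearIsometryEquiv.norm_map]
      linarith
    have h6 : ‖f - (3 : ℝ)⁻¹ • orbitSum 3 t i‖ ≤ ‖f - i‖ + ‖i - (3 : ℝ)⁻¹ • orbitSum 3 t i‖ := by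
      have : f - (3 : ℝ)⁻¹ • orbitSum 3 t i = (f - i) + (i - (3 : ℝ)⁻¹ • orbitSum 3 t i) := by abel
      rw [this]; exact norm_add_le _ _
    have := norm_nonneg (x f - f)
    have := norm_nonneg (t f - f)
    linarith

end Isometries

/-! ### From the spectral gap to edge expansion -/

section Permutations

variable {W : Type*} [Fintype W]

/-- The permutation representation on `ℓ²(W)`. -/
noncomputable def permIso (σ : Equiv.Perm W) : EuclideanSpace ℝ W ≃ₗᵢ[ℝ] EuclideanSpace ℝ W :=
  LinearIsometryEquiv.piLpCongrLeft 2 ℝ ℝ σ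

lemma permIso_apply (σ : Equiv.Perm W) (f : EuclideanSpace ℝ W) (s : W) :
    permIso σ f s = f (σ⁻¹ s) := by
  simp [permIso, LinearIsometryEquiv.piLpCongrLeft_apply]

/-- The permutation representation as a group homomorphism. -/
noncomputable def permIsoHom :
    Equiv.Perm W →* (EuclideanSpace ℝ W ≃ₗᵢ[ℝ] EuclideanSpace ℝ W) where
  toFun := permIso
  map_one' := by ext f s; rw [permIso_apply]; rfl
  map_mul' σ τ := by
    ext f s
    rw [isometry_mul_apply, permIso_apply, permIso_apply, permIso_apply]
    rw [mul_inv_rev]; rfl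

-- A permutation of a finite set moves as many points into `U` as out of it.
open Classical in
lemma card_moved_out (σ : Equiv.Perm W) (U : Finset W) :
    (Finset.univ.filter fun s => s ∉ U ∧ σ s ∈ U).card = (U.filter fun s => σ s ∉ U).card := by
  have h1 : (Finset.univ.filter fun s => σ s ∈ U).card = U.card :=
    Finset.card_bij (fun s _ => σ s) (by simp) (by simp)
      (fun b hb => ⟨σ.symm b, by simpa using hb, by simp⟩)
  have h2 := Finset.card_filter_add_card_filter_not (s := U) (fun s => σ s ∈ U)
  have h3 := Finset.card_filter_add_card_filter_not
    (s := Finset.univ.filter fun s => σ s ∈ U) (fun s => s ∈ U)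
  rw [Finset.filter_filter, Finset.filter_filter] at h3
  have h4 : (Finset.univ.filter fun s => σ s ∈ U ∧ s ∈ U) = U.filter fun s => σ s ∈ U := by
    ext s; simp [and_comm]
  have h5 : (Finset.univ.filter fun s => σ s ∈ U ∧ s ∉ U)
      = Finset.univ.filter fun s => s ∉ U ∧ σ s ∈ U := by
    ext s; simp [and_comm]
  rw [h4, h5] at h3
  omega

/-- Edge expansion of the permutation graph of two generators of a group as in
`exists_fixed_near`. -/
theorem expansion_of_perm {x t c : Equiv.Perm W} (hx : x ^ 5 = 1)
    (ht : t ^ 3 = 1) (hc : x * (t * x * t⁻¹) = c * (t * x * t⁻¹) * x) (hcx : Commute c x)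
    (hcy : Commute c (t * x * t⁻¹))
    (htrans : ∀ S : Set W, S.Nonempty → (∀ s ∈ S, x s ∈ S ∧ t s ∈ S) → S = Set.univ)
    [DecidableEq W] (U : Finset W) :
    min U.card Uᶜ.card ≤
      30000000 * ((U.filter fun s => x s ∉ U).card + (U.filter fun s => t s ∉ U).card) := by
  set f : EuclideanSpace ℝ W := WithLp.toLp 2 (fun s => if s ∈ U then (1 : ℝ) else 0) with hf
  have hD : ∀ σ : Equiv.Perm W,
      ‖permIsoHom σ f - f‖ ^ 2 = 2 * ((U.filter fun s => σ s ∉ U).card : ℝ) := by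
    intro σ
    rw [EuclideanSpace.norm_sq_eq]
    have h1 : ∑ s, ‖(permIsoHom σ f - f) s‖ ^ 2 = ∑ s, ‖(permIsoHom σ f - f) (σ s)‖ ^ 2 :=
      (Equiv.sum_comp σ _).symm
    have h2 : ∀ s, ‖(permIsoHom σ f - f) (σ s)‖ ^ 2 =
        (if s ∈ U ∧ σ s ∉ U then (1 : ℝ) else 0) + (if s ∉ U ∧ σ s ∈ U then (1 : ℝ) else 0) := by
      intro s
      rw [PiLp.sub_apply]
      change ‖permIso σ f (σ s) - f (σ s)‖ ^ 2 = _
      rw [permIso_apply]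
      rw [show σ⁻¹ (σ s) = s from σ.symm_apply_apply s]
      simp only [hf]
      by_cases a : s ∈ U <;> by_cases b : σ s ∈ U <;> simp [a, b]
    rw [h1, Finset.sum_congr rfl fun s _ => h2 s, Finset.sum_add_distrib]
    simp only [Finset.sum_boole]
    have h3 := card_moved_out σ U
    have h4 : (Finset.univ.filter fun s => s ∈ U ∧ σ s ∉ U) = U.filter fun s => σ s ∉ U := by
      ext s; simp
    rw [h4]
    have h5 : ((Finset.univ.filter fun s => s ∉ U ∧ σ s ∈ U).card : ℝ)
        = (U.filter fun s => σ s ∉ U).card := by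
      norm_cast
      convert h3
    rw [h5]; ring
  obtain ⟨a, hxa, hta, hfa⟩ := exists_fixed_near (x := permIsoHom x) (t := permIsoHom t)
    (c := permIsoHom c) (by rw [← map_pow, hx, map_one]) (by rw [← map_pow, ht, map_one])
    (by simp only [← map_mul, ← map_inv]; rw [hc]) (hcx.map _)
    (by simp only [← map_mul, ← map_inv]; exact hcy.map _) f
  have hinv : ∀ σ : Equiv.Perm W, permIsoHom σ a = a → ∀ s, a (σ s) = a s := by
    intro σ h s
    have := congrArg (fun g : EuclideanSpace ℝ W => g (σ s)) h
    change permIso σ a (σ s) = a (σ s) at this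
    rw [permIso_apply] at this
    simpa using this.symm
  rcases isEmpty_or_nonempty W with hE | ⟨⟨s₀⟩⟩
  · simp [Finset.eq_empty_of_isEmpty U]
  -- A vector invariant under both generators is constant on orbits, so transitivity makes it
  -- constant.
  have hconst : ∀ s, a s = a s₀ := by
    have := htrans {s | a s = a s₀} ⟨s₀, rfl⟩ (fun s hs => ⟨(hinv x hxa s).trans hs,
      (hinv t hta s).trans hs⟩)
    intro s
    have h : s ∈ ({s | a s = a s₀} : Set W) := this ▸ Set.mem_univ s
    exact h
  have hnorm : ‖f - a‖ ^ 2 = U.card * (1 - a s₀) ^ 2 + Uᶜ.card * (a s₀) ^ 2 := by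
    rw [EuclideanSpace.norm_sq_eq, ← Finset.sum_add_sum_compl U]
    congr 1
    · rw [Finset.sum_congr rfl (g := fun _ => (1 - a s₀) ^ 2)]
      · simp
      · intro s hs
        rw [PiLp.sub_apply, hconst s]; simp [hf, hs]
    · rw [Finset.sum_congr rfl (g := fun _ => (a s₀) ^ 2)]
      · simp
      · intro s hs
        rw [Finset.mem_compl] at hs
        rw [PiLp.sub_apply, hconst s]; simp [hf, hs]
  have hsq : ‖f - a‖ ^ 2 ≤ 1600 ^ 2 * (2 * (‖permIsoHom x f - f‖ ^ 2 + ‖permIsoHom t f - f‖ ^ 2)) := by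
    have h1 := pow_le_pow_left₀ (norm_nonneg _) hfa 2
    rw [mul_pow] at h1
    nlinarith [sq_nonneg (‖permIsoHom x f - f‖ - ‖permIsoHom t f - f‖)]
  rw [hnorm, hD, hD] at hsq
  have hmin1 : ((min U.card Uᶜ.card : ℕ) : ℝ) ≤ U.card := by exact_mod_cast min_le_left _ _
  have hmin2 : ((min U.card Uᶜ.card : ℕ) : ℝ) ≤ Uᶜ.card := by exact_mod_cast min_le_right _ _
  -- Since (1 - a)² + a² ≥ 1/2, half of the minimum is at most ‖f - a‖². This yields the constant
  -- 8·1600², rounded up.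
  have hfin : ((min U.card Uᶜ.card : ℕ) : ℝ) ≤
      30000000 * (((U.filter fun s => x s ∉ U).card : ℝ) + (U.filter fun s => t s ∉ U).card) := by
    have h1 := mul_le_mul_of_nonneg_right hmin1 (sq_nonneg (1 - a s₀))
    have h2 := mul_le_mul_of_nonneg_right hmin2 (sq_nonneg (a s₀))
    have h3 : ((min U.card Uᶜ.card : ℕ) : ℝ) * (1 / 2) ≤
        ((min U.card Uᶜ.card : ℕ) : ℝ) * ((1 - a s₀) ^ 2 + (a s₀) ^ 2) :=
      mul_le_mul_of_nonneg_left (by nlinarith [sq_nonneg (1 - 2 * a s₀)]) (by positivity)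
    have h4 : (0 : ℝ) ≤ ((U.filter fun s => x s ∉ U).card : ℝ) := by positivity
    have h5 : (0 : ℝ) ≤ ((U.filter fun s => t s ∉ U).card : ℝ) := by positivity
    linarith
  exact_mod_cast hfin

end Permutations

/-- A vertex-transitive expander that is 4-regular and decomposed into short cycles: the
neighbours of `s` are `perm b s` and `(perm b)⁻¹ s`. -/
structure CycleExpander (W : Type*) [Fintype W] [DecidableEq W] where
  perm : Fin 2 → Equiv.Perm W
  pow_eq_one : ∀ b, perm b ^ 15 = 1
  apply_ne : ∀ b s, perm b s ≠ s
  apply_apply_ne : ∀ b s, perm b (perm b s) ≠ s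
  zero_ne_one : ∀ s, perm 0 s ≠ perm 1 s
  zero_one_ne : ∀ s, perm 0 (perm 1 s) ≠ s
  symm_zero_ne_symm_one : ∀ s, (perm 0).symm s ≠ (perm 1).symm s
  transitive : ∀ s t, ∃ σ : Equiv.Perm W, σ s = t ∧ ∀ b w, σ (perm b w) = perm b (σ w)
  expansion : ∀ U : Finset W, min U.card Uᶜ.card ≤
    30000000 * ((U.filter fun s => perm 0 s ∉ U).card + (U.filter fun s => perm 1 s ∉ U).card)

/-- Transport along a bijection. -/
def CycleExpander.congr {W W' : Type*} [Fintype W] [DecidableEq W] [Fintype W'] [DecidableEq W']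
    (X : CycleExpander W) (e : W ≃ W') : CycleExpander W' where
  perm b := e.permCongrHom (X.perm b)
  pow_eq_one b := by rw [← map_pow, X.pow_eq_one, map_one]
  apply_ne b s := by
    simpa [Equiv.permCongrHom, Equiv.permCongr_apply, ← Equiv.eq_symm_apply] using
      X.apply_ne b (e.symm s)
  apply_apply_ne b s := by
    simpa [Equiv.permCongrHom, Equiv.permCongr_apply, ← Equiv.eq_symm_apply] using
      X.apply_apply_ne b (e.symm s)
  zero_ne_one s := by
    simpa [Equiv.permCongrHom, Equiv.permCongr_apply] using X.zero_ne_one (e.symm s)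
  zero_one_ne s := by
    simpa [Equiv.permCongrHom, Equiv.permCongr_apply, ← Equiv.eq_symm_apply] using
      X.zero_one_ne (e.symm s)
  symm_zero_ne_symm_one s := by
    intro h
    apply X.symm_zero_ne_symm_one (e.symm s)
    exact e.injective h
  transitive s t := by
    obtain ⟨σ, h1, h2⟩ := X.transitive (e.symm s) (e.symm t)
    refine ⟨e.permCongr σ, ?_, ?_⟩
    · simp [Equiv.permCongr_apply, h1]
    · intro b w
      simp [Equiv.permCongrHom, Equiv.permCongr_apply, h2]
  expansion U := by
    have h := X.expansion (U.map e.symm.toEmbedding)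
    have hc : (U.map e.symm.toEmbedding)ᶜ = Uᶜ.map e.symm.toEmbedding := by
      ext s; simp [Finset.mem_map_equiv]
    rw [hc] at h
    have hf : ∀ b, ((U.map e.symm.toEmbedding).filter
        fun s => X.perm b s ∉ U.map e.symm.toEmbedding).card
        = (U.filter fun s => e.permCongrHom (X.perm b) s ∉ U).card := by
      intro b
      rw [Finset.filter_map, Finset.card_map]
      congr 1
      ext s
      rw [Finset.mem_filter, Finset.mem_filter]
      simp [Finset.mem_map_equiv, Equiv.permCongrHom, Equiv.permCongr_apply]
    rw [hf, hf] at h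
    simpa using h

/-- Right translations as a homomorphism. -/
def rightTranslation (G : Type*) [Group G] : G →* Equiv.Perm G where
  toFun g := Equiv.mulRight g⁻¹
  map_one' := by ext; simp
  map_mul' a b := by ext; simp [mul_assoc]

lemma rightTranslation_apply {G : Type*} [Group G] (g s : G) :
    rightTranslation G g s = s * g⁻¹ := rfl

lemma rightTranslation_symm_apply {G : Type*} [Group G] (g s : G) :
    (rightTranslation G g).symm s = s * g := by
  rw [Equiv.symm_apply_eq, rightTranslation_apply]; simp

/-- The Cayley graph of a group generated by `x` of order five and `t` of order three, where
`x` and `t x t⁻¹` generate a Heisenberg group. -/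
noncomputable def cayleyExpander {G : Type*} [Group G] [Fintype G] [DecidableEq G] {x t c : G}
    (hx : x ^ 5 = 1) (ht : t ^ 3 = 1) (hc : x * (t * x * t⁻¹) = c * (t * x * t⁻¹) * x)
    (hcx : Commute c x) (hcy : Commute c (t * x * t⁻¹))
    (hx1 : x * x ≠ 1) (ht1 : t ≠ 1) (hxt : x ≠ t) (hxt' : x * t ≠ 1)
    (htop : Subgroup.closure {x, t} = ⊤) : CycleExpander G where
  perm b := rightTranslation G (if b = 0 then x else t)
  pow_eq_one b := by
    rw [← map_pow]
    have : (if b = 0 then x else t) ^ 15 = 1 := by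
      split_ifs
      · rw [show 15 = 5 * 3 from rfl, pow_mul, hx, one_pow]
      · rw [show 15 = 3 * 5 from rfl, pow_mul, ht, one_pow]
    rw [this, map_one]
  apply_ne b s := by
    rw [rightTranslation_apply]
    split_ifs
    · simpa using fun h : x = 1 => hx1 (by rw [h]; simp)
    · simpa using ht1
  apply_apply_ne b s := by
    rw [rightTranslation_apply, rightTranslation_apply, mul_assoc]
    split_ifs
    · simpa [← mul_inv_rev] using hx1
    · intro h
      have h2 : t * t = 1 := by simpa [← mul_inv_rev] using h
      apply ht1
      rw [pow_succ, pow_two, h2, one_mul] at ht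
      exact ht
  zero_ne_one s := by simpa [rightTranslation_apply] using hxt
  zero_one_ne s := by
    simp only [rightTranslation_apply, mul_assoc]
    simpa [← mul_inv_rev] using hxt'
  symm_zero_ne_symm_one s := by simpa [rightTranslation_symm_apply] using hxt
  transitive s r := by
    -- Left translations commute with the right translations that define the edges.
    refine ⟨Equiv.mulLeft (r * s⁻¹), by simp, fun b w => ?_⟩
    simp [rightTranslation_apply, mul_assoc]
  expansion U := by
    have := expansion_of_perm (x := rightTranslation G x) (t := rightTranslation G t)
      (c := rightTranslation G c)
      (by rw [← map_pow, hx, map_one]) (by rw [← map_pow, ht, map_one])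
      (by simp only [← map_mul, ← map_inv]; rw [hc]) (hcx.map _)
      (by simp only [← map_mul, ← map_inv]; exact hcy.map _) ?_ U
    · simpa using this
    · intro S hS hcl
      have hinv : ∀ g ∈ Subgroup.closure {x, t}, ∀ s ∈ S, s * g ∈ S := by
        have hpow : ∀ g : G, (∀ s ∈ S, s * g⁻¹ ∈ S) → ∀ n : ℕ, ∀ s ∈ S, s * (g⁻¹) ^ n ∈ S := by
          intro g hg n
          induction n with
          | zero => simp
          | succ n ih => intro s hs; rw [pow_succ, ← mul_assoc]; exact hg _ (ih s hs)
        have hx' : ∀ s ∈ S, s * x⁻¹ ∈ S := fun s hs => (hcl s hs).1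
        have ht' : ∀ s ∈ S, s * t⁻¹ ∈ S := fun s hs => (hcl s hs).2
        -- The right translations multiply by inverses of the generators; finite order turns powers
        -- of these back into the generators.
        have ex : x⁻¹ ^ 4 = x := by
          rw [inv_pow, inv_eq_iff_mul_eq_one, ← pow_succ]; exact hx
        have et : t⁻¹ ^ 2 = t := by
          rw [inv_pow, inv_eq_iff_mul_eq_one, ← pow_succ]; exact ht
        intro g hg
        have : ∀ s ∈ S, s * g ∈ S ∧ s * g⁻¹ ∈ S := by
          induction hg using Subgroup.closure_induction with
          | mem g hg =>
            rcases hg with rfl | hg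
            · intro s hs
              refine ⟨?_, hx' s hs⟩
              have := hpow g hx' 4 s hs
              rwa [ex] at this
            · rw [Set.mem_singleton_iff] at hg
              subst hg
              intro s hs
              refine ⟨?_, ht' s hs⟩
              have := hpow g ht' 2 s hs
              rwa [et] at this
          | one => simp
          | mul a b _ _ iha ihb =>
            intro s hs
            rw [mul_inv_rev, ← mul_assoc, ← mul_assoc]
            exact ⟨(ihb _ (iha s hs).1).1, (iha _ (ihb s hs).2).2⟩
          | inv a _ ih => intro s hs; simpa using (ih s hs).symm
        exact fun s hs => (this s hs).1
      obtain ⟨s₀, hs₀⟩ := hS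
      refine Set.eq_univ_of_forall fun g => ?_
      have := hinv (s₀⁻¹ * g) (by rw [htop]; trivial) s₀ hs₀
      simpa using this

/-! ### A two-generator group of 3 × 3 matrices -/

section MatrixGroup

variable {R : Type*} [CommRing R]

/-- Elementary matrices as units. -/
def elemUnit (i j : Fin 3) (h : i ≠ j) (a : R) : (Matrix (Fin 3) (Fin 3) R)ˣ where
  val := Matrix.transvection i j a
  inv := Matrix.transvection i j (-a)
  val_inv := by rw [Matrix.transvection_mul_transvection_same _ _ h]; simp
  inv_val := by rw [Matrix.transvection_mul_transvection_same _ _ h]; simp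

lemma elemUnit_mul (i j : Fin 3) (h : i ≠ j) (a b : R) :
    elemUnit i j h a * elemUnit i j h b = elemUnit i j h (a + b) := by
  ext1; exact Matrix.transvection_mul_transvection_same _ _ h a b

lemma elemUnit_pow (i j : Fin 3) (h : i ≠ j) (a : R) (n : ℕ) :
    elemUnit i j h a ^ n = elemUnit i j h (n * a) := by
  induction n with
  | zero => ext1; simp [elemUnit]
  | succ n ih => rw [pow_succ, ih, elemUnit_mul]; push_cast; ring_nf

lemma elemUnit_commutator (i j k : Fin 3) (hij : i ≠ j) (hjk : j ≠ k) (hik : i ≠ k) (a b : R) :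
    elemUnit i j hij a * elemUnit j k hjk b
      = elemUnit i k hik (a * b) * elemUnit j k hjk b * elemUnit i j hij a := by
  ext1
  simp only [elemUnit, Units.val_mul, Matrix.transvection, mul_add, add_mul, one_mul, mul_one]
  simp [Matrix.single_mul_single_of_ne, hjk.symm, hik.symm]
  abel

lemma elemUnit_commute_left (i j k : Fin 3) (hij : i ≠ j) (hik : i ≠ k) (a b : R) :
    Commute (elemUnit i k hik a) (elemUnit i j hij b) := by
  ext1
  simp only [elemUnit, Units.val_mul, Matrix.transvection, mul_add, add_mul, one_mul, mul_one]
  simp [Matrix.single_mul_single_of_ne, hij.symm, hik.symm, add_comm, add_left_comm]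

lemma elemUnit_commute_right (i j k : Fin 3) (hjk : j ≠ k) (hik : i ≠ k) (a b : R) :
    Commute (elemUnit i k hik a) (elemUnit j k hjk b) := by
  ext1
  simp only [elemUnit, Units.val_mul, Matrix.transvection, mul_add, add_mul, one_mul, mul_one]
  simp [Matrix.single_mul_single_of_ne, hjk.symm, hik.symm, add_comm, add_left_comm]

lemma elemUnit_mem_of_commutator (Γ : Subgroup (Matrix (Fin 3) (Fin 3) R)ˣ)
    (i j k : Fin 3) (hij : i ≠ j) (hjk : j ≠ k) (hik : i ≠ k) {a b : R}
    (ha : elemUnit i j hij a ∈ Γ) (hb : elemUnit j k hjk b ∈ Γ) :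
    elemUnit i k hik (a * b) ∈ Γ := by
  have h := elemUnit_commutator i j k hij hjk hik a b
  have : elemUnit i k hik (a * b) = elemUnit i j hij a * elemUnit j k hjk b *
      (elemUnit i j hij a)⁻¹ * (elemUnit j k hjk b)⁻¹ := by rw [h]; group
  rw [this]
  exact Γ.mul_mem (Γ.mul_mem (Γ.mul_mem ha hb) (Γ.inv_mem ha)) (Γ.inv_mem hb)

/-- The monomial matrix of order three that permutes the three elementary generators. -/
def rotUnit (u : Rˣ) : (Matrix (Fin 3) (Fin 3) R)ˣ where
  val := !![0, 0, (u⁻¹ : Rˣ) * (u⁻¹ : Rˣ); u, 0, 0; 0, u, 0]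
  inv := !![0, (u⁻¹ : Rˣ), 0; 0, 0, (u⁻¹ : Rˣ); u * u, 0, 0]
  val_inv := by
    ext i j
    fin_cases i <;> fin_cases j <;> simp [Matrix.mul_apply, Fin.sum_univ_three, mul_assoc]
  inv_val := by
    ext i j
    fin_cases i <;> fin_cases j <;> simp [Matrix.mul_apply, Fin.sum_univ_three, mul_assoc]

lemma rotUnit_pow (u : Rˣ) : rotUnit u ^ 3 = 1 := by
  ext i j
  simp only [pow_succ, pow_zero, one_mul, Units.val_mul, rotUnit]
  fin_cases i <;> fin_cases j <;> simp [Matrix.mul_apply, Fin.sum_univ_three, mul_assoc]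

lemma rotUnit_conj (u : Rˣ) :
    rotUnit u * elemUnit 0 1 (by decide) 1 * (rotUnit u)⁻¹ = elemUnit 1 2 (by decide) 1 := by
  rw [mul_inv_eq_iff_eq_mul]
  ext i j
  simp only [Units.val_mul, rotUnit, elemUnit, Matrix.transvection]
  fin_cases i <;> fin_cases j <;> simp [Matrix.mul_apply, Fin.sum_univ_three, Matrix.single,
    Matrix.one_apply]

/-- The weights of the monomial matrix do not cancel around the triangle 0 → 1 → 2 → 0 of elementary
positions: the parameter `u ^ 3` appears here although the cube of the rotation is 1. This is what
makes the group large. -/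
lemma rotUnit_conj' (u : Rˣ) :
    rotUnit u * elemUnit 1 2 (by decide) 1 * (rotUnit u)⁻¹
      = elemUnit 2 0 (by decide) ((u : R) ^ 3) := by
  rw [mul_inv_eq_iff_eq_mul]
  ext i j
  simp only [Units.val_mul, rotUnit, elemUnit, Matrix.transvection]
  fin_cases i <;> fin_cases j <;> simp [Matrix.mul_apply, Fin.sum_univ_three, Matrix.single,
    Matrix.one_apply, pow_succ, mul_assoc]

/-- The group generated by an elementary matrix and the rotation. -/
def rotGroup (u : Rˣ) : Subgroup (Matrix (Fin 3) (Fin 3) R)ˣ :=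
  Subgroup.closure {elemUnit 0 1 (by decide) 1, rotUnit u}

lemma elemUnit_mem_rotGroup (u : Rˣ) : elemUnit 0 1 (by decide) 1 ∈ rotGroup u :=
  Subgroup.subset_closure (by simp)

lemma rotUnit_mem_rotGroup (u : Rˣ) : rotUnit u ∈ rotGroup u :=
  Subgroup.subset_closure (by simp)

/-- Commutators move a parameter from position (0,1) to (0,2) by means of a 1 at (1,2), and back to
(0,1) by means of `u ^ 3` at (2,1), gaining one factor `u ^ 3` per round. -/
lemma elemUnit_pow_mem_rotGroup (u : Rˣ) (n : ℕ) :
    elemUnit 0 1 (by decide) (((u : R) ^ 3) ^ n) ∈ rotGroup u := by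
  set Γ := rotGroup u
  have hx := elemUnit_mem_rotGroup u
  have ht := rotUnit_mem_rotGroup u
  have hy : elemUnit 1 2 (by decide) (1 : R) ∈ Γ := by
    rw [← rotUnit_conj u]
    exact Γ.mul_mem (Γ.mul_mem ht hx) (Γ.inv_mem ht)
  have hz : elemUnit 2 0 (by decide) ((u : R) ^ 3) ∈ Γ := by
    rw [← rotUnit_conj' u]
    exact Γ.mul_mem (Γ.mul_mem ht hy) (Γ.inv_mem ht)
  have h21 : elemUnit 2 1 (by decide) ((u : R) ^ 3) ∈ Γ := by
    have := elemUnit_mem_of_commutator Γ 2 0 1 (by decide) (by decide) (by decide) hz hx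
    rwa [mul_one] at this
  induction n with
  | zero => simpa using hx
  | succ n ih =>
    have h1 := elemUnit_mem_of_commutator Γ 0 1 2 (by decide) (by decide) (by decide) ih hy
    rw [mul_one] at h1
    have h2 := elemUnit_mem_of_commutator Γ 0 2 1 (by decide) (by decide) (by decide) h1 h21
    rwa [← pow_succ] at h2

/-- Characteristic five gives an elementary matrix order five. It and its conjugate at (1,2) have
the elementary matrix at (0,2) as commutator, which commutes with both. The nondegeneracy conditions
are read off single matrix entries. -/
theorem nonempty_cycleExpander_rotGroup [Nontrivial R] (h5 : (5 : R) = 0) (u : Rˣ)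
    [Fintype (rotGroup u)] [DecidableEq (rotGroup u)] : Nonempty (CycleExpander (rotGroup u)) := by
  set x : rotGroup u := ⟨_, elemUnit_mem_rotGroup u⟩ with hx
  set t : rotGroup u := ⟨_, rotUnit_mem_rotGroup u⟩ with ht
  have hconj : (t * x * t⁻¹ : rotGroup u).1 = elemUnit 1 2 (by decide) 1 := rotUnit_conj u
  have h02 : elemUnit 0 2 (by decide) (1 : R) ∈ rotGroup u := by
    have := elemUnit_mem_of_commutator (rotGroup u) 0 1 2 (by decide) (by decide) (by decide)
      x.2 (hconj ▸ (t * x * t⁻¹ : rotGroup u).2)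
    rwa [mul_one] at this
  have h2 : (2 : R) ≠ 0 := by
    intro h2
    have : (1 : R) = 5 - 2 * 2 := by norm_num
    rw [h5, h2] at this
    simp at this
  refine ⟨cayleyExpander (x := x) (t := t) (c := ⟨_, h02⟩) ?_ ?_ ?_ ?_ ?_ ?_ ?_ ?_ ?_ ?_⟩
  · ext1
    change elemUnit 0 1 (by decide) (1 : R) ^ 5 = 1
    rw [elemUnit_pow]
    ext1; simp [elemUnit, h5]
  · ext1; exact rotUnit_pow u
  · ext1
    change elemUnit 0 1 (by decide) 1 * (t * x * t⁻¹ : rotGroup u).1 =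
      elemUnit 0 2 (by decide) 1 * (t * x * t⁻¹ : rotGroup u).1 * elemUnit 0 1 (by decide) 1
    rw [hconj]
    have := elemUnit_commutator 0 1 2 (by decide) (by decide) (by decide) (1 : R) 1
    rw [mul_one] at this
    exact this
  · ext1; exact elemUnit_commute_left 0 1 2 (by decide) (by decide) 1 1
  · rw [Commute, SemiconjBy]; ext1
    change elemUnit 0 2 (by decide) 1 * (t * x * t⁻¹ : rotGroup u).1 =
      (t * x * t⁻¹ : rotGroup u).1 * elemUnit 0 2 (by decide) 1
    rw [hconj]
    exact elemUnit_commute_right 0 1 2 (by decide) (by decide) 1 1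
  · intro h
    have h3 : elemUnit 0 1 (by decide) (1 : R) * elemUnit 0 1 (by decide) (1 : R) = 1 :=
      congrArg Subtype.val h
    rw [elemUnit_mul] at h3
    have := congrArg (fun m : (Matrix (Fin 3) (Fin 3) R)ˣ => m.1 0 1) h3
    simp [elemUnit, Matrix.transvection] at this
    exact h2 (by rw [← this]; norm_num)
  · intro h
    have := congrArg (fun m : rotGroup u => m.1.1 1 1) h
    simp [ht, rotUnit] at this
  · intro h
    have := congrArg (fun m : rotGroup u => m.1.1 1 1) h
    simp [hx, ht, rotUnit, elemUnit, Matrix.transvection] at this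
  · intro h
    have := congrArg (fun m : rotGroup u => m.1.1 2 2) h
    simp [hx, ht, rotUnit, elemUnit, Matrix.transvection, Matrix.mul_apply,
      Fin.sum_univ_three] at this
  · have := Subgroup.closure_closure_coe_preimage
      (k := ({elemUnit 0 1 (by decide) 1, rotUnit u} : Set (Matrix (Fin 3) (Fin 3) R)ˣ))
    refine Eq.trans ?_ this
    congr 1
    ext g
    simp only [Set.mem_insert_iff, Set.mem_singleton_iff, hx, ht, Subtype.ext_iff]
    rfl

/-- The elementary matrices with parameters `u ^ (3 * i)`, `i < n`, are distinct members. The bound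
is crude, but only unboundedness is needed. -/
lemma card_rotGroup_ge [Finite R] (u : Rˣ) (n : ℕ) (hu : ∀ m, 0 < m → m < n → (u : R) ^ (3 * m) ≠ 1) :
    n ≤ Nat.card (rotGroup u) := by
  have hinj : Function.Injective (fun i : Fin n =>
      (⟨_, elemUnit_pow_mem_rotGroup u i⟩ : rotGroup u)) := by
    have hlt : ∀ i j : Fin n, i < j → ((u : R) ^ 3) ^ (i : ℕ) ≠ ((u : R) ^ 3) ^ (j : ℕ) := by
      intro i j hij h
      refine hu (j - i) (by omega) (by omega) ?_
      have e : (j : ℕ) = i + (j - i) := by omega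
      rw [e, pow_add, ← Units.val_pow_eq_pow_val, ← Units.val_pow_eq_pow_val] at h
      have := (Units.mul_right_inj ((u ^ 3) ^ (i : ℕ))).1 (h.symm.trans (mul_one _).symm)
      rwa [pow_mul, ← Units.val_pow_eq_pow_val]
    intro i j h
    have h1 := congrArg (fun m : rotGroup u => m.1.1 0 1) h
    simp [elemUnit, Matrix.transvection] at h1
    rcases lt_trichotomy i j with hij | hij | hij
    · exact absurd h1 (by simpa using hlt i j hij)
    · exact hij
    · exact absurd h1.symm (by simpa using hlt j i hij)
  have := Nat.card_le_card_of_injective _ hinj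
  simpa using this

/-- An element of the kernel of reduction differs from the identity by nine entries in the kernel of
`φ`, and generators reduce to generators. -/
lemma card_rotGroup_le {R' : Type*} [CommRing R'] [Finite R] [Finite R'] (φ : R →+* R') (u : Rˣ)
    {n : ℕ} (hn : Nat.card (RingHom.ker φ) ≤ n) :
    Nat.card (rotGroup u) ≤ n ^ 9 * Nat.card (rotGroup (Units.map (φ : R →* R') u)) := by
  set Φ : (Matrix (Fin 3) (Fin 3) R)ˣ →* (Matrix (Fin 3) (Fin 3) R')ˣ :=
    Units.map (φ.mapMatrix : Matrix (Fin 3) (Fin 3) R →+* Matrix (Fin 3) (Fin 3) R') with hΦ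
  set f := Φ.comp (rotGroup u).subtype with hf
  have h1 : Nat.card (rotGroup u) = Nat.card f.ker * Nat.card f.range := by
    rw [Subgroup.card_eq_card_quotient_mul_card_subgroup f.ker, mul_comm,
      Nat.card_congr (QuotientGroup.quotientKerEquivRange f).toEquiv]
  have h2 : Nat.card f.range ≤ Nat.card (rotGroup (Units.map (φ : R →* R') u)) := by
    have : f.range ≤ rotGroup (Units.map (φ : R →* R') u) := by
      rw [hf, MonoidHom.range_comp, Subgroup.range_subtype, rotGroup, MonoidHom.map_closure,
        rotGroup]
      refine Subgroup.closure_mono ?_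
      rintro _ ⟨g, hg, rfl⟩
      rcases hg with rfl | hg
      · left
        ext i j
        simp [hΦ, elemUnit, Matrix.transvection, Matrix.one_apply, Matrix.single]
      · rw [Set.mem_singleton_iff] at hg
        right
        subst hg
        ext i j
        simp only [hΦ, rotUnit]
        fin_cases i <;> fin_cases j <;> simp
    exact Nat.card_mono (Set.toFinite _) this
  have h3 : Nat.card f.ker ≤ n ^ 9 := by
    have hk : Nat.card (Fin 3 → Fin 3 → RingHom.ker φ) ≤ n ^ 9 := by
      rw [Nat.card_fun, Nat.card_fun]
      simp only [Nat.card_eq_fintype_card, Fintype.card_fin, ← pow_mul]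
      exact Nat.pow_le_pow_left hn 9
    refine le_trans ?_ hk
    have hmem : ∀ g : f.ker, ∀ i j, (g.1.1.1 i j - (1 : Matrix (Fin 3) (Fin 3) R) i j) ∈
        RingHom.ker φ := by
      intro g i j
      have := congrArg (fun m : (Matrix (Fin 3) (Fin 3) R')ˣ => m.1 i j) (MonoidHom.mem_ker.1 g.2)
      simp [hf, hΦ] at this
      rw [RingHom.mem_ker, map_sub, this, sub_eq_zero]
      simp [Matrix.one_apply]
    refine Nat.card_le_card_of_injective (fun g : f.ker => fun i j => ⟨_, hmem g i j⟩) ?_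
    intro g h hgh
    ext i j
    have := congrArg Subtype.val (congrFun (congrFun hgh i) j)
    simpa using this
  rw [h1]
  exact Nat.mul_le_mul h3 h2

end MatrixGroup

/-! ### Truncated polynomial rings over the field with five elements -/

section TruncatedPolynomials

open Polynomial

instance : Fact (Nat.Prime 5) := ⟨by norm_num⟩

/-- The ring `𝔽₅[X] / (X ^ d)`. -/
abbrev TruncPoly (d : ℕ) : Type := (ZMod 5)[X] ⧸ Ideal.span {(X : (ZMod 5)[X]) ^ d}

instance (d : ℕ) : Finite (TruncPoly d) := by
  have : Module.Finite (ZMod 5) (TruncPoly d) :=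
    Polynomial.Monic.finite_quotient (monic_X_pow d)
  exact Module.finite_of_finite (ZMod 5)

lemma isUnit_one_add_X (d : ℕ) : IsUnit (Ideal.Quotient.mk (Ideal.span {(X : (ZMod 5)[X]) ^ d})
    (1 + X)) := by
  rw [map_add, map_one]
  refine IsNilpotent.isUnit_one_add ⟨d, ?_⟩
  rw [← map_pow, Ideal.Quotient.eq_zero_iff_mem]
  exact Ideal.mem_span_singleton_self _

/-- The unit `1 + X` of the truncated polynomial ring. -/
noncomputable def truncUnit (d : ℕ) : (TruncPoly d)ˣ := (isUnit_one_add_X d).unit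

/-- Truncation. -/
noncomputable def truncMap (d : ℕ) : TruncPoly (d + 1) →+* TruncPoly d :=
  Ideal.Quotient.factor (Ideal.span_singleton_le_span_singleton.2 (pow_dvd_pow X (Nat.le_succ d)))

lemma map_truncUnit (d : ℕ) :
    Units.map (truncMap d : TruncPoly (d + 1) →* TruncPoly d) (truncUnit (d + 1)) = truncUnit d := by
  ext1
  simp [truncUnit, truncMap]

lemma card_ker_truncMap (d : ℕ) : Nat.card (RingHom.ker (truncMap d)) ≤ 5 := by
  have hs : Function.Surjective (fun a : ZMod 5 =>
      (⟨Ideal.Quotient.mk _ (C a * X ^ d), by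
        rw [RingHom.mem_ker, truncMap, Ideal.Quotient.factor_mk, Ideal.Quotient.eq_zero_iff_mem]
        exact Ideal.mul_mem_left _ _ (Ideal.mem_span_singleton_self _)⟩ :
        RingHom.ker (truncMap d))) := by
    rintro ⟨f, hf⟩
    obtain ⟨f, rfl⟩ := Ideal.Quotient.mk_surjective f
    rw [RingHom.mem_ker, truncMap, Ideal.Quotient.factor_mk, Ideal.Quotient.eq_zero_iff_mem,
      Ideal.mem_span_singleton] at hf
    obtain ⟨g, rfl⟩ := hf
    refine ⟨g.coeff 0, ?_⟩
    ext1
    simp only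
    rw [Ideal.Quotient.eq, Ideal.mem_span_singleton]
    have : X ∣ g - C (g.coeff 0) := by
      rw [X_dvd_iff]; simp
    obtain ⟨h, hh⟩ := this
    refine ⟨-h, ?_⟩
    linear_combination (-X ^ d : (ZMod 5)[X]) * hh
  have := Nat.card_le_card_of_surjective _ hs
  simpa using this

/-- The polynomial (1 + X)^m - 1 has degree m < d, so X^d cannot divide it. -/
lemma truncUnit_pow_ne_one (d m : ℕ) (hm : 0 < m) (hmd : m < d) :
    (truncUnit d : TruncPoly d) ^ m ≠ 1 := by
  intro h
  change (Ideal.Quotient.mk _ (1 + X)) ^ m = 1 at h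
  rw [← map_pow, ← map_one (Ideal.Quotient.mk _), Ideal.Quotient.eq,
    Ideal.mem_span_singleton] at h
  have hdeg : ((1 + X : (ZMod 5)[X]) ^ m - 1).natDegree = m := by
    have h1 : (1 + X : (ZMod 5)[X]) = X + C 1 := by rw [map_one, add_comm]
    have h2 : ((X + C 1 : (ZMod 5)[X]) ^ m).natDegree = m := by
      rw [natDegree_pow, natDegree_X_add_C, mul_one]
    rw [h1, natDegree_sub_eq_left_of_natDegree_lt, h2]
    rw [h2, natDegree_one]
    exact hm
  have hne : ((1 + X : (ZMod 5)[X]) ^ m - 1) ≠ 0 := by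
    intro h0; rw [h0] at hdeg; simp at hdeg; omega
  have := natDegree_le_of_dvd h hne
  rw [hdeg, natDegree_X_pow] at this
  omega

end TruncatedPolynomials

/-- Expanders that are vertex-transitive and decomposed into short cycles exist in all sizes, up
to a constant factor. -/
theorem exists_cycleExpander (m : ℕ) (hm : 0 < m) :
    ∃ N, m ≤ N ∧ N ≤ 5 ^ 9 * Nat.card (rotGroup (truncUnit 1)) * m ∧
      Nonempty (CycleExpander (Fin N)) := by
  classical
  set a : ℕ → ℕ := fun d => Nat.card (rotGroup (truncUnit (d + 1))) with ha
  have hstep : ∀ d, a (d + 1) ≤ 5 ^ 9 * a d := by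
    intro d
    have := card_rotGroup_le (truncMap (d + 1)) (truncUnit (d + 2)) (card_ker_truncMap (d + 1))
    rwa [map_truncUnit] at this
  have hunb : ∃ d, m ≤ a d := by
    refine ⟨3 * m, card_rotGroup_ge _ _ fun i hi him => truncUnit_pow_ne_one _ _ (by omega) (by omega)⟩
  -- Take the first group with at least `m` elements: its predecessor has fewer than `m`, and one
  -- step multiplies the order by at most 5⁹. The factor `a 0` covers the case that the first group
  -- is already large.
  have hex : ∃ d, m ≤ a d ∧ a d ≤ 5 ^ 9 * a 0 * m := by
    have hmin := Nat.find_spec hunb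
    refine ⟨Nat.find hunb, hmin, ?_⟩
    rcases h : Nat.find hunb with _ | d
    · nlinarith [Nat.zero_le (a 0)]
    · have h1 : a d < m := by
        have := Nat.find_min hunb (m := d) (by omega)
        omega
      have h0 : 0 < a 0 := Nat.card_pos
      calc a (d + 1) ≤ 5 ^ 9 * a d := hstep d
        _ ≤ 5 ^ 9 * m := by omega
        _ ≤ 5 ^ 9 * a 0 * m := by nlinarith
  obtain ⟨d, h1, h2⟩ := hex
  refine ⟨a d, h1, h2, ?_⟩
  have hnt : Nontrivial (TruncPoly (d + 1)) := by
    refine Ideal.Quotient.nontrivial_iff.2 ?_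
    rw [Ne, Ideal.span_singleton_eq_top]
    intro h
    have := Polynomial.natDegree_eq_zero_of_isUnit h
    simp at this
  have h5 : (5 : TruncPoly (d + 1)) = 0 := by
    have : (5 : Polynomial (ZMod 5)) = 0 := by
      have h : ((5 : ℕ) : Polynomial (ZMod 5)) = 0 := CharP.cast_eq_zero _ 5
      exact_mod_cast h
    have h' := congrArg (Ideal.Quotient.mk (Ideal.span {(Polynomial.X : Polynomial (ZMod 5)) ^ (d + 1)})) this
    rw [map_zero] at h'
    exact h'
  have : Fintype (rotGroup (truncUnit (d + 1))) := Fintype.ofFinite _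
  obtain ⟨X⟩ := nonempty_cycleExpander_rotGroup h5 (truncUnit (d + 1))
  exact ⟨X.congr (Finite.equivFin _)⟩

/-! ### Executions on a matching of half-edges -/

section Run

variable {V : Type} {d : ℕ}

/-- The messages received in the first `t` rounds, latest round first, when every node has `d`
ports, `L` matches the half-edges, and `snd` gives the messages that a node sends. -/
def run (snd : V → List (PortMsgs d) → PortMsgs d) (L : V × Fin d → V × Fin d) :
    ℕ → V → List (PortMsgs d)
  | 0, _ => []
  | t + 1, v => (fun p => snd (L (v, p)).1 (run snd L t (L (v, p)).1) (L (v, p)).2) ::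
      run snd L t v

/-- The network given by a matching of the half-edges. -/
noncomputable def matchedNetwork [Fintype V] (G : SimpleGraph V) (hG : G.Connected)
    (L : V × Fin d → V × Fin d) (hadj : ∀ v u, G.Adj v u ↔ ∃ p, (L (v, p)).1 = u)
    (hinj : ∀ v, Function.Injective fun p => (L (v, p)).1)
    (id : V → ℕ) (hid : Function.Injective id)
    (hmem : ∀ v, id v ∈ Finset.Icc 1 (Fintype.card V ^ 4)) : Network V where
  graph := G
  connected := hG
  deg _ := d
  port v := Equiv.ofBijective (fun p => ⟨(L (v, p)).1, (hadj v _).2 ⟨p, rfl⟩⟩)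
    ⟨fun p p' h => hinj v (congrArg Subtype.val h), fun ⟨u, hu⟩ => by
      obtain ⟨p, hp⟩ := (hadj v u).1 hu
      exact ⟨p, Subtype.ext hp⟩⟩
  id := id
  id_injective := hid
  id_mem := hmem

/-- Involutivity of `L` identifies the port leading back with the second component of the matched
half-edge. -/
lemma received_matchedNetwork [Fintype V] (G : SimpleGraph V) (hG : G.Connected)
    (L : V × Fin d → V × Fin d) (hadj : ∀ v u, G.Adj v u ↔ ∃ p, (L (v, p)).1 = u)
    (hinj : ∀ v, Function.Injective fun p => (L (v, p)).1)
    (id : V → ℕ) (hid : Function.Injective id)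
    (hmem : ∀ v, id v ∈ Finset.Icc 1 (Fintype.card V ^ 4))
    (hinv : ∀ h, L (L h) = h) (A : Algorithm) (r : V → ℕ → Bool) (t : ℕ) (v : V) :
    received A (matchedNetwork G hG L hadj hinj id hid hmem) r t v =
      run (fun v => A.send (Fintype.card V) (id v) d (r v)) L t v := by
  set net := matchedNetwork G hG L hadj hinj id hid hmem with hnet
  have hport : ∀ v (p : Fin d), (net.port v p : V) = (L (v, p)).1 := fun v p => rfl
  have hback : ∀ v (p : Fin d), net.backPort v p = (L (v, p)).2 := by
    intro v p
    refine (Equiv.symm_apply_eq (net.port (L (v, p)).1)).2 (Subtype.ext ?_)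
    change v = (L (L (v, p))).1
    rw [hinv]
  induction t generalizing v with
  | zero => rfl
  | succ t ih =>
    refine congrArg₂ List.cons (funext fun p : Fin d => ?_) (ih v)
    exact congrArg₂ (A.send (Fintype.card V) (id (L (v, p)).1) d (r (L (v, p)).1))
      (ih (L (v, p)).1) (hback v p)

end Run

/-- The four external nodes of a clique come in two pairs. -/
def partner : Fin 4 → Fin 4 := ![1, 0, 3, 2]

lemma partner_partner (j : Fin 4) : partner (partner j) = j := by revert j; decide

lemma partner_ne (j : Fin 4) : partner j ≠ j := by revert j; decide

/-! ### Wiring the cliques along the expander -/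

section Wiring

variable {W : Type} [Fintype W] [DecidableEq W] (X : CycleExpander W)

/-- The four neighbours of a vertex. -/
def CycleExpander.step (j : Fin 4) : Equiv.Perm W :=
  ![X.perm 0, (X.perm 0).symm, X.perm 1, (X.perm 1).symm] j

lemma CycleExpander.step_partner (j : Fin 4) (s : W) : X.step (partner j) (X.step j s) = s := by
  fin_cases j <;> simp [step, partner]

lemma CycleExpander.step_ne (j : Fin 4) (s : W) : X.step j s ≠ s := by
  fin_cases j
  · exact X.apply_ne 0 s
  · exact fun h => X.apply_ne 0 s ((Equiv.symm_apply_eq _).1 h).symm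
  · exact X.apply_ne 1 s
  · exact fun h => X.apply_ne 1 s ((Equiv.symm_apply_eq _).1 h).symm

lemma CycleExpander.step_injective (s : W) : Function.Injective fun j => X.step j s := by
  have h01 : X.perm 0 s ≠ (X.perm 0).symm s := fun h =>
    X.apply_apply_ne 0 s (by rw [h]; simp)
  have h23 : X.perm 1 s ≠ (X.perm 1).symm s := fun h =>
    X.apply_apply_ne 1 s (by rw [h]; simp)
  have h02 := X.zero_ne_one s
  have h13 := X.symm_zero_ne_symm_one s
  have h03 : X.perm 0 s ≠ (X.perm 1).symm s := fun h =>
    X.zero_one_ne ((X.perm 1).symm s) (by simpa using h)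
  have h12 : (X.perm 0).symm s ≠ X.perm 1 s := fun h =>
    X.zero_one_ne s (by rw [← h]; simp)
  intro j j' h
  fin_cases j <;> fin_cases j' <;> simp [step] at h ⊢ <;> first
    | exact h01 h | exact h02 h | exact h03 h | exact h12 h | exact h13 h | exact h23 h
    | exact h01 h.symm | exact h02 h.symm | exact h03 h.symm | exact h12 h.symm | exact h13 h.symm
    | exact h23 h.symm

/-- The 4-regular graph of the expander. -/
def CycleExpander.graph : SimpleGraph W where
  Adj s t := ∃ j, X.step j s = t
  symm := by
    constructor
    rintro s _ ⟨j, rfl⟩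
    exact ⟨partner j, X.step_partner j s⟩
  loopless := by
    constructor
    rintro s ⟨j, h⟩
    exact X.step_ne j s h

lemma CycleExpander.ncard_neighborSet (s : W) : (X.graph.neighborSet s).ncard = 4 := by
  have : X.graph.neighborSet s = Set.range fun j => X.step j s := by
    ext t; rfl
  rw [this, Set.ncard_eq_toFinset_card', Set.toFinset_range,
    Finset.card_image_of_injective _ (X.step_injective s)]
  simp

variable {q : ℕ}

/-- An arbitrary fixed port numbering of the complete graph on `Fin k`. -/
noncomputable def portEquiv (k : ℕ) (i : Fin k) : Fin (k - 1) ≃ {l : Fin k // l ≠ i} :=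
  (Fintype.equivFinOfCardEq (by simp)).symm

/-- The node behind a half-edge in the complete graph. -/
noncomputable def dir {k : ℕ} (h : (W × Fin k) × Fin (k - 1)) : Fin k := portEquiv k h.1.2 h.2

/-- The half-edge at `v` that points to `l`. -/
noncomputable def halfEdge {k : ℕ} (v : W × Fin k) (l : Fin k) (h : l ≠ v.2) :
    (W × Fin k) × Fin (k - 1) :=
  (v, (portEquiv k v.2).symm ⟨l, h⟩)

lemma dir_ne {k : ℕ} (h : (W × Fin k) × Fin (k - 1)) : dir h ≠ h.1.2 := (portEquiv k h.1.2 h.2).2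

lemma dir_halfEdge {k : ℕ} (v : W × Fin k) (l : Fin k) (h : l ≠ v.2) :
    dir (halfEdge v l h) = l :=
  congrArg Subtype.val ((portEquiv k v.2).apply_symm_apply ⟨l, h⟩)

lemma halfEdge_ext {k : ℕ} {h h' : (W × Fin k) × Fin (k - 1)} (h1 : h.1 = h'.1)
    (h2 : dir h = dir h') : h = h' := by
  obtain ⟨v, p⟩ := h
  obtain ⟨v', p'⟩ := h'
  dsimp only at h1
  subst h1
  simp only [dir] at h2
  rw [(portEquiv k v.2).injective (Subtype.ext h2)]

/-- The block of a node: the nodes of a clique fall into four blocks of size `q`. -/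
def block (i : Fin (4 * q)) : Fin 4 := (finProdFinEquiv.symm i).1

/-- The `j`-th external node of the clique of `s`, chosen in block `j` by `g`. -/
def extNode (g : W → Fin 4 → Fin q) (s : W) (j : Fin 4) : Fin (4 * q) := finProdFinEquiv (j, g s j)

lemma block_extNode (g : W → Fin 4 → Fin q) (s : W) (j : Fin 4) : block (extNode g s j) = j := by
  simp [block, extNode]

lemma extNode_ne (g : W → Fin 4 → Fin q) (s : W) {j j' : Fin 4} (h : j ≠ j') :
    extNode g s j ≠ extNode g s j' := fun e => h (by
  rw [← block_extNode g s j, e, block_extNode])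

/-- The edge from `i` to `l` in the clique of `s` is one of those that are removed; only pairs
permitted by `C` are. -/
def IsCut (g : W → Fin 4 → Fin q) (C : W → Fin 4 → Prop) (s : W) (i l : Fin (4 * q)) : Prop :=
  C s (block i) ∧ i = extNode g s (block i) ∧ l = extNode g s (partner (block i))

lemma isCut_extNode {g : W → Fin 4 → Fin q} {C : W → Fin 4 → Prop} {s : W} {j : Fin 4} :
    IsCut g C s (extNode g s j) (extNode g s (partner j)) ↔ C s j := by
  simp [IsCut, block_extNode]

lemma IsCut.symm {g : W → Fin 4 → Fin q} {C : W → Fin 4 → Prop}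
    (hC : ∀ s j, C s j → C s (partner j)) {s : W} {i l : Fin (4 * q)} (h : IsCut g C s i l) :
    IsCut g C s l i := by
  obtain ⟨h1, h2, h3⟩ := h
  have hb : block l = partner (block i) := by rw [h3, block_extNode]
  refine ⟨hb ▸ hC _ _ h1, by rw [hb]; exact h3, ?_⟩
  rw [hb, partner_partner]; exact h2

open Classical in
/-- The matching of the half-edges: those along removed edges lead to neighbouring cliques. -/
noncomputable def link (g : W → Fin 4 → Fin q) (C : W → Fin 4 → Prop)
    (h : (W × Fin (4 * q)) × Fin (4 * q - 1)) : (W × Fin (4 * q)) × Fin (4 * q - 1) :=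
  if IsCut g C h.1.1 h.1.2 (dir h) then
    halfEdge (X.step (block h.1.2) h.1.1,
        extNode g (X.step (block h.1.2) h.1.1) (partner (block h.1.2)))
      (extNode g (X.step (block h.1.2) h.1.1) (block h.1.2))
      (extNode_ne _ _ (partner_ne _).symm)
  else halfEdge (h.1.1, dir h) h.1.2 (dir_ne h).symm

lemma link_of_not_isCut {g : W → Fin 4 → Fin q} {C : W → Fin 4 → Prop}
    {h : (W × Fin (4 * q)) × Fin (4 * q - 1)} (hc : ¬ IsCut g C h.1.1 h.1.2 (dir h)) :
    link X g C h = halfEdge (h.1.1, dir h) h.1.2 (dir_ne h).symm := if_neg hc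

/-- The `j`-th external half-edge of the clique of `s`. -/
noncomputable def extHalfEdge (g : W → Fin 4 → Fin q) (s : W) (j : Fin 4) :
    (W × Fin (4 * q)) × Fin (4 * q - 1) :=
  halfEdge (s, extNode g s j) (extNode g s (partner j)) (extNode_ne _ _ (partner_ne j))

lemma eq_extHalfEdge_of_isCut {g : W → Fin 4 → Fin q} {C : W → Fin 4 → Prop}
    {h : (W × Fin (4 * q)) × Fin (4 * q - 1)} (hc : IsCut g C h.1.1 h.1.2 (dir h)) :
    h = extHalfEdge g h.1.1 (block h.1.2) := by
  refine halfEdge_ext ?_ ?_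
  · exact Prod.ext rfl hc.2.1
  · rw [hc.2.2, extHalfEdge, dir_halfEdge]

lemma link_extHalfEdge {g : W → Fin 4 → Fin q} {C : W → Fin 4 → Prop} {s : W} {j : Fin 4}
    (hc : C s j) : link X g C (extHalfEdge g s j) = extHalfEdge g (X.step j s) (partner j) := by
  have h : IsCut g C (extHalfEdge g s j).1.1 (extHalfEdge g s j).1.2 (dir (extHalfEdge g s j)) := by
    rw [extHalfEdge, dir_halfEdge]; exact isCut_extNode.2 hc
  rw [link, if_pos h]
  have hb : block (extHalfEdge g s j).1.2 = j := block_extNode g s j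
  refine halfEdge_ext ?_ ?_
  · simp only [halfEdge, extHalfEdge, block_extNode]
  · simp only [extHalfEdge, dir_halfEdge, partner_partner]
    simp only [halfEdge, block_extNode]

/-- The set of cut pairs has to be closed both under exchanging the two ends of a pair and under
crossing an external edge. The second condition is why pairs can be restored only along whole
trails. -/
lemma link_link {g : W → Fin 4 → Fin q} {C : W → Fin 4 → Prop}
    (hC : ∀ s j, C s j → C s (partner j)) (hC' : ∀ s j, C s j → C (X.step j s) (partner j))
    (h : (W × Fin (4 * q)) × Fin (4 * q - 1)) : link X g C (link X g C h) = h := by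
  by_cases hc : IsCut g C h.1.1 h.1.2 (dir h)
  · have e := eq_extHalfEdge_of_isCut hc
    set s := h.1.1
    set j := block h.1.2
    have hcj : C s j := hc.1
    rw [e, link_extHalfEdge X hcj, link_extHalfEdge X (hC' s j hcj), X.step_partner,
      partner_partner]
  · rw [link_of_not_isCut X hc, link_of_not_isCut]
    · refine halfEdge_ext ?_ ?_
      · exact Prod.ext rfl (dir_halfEdge _ _ _)
      · rw [dir_halfEdge]; rfl
    · intro hc'
      rw [dir_halfEdge] at hc'
      exact hc (IsCut.symm hC hc')

/-- The clique substitution determined by the choice of the external nodes. -/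
noncomputable def CycleExpander.substitution (g : W → Fin 4 → Fin q) :
    CliqueSubstitution X.graph (4 * q) := by
  classical
  let idx : W → W → Fin 4 := fun s t => if h : ∃ j, X.step j s = t then h.choose else 0
  have hidx : ∀ s j, idx s (X.step j s) = j := by
    intro s j
    have h : ∃ j', X.step j' s = X.step j s := ⟨j, rfl⟩
    simp only [idx, dif_pos h]
    exact X.step_injective s h.choose_spec
  exact {
    ext := fun s t => extNode g s (idx s t)
    ext_injOn := by
      rintro s _ ⟨j, rfl⟩ _ ⟨j', rfl⟩ h
      simp only [hidx] at h
      have := congrArg block h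
      rw [block_extNode, block_extNode] at this
      rw [this]
    mate := fun s t => X.step (partner (idx s t)) s
    mate_adj := by
      rintro s _ ⟨j, rfl⟩
      exact ⟨_, rfl⟩
    mate_ne := by
      rintro s _ ⟨j, rfl⟩ h
      rw [hidx] at h
      exact partner_ne j (X.step_injective s h)
    mate_mate := by
      rintro s _ ⟨j, rfl⟩
      rw [hidx, hidx, partner_partner] }

lemma CycleExpander.substitution_ext (g : W → Fin 4 → Fin q) (s : W) (j : Fin 4) :
    (X.substitution g).ext s (X.step j s) = extNode g s j := by
  have h : ∃ j', X.step j' s = X.step j s := ⟨j, rfl⟩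
  have e : h.choose = j := X.step_injective s h.choose_spec
  simp only [substitution, dif_pos h]
  rw [e]

lemma CycleExpander.substitution_mate (g : W → Fin 4 → Fin q) (s : W) (j : Fin 4) :
    (X.substitution g).mate s (X.step j s) = X.step (partner j) s := by
  have h : ∃ j', X.step j' s = X.step j s := ⟨j, rfl⟩
  have e : h.choose = j := X.step_injective s h.choose_spec
  simp only [substitution, dif_pos h]
  rw [e]

lemma substitution_adj_iff (g : W → Fin 4 → Fin q) (v u : W × Fin (4 * q)) :
    (X.substitution g).graph.Adj v u ↔
      (v.1 = u.1 ∧ v.2 ≠ u.2 ∧ ¬ IsCut g (fun _ _ => True) v.1 v.2 u.2) ∨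
      ∃ j, u.1 = X.step j v.1 ∧ v.2 = extNode g v.1 j ∧ u.2 = extNode g u.1 (partner j) := by
  have h1 : (∃ t, X.graph.Adj v.1 t ∧ v.2 = (X.substitution g).ext v.1 t ∧
      u.2 = (X.substitution g).ext v.1 ((X.substitution g).mate v.1 t)) ↔
      IsCut g (fun _ _ => True) v.1 v.2 u.2 := by
    constructor
    · rintro ⟨_, ⟨j, rfl⟩, h2, h3⟩
      rw [X.substitution_mate, X.substitution_ext] at h3
      rw [X.substitution_ext] at h2
      rw [h2, h3]
      exact isCut_extNode.2 trivial
    · rintro ⟨-, h2, h3⟩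
      refine ⟨_, ⟨block v.2, rfl⟩, ?_, ?_⟩
      · rw [X.substitution_ext]; exact h2
      · rw [X.substitution_mate, X.substitution_ext]; exact h3
  have h2 : (X.graph.Adj v.1 u.1 ∧ v.2 = (X.substitution g).ext v.1 u.1 ∧
      u.2 = (X.substitution g).ext u.1 v.1) ↔
      ∃ j, u.1 = X.step j v.1 ∧ v.2 = extNode g v.1 j ∧ u.2 = extNode g u.1 (partner j) := by
    constructor
    · rintro ⟨⟨j, hj⟩, h2, h3⟩
      refine ⟨j, hj.symm, ?_, ?_⟩
      · rw [← hj, X.substitution_ext] at h2; exact h2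
      · have e : v.1 = X.step (partner j) u.1 := by rw [← hj, X.step_partner]
        rw [e, X.substitution_ext] at h3; exact h3
    · rintro ⟨j, hj, h2, h3⟩
      refine ⟨⟨j, hj.symm⟩, ?_, ?_⟩
      · rw [hj, X.substitution_ext]; exact h2
      · have e : v.1 = X.step (partner j) u.1 := by rw [hj, X.step_partner]
        rw [h3]
        conv_rhs => rw [e, X.substitution_ext]
  change (v.1 = u.1 ∧ v.2 ≠ u.2 ∧ ¬ _) ∨ _ ↔ _
  rw [h1, h2]

lemma substitution_adj_iff_link (g : W → Fin 4 → Fin q) (v u : W × Fin (4 * q)) :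
    (X.substitution g).graph.Adj v u ↔ ∃ p, (link X g (fun _ _ => True) (v, p)).1 = u := by
  rw [substitution_adj_iff]
  constructor
  · rintro (⟨h1, h2, h3⟩ | ⟨j, h1, h2, h3⟩)
    · refine ⟨(halfEdge v u.2 h2.symm).2, ?_⟩
      change (link X g _ (halfEdge v u.2 h2.symm)).1 = u
      rw [link_of_not_isCut]
      · exact Prod.ext h1 (dir_halfEdge _ _ _)
      · rw [dir_halfEdge]; exact h3
    · have hv : v = (extHalfEdge g v.1 j).1 := Prod.ext rfl h2
      refine ⟨(extHalfEdge g v.1 j).2, ?_⟩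
      have : (v, (extHalfEdge g v.1 j).2) = extHalfEdge g v.1 j := Prod.ext hv rfl
      rw [this, link_extHalfEdge X trivial]
      refine Prod.ext h1.symm ?_
      rw [h3, h1]; rfl
  · rintro ⟨p, rfl⟩
    by_cases hc : IsCut g (fun _ _ => True) v.1 v.2 (dir (v, p))
    · right
      have e := eq_extHalfEdge_of_isCut (h := (v, p)) hc
      refine ⟨block v.2, ?_, hc.2.1, ?_⟩
      · rw [e, link_extHalfEdge X trivial]; rfl
      · rw [e, link_extHalfEdge X trivial]; rfl
    · left
      rw [link_of_not_isCut X hc]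
      exact ⟨rfl, (dir_ne (v, p)).symm, hc⟩

/-- A node has at most one cut half-edge; it leaves the clique, whereas the others stay inside and
end at distinct nodes. So no multiple edges arise. -/
lemma link_fst_injective (g : W → Fin 4 → Fin q) (v : W × Fin (4 * q)) :
    Function.Injective fun p => (link X g (fun _ _ => True) (v, p)).1 := by
  intro p p' h
  have key : ∀ p p', IsCut g (fun _ _ => True) v.1 v.2 (dir (v, p)) →
      ¬ IsCut g (fun _ _ => True) v.1 v.2 (dir (v, p')) →
      (link X g (fun _ _ => True) (v, p)).1 ≠ (link X g (fun _ _ => True) (v, p')).1 := by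
    intro p p' hc hc' h
    rw [link_of_not_isCut X (h := (v, p')) hc', eq_extHalfEdge_of_isCut (h := (v, p)) hc,
      link_extHalfEdge X trivial] at h
    exact X.step_ne _ _ (congrArg Prod.fst h)
  have : dir (v, p) = dir (v, p') := by
    by_cases hc : IsCut g (fun _ _ => True) v.1 v.2 (dir (v, p)) <;>
    by_cases hc' : IsCut g (fun _ _ => True) v.1 v.2 (dir (v, p'))
    · rw [hc.2.2, hc'.2.2]
    · exact absurd h (key p p' hc hc')
    · exact absurd h.symm (key p' p hc' hc)
    · simp only [link_of_not_isCut X (h := (v, p)) hc,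
        link_of_not_isCut X (h := (v, p')) hc'] at h
      exact congrArg Prod.snd h
  exact congrArg Prod.snd (halfEdge_ext (h := (v, p)) (h' := (v, p')) rfl this)

end Wiring

/-! ### Conductance of the clique substitution -/

section ConductanceBounds

variable {W : Type} [Fintype W] [DecidableEq W] (X : CycleExpander W) {q : ℕ}

lemma cutSize_eq {V : Type} [Fintype V] (G : SimpleGraph V) (U : Finset V)
    [DecidablePred fun e : V × V => e.1 ∈ U ∧ e.2 ∉ U ∧ G.Adj e.1 e.2] :
    cutSize G U = (Finset.univ.filter fun e : V × V =>
      e.1 ∈ U ∧ e.2 ∉ U ∧ G.Adj e.1 e.2).card := by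
  rw [cutSize]
  congr 1
  ext e
  simp [and_assoc]

/-- Frees the complement in the definition from its classical decidability instance. -/
lemma cutConductance_eq {V : Type} [Fintype V] [DecidableEq V] (G : SimpleGraph V)
    (U : Finset V) :
    cutConductance G U = (cutSize G U : ℝ) / (min (vol G U) (vol G Uᶜ) : ℕ) := by
  rw [cutConductance]
  have : ∀ i₁ i₂ : DecidableEq V, vol G (@compl _ (@Finset.booleanAlgebra V _ i₁).toCompl U)
      = vol G (@compl _ (@Finset.booleanAlgebra V _ i₂).toCompl U) := by
    intro i₁ i₂; rw [Subsingleton.elim i₁ i₂]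
  exact congrArg (fun n : ℕ => (cutSize G U : ℝ) / (min (vol G U) n : ℕ)) (this _ _)

lemma ncard_neighborSet_substitution (g : W → Fin 4 → Fin q) (v : W × Fin (4 * q)) :
    ((X.substitution g).graph.neighborSet v).ncard = 4 * q - 1 := by
  have : (X.substitution g).graph.neighborSet v
      = Set.range fun p => (link X g (fun _ _ => True) (v, p)).1 := by
    ext u
    rw [SimpleGraph.mem_neighborSet, substitution_adj_iff_link]; rfl
  rw [this, ← Set.image_univ, Set.ncard_image_of_injective _ (link_fst_injective X g v),
    Set.ncard_univ]
  simp

lemma vol_substitution (g : W → Fin 4 → Fin q) (U : Finset (W × Fin (4 * q))) :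
    vol (X.substitution g).graph U = (4 * q - 1) * U.card := by
  rw [vol, Finset.sum_congr rfl fun v _ => ncard_neighborSet_substitution X g v]
  simp [mul_comm]

/-- The nodes of `U` in the clique of `s`. -/
def slice (U : Finset (W × Fin (4 * q))) (s : W) : Finset (Fin (4 * q)) :=
  Finset.univ.filter fun i => (s, i) ∈ U

lemma mem_slice {U : Finset (W × Fin (4 * q))} {s : W} {i : Fin (4 * q)} :
    i ∈ slice U s ↔ (s, i) ∈ U := by simp [slice]

lemma card_eq_sum_slice (U : Finset (W × Fin (4 * q))) : U.card = ∑ s, (slice U s).card := by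
  rw [← Finset.card_sigma]
  refine Finset.card_bij' (fun v _ => ⟨v.1, v.2⟩) (fun v _ => (v.1, v.2)) ?_ ?_ ?_ ?_
  · intro v hv; simpa [mem_slice] using hv
  · intro v hv; simpa [mem_slice] using hv
  · intro v _; rfl
  · intro v _; rfl

lemma slice_compl (U : Finset (W × Fin (4 * q))) (s : W) : slice Uᶜ s = (slice U s)ᶜ := by
  ext i; simp [mem_slice]

open Classical in
/-- The edges of the clique of `s` across the cut. -/
noncomputable def sliceCut (g : W → Fin 4 → Fin q) (U : Finset (W × Fin (4 * q))) (s : W) :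
    Finset (Fin (4 * q) × Fin (4 * q)) :=
  ((slice U s) ×ˢ (slice U s)ᶜ).filter fun e => ¬ IsCut g (fun _ _ => True) s e.1 e.2

/-- At most four ordered pairs are removed in a clique, one for each block of the first node. -/
lemma card_sliceCut (g : W → Fin 4 → Fin q) (U : Finset (W × Fin (4 * q))) (s : W) :
    (slice U s).card * (4 * q - (slice U s).card) ≤ (sliceCut g U s).card + 4 := by
  classical
  have h := Finset.card_filter_add_card_filter_not (s := (slice U s) ×ˢ (slice U s)ᶜ)
    (fun e => IsCut g (fun _ _ => True) s e.1 e.2)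
  rw [Finset.card_product, Finset.card_compl, Fintype.card_fin] at h
  have h4 : (((slice U s) ×ˢ (slice U s)ᶜ).filter
      fun e => IsCut g (fun _ _ => True) s e.1 e.2).card ≤ 4 := by
    have := Finset.card_le_card_of_injOn (t := (Finset.univ : Finset (Fin 4)))
      (s := ((slice U s) ×ˢ (slice U s)ᶜ).filter fun e => IsCut g (fun _ _ => True) s e.1 e.2)
      (fun e => block e.1) (fun _ _ => Finset.mem_univ _) (by
        intro e he e' he' hb
        rw [Finset.mem_coe, Finset.mem_filter] at he he'
        obtain ⟨-, -, h2, h3⟩ := he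
        obtain ⟨-, -, h2', h3'⟩ := he'
        dsimp only at hb
        refine Prod.ext ?_ ?_
        · rw [h2, h2', hb]
        · rw [h3, h3', hb])
    simpa using this
  have e : (sliceCut g U s).card = (((slice U s) ×ˢ (slice U s)ᶜ).filter
      fun e => ¬ IsCut g (fun _ _ => True) s e.1 e.2).card := by
    rw [sliceCut]
  omega

/-- The external edge in direction `b` at `s` crosses the cut from inside to outside. -/
def ExtCut (g : W → Fin 4 → Fin q) (U : Finset (W × Fin (4 * q))) (s : W) (b : Fin 2) : Prop :=
  (s, extNode g s (![0, 2] b)) ∈ U ∧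
    (X.perm b s, extNode g (X.perm b s) (partner (![0, 2] b))) ∉ U

lemma step_two_mul (b : Fin 2) : X.step (![0, 2] b) = X.perm b := by
  fin_cases b <;> rfl

-- Each external edge is examined in the direction of `X.perm b` only, so nothing is counted twice;
-- the crossings missed in this way are not needed.
open Classical in
lemma cutSize_ge (g : W → Fin 4 → Fin q) (U : Finset (W × Fin (4 * q))) :
    ∑ s, (sliceCut g U s).card +
      (Finset.univ.filter fun z : Fin 2 × W => ExtCut X g U z.2 z.1).card
      ≤ cutSize (X.substitution g).graph U := by
  rw [cutSize_eq, ← Finset.card_filter_add_card_filter_not (p := fun e : (W × Fin (4 * q)) × (W × Fin (4 * q)) =>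
    e.1.1 = e.2.1)]
  refine add_le_add ?_ ?_
  · rw [← Finset.card_sigma]
    refine Finset.card_le_card_of_injOn (fun z => ((z.1, z.2.1), (z.1, z.2.2))) ?_ ?_
    · rintro ⟨s, i, l⟩ hz
      simp only [Finset.coe_sigma, Set.mem_sigma_iff, Finset.mem_coe, sliceCut, Finset.mem_filter,
        Finset.mem_product, Finset.mem_compl, mem_slice] at hz
      obtain ⟨-, ⟨h1, h2⟩, h3⟩ := hz
      simp only [Finset.mem_coe, Finset.mem_filter, Finset.mem_univ, true_and, and_true]
      refine ⟨h1, h2, (substitution_adj_iff X g _ _).2 (Or.inl ⟨rfl, ?_, h3⟩)⟩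
      rintro rfl
      exact h2 h1
    · rintro ⟨s, i, l⟩ _ ⟨s', i', l'⟩ _ h
      simp only [Prod.mk.injEq] at h
      obtain ⟨⟨rfl, rfl⟩, -, rfl⟩ := h
      rfl
  · refine Finset.card_le_card_of_injOn (fun z => ((z.2, extNode g z.2 (![0, 2] z.1)),
      (X.perm z.1 z.2, extNode g (X.perm z.1 z.2) (partner (![0, 2] z.1))))) ?_ ?_
    · rintro ⟨b, s⟩ hz
      simp only [Finset.coe_filter, Finset.mem_univ, true_and, Set.mem_ofPred_eq] at hz
      simp only [Finset.mem_coe, Finset.mem_filter, Finset.mem_univ, true_and]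
      refine ⟨⟨hz.1, hz.2, (substitution_adj_iff X g _ _).2 (Or.inr ⟨![0, 2] b, ?_, rfl, rfl⟩)⟩,
        (X.apply_ne b s).symm⟩
      rw [step_two_mul]
    · rintro ⟨b, s⟩ _ ⟨b', s'⟩ _ h
      simp only [Prod.mk.injEq] at h
      obtain ⟨⟨rfl, -⟩, h, -⟩ := h
      rw [← step_two_mul, ← step_two_mul] at h
      have := X.step_injective s h
      have hinj : ∀ c c' : Fin 2, (![0, 2] c : Fin 4) = ![0, 2] c' → c = c' := by decide
      have hb : b = b' := hinj b b' this
      rw [hb]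

/-- Isoperimetry of the clique substitution. -/
theorem min_card_le_cutSize (hq : 3 ≤ q) (g : W → Fin 4 → Fin q)
    (U : Finset (W × Fin (4 * q))) :
    min U.card Uᶜ.card ≤ 40000000 * (4 * q) * cutSize (X.substitution g).graph U := by
  classical
  set a : W → ℕ := fun s => (slice U s).card with ha
  have hak : ∀ s, a s ≤ (4 * q) := fun s => by simpa using Finset.card_le_univ (slice U s)
  -- `B` collects the cliques with a majority in `U`, and `J` those split by the cut. Expansion is
  -- applied to `B`; split cliques pay with edges inside them.
  set B : Finset W := Finset.univ.filter fun s => (4 * q) < 2 * a s with hB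
  set J : Finset W := Finset.univ.filter fun s => 0 < a s ∧ a s < (4 * q) with hJ
  set cut := cutSize (X.substitution g).graph U with hcut
  set ext := (Finset.univ.filter fun z : Fin 2 × W => ExtCut X g U z.2 z.1) with hext
  have hge : ∑ s, (sliceCut g U s).card + ext.card ≤ cut := cutSize_ge X g U
  have hs1 : ∀ s, a s * ((4 * q) - a s) ≤ (sliceCut g U s).card + 4 := fun s => card_sliceCut g U s
  have hprod : ∀ s, 0 < a s → a s < (4 * q) → 11 ≤ a s * ((4 * q) - a s) := by
    intro s h0 h1
    obtain ⟨b, hb⟩ : ∃ b, (4 * q) = a s + b := ⟨(4 * q) - a s, by omega⟩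
    have : (4 * q) - a s = b := by omega
    rw [this]
    nlinarith
  have hJle : 4 * J.card ≤ ∑ s, (sliceCut g U s).card := by
    calc 4 * J.card = ∑ s ∈ J, 4 := by simp [mul_comm]
      _ ≤ ∑ s ∈ J, (sliceCut g U s).card := by
          refine Finset.sum_le_sum fun s hs => ?_
          rw [hJ, Finset.mem_filter] at hs
          have := hs1 s
          have := hprod s hs.2.1 hs.2.2
          omega
      _ ≤ _ := Finset.sum_le_sum_of_subset (Finset.subset_univ _)
  -- For a split clique a(k - a) ≥ 11, so at least seven internal edges cross, and the loss of four
  -- removed pairs is absorbed by doubling the constant 2 to 4.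
  have hmin : ∀ s, (4 * q) * min (a s) ((4 * q) - a s) ≤ 4 * (sliceCut g U s).card := by
    intro s
    rcases Nat.eq_zero_or_pos (a s) with h0 | h0
    · simp [h0]
    rcases (hak s).eq_or_lt with h1 | h1
    · simp [h1]
    have := hs1 s
    have := hprod s h0 h1
    have h2 : (4 * q) * min (a s) ((4 * q) - a s) ≤ 2 * (a s * ((4 * q) - a s)) := by
      obtain ⟨b, hb⟩ : ∃ b, (4 * q) = a s + b := ⟨(4 * q) - a s, by omega⟩
      have hb' : (4 * q) - a s = b := by omega
      rw [hb', hb]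
      rcases le_total (a s) b with h | h
      · rw [min_eq_left h]; nlinarith
      · rw [min_eq_right h]; nlinarith
    omega
  have hmsum : (4 * q) * ∑ s, min (a s) ((4 * q) - a s) ≤ 4 * cut := by
    rw [Finset.mul_sum]
    calc _ ≤ ∑ s, 4 * (sliceCut g U s).card := Finset.sum_le_sum fun s _ => hmin s
      _ = 4 * ∑ s, (sliceCut g U s).card := by rw [Finset.mul_sum]
      _ ≤ _ := by omega
  have hnotB : ∀ s, s ∈ B ↔ (4 * q) < 2 * a s := by intro s; simp [hB]
  -- An expander edge leaving `B` either carries an external edge from inside `U` to outside, or one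
  -- of its two cliques is split: its own external node lies on the minority side.
  have hext_le : (B.filter fun s => X.perm 0 s ∉ B).card + (B.filter fun s => X.perm 1 s ∉ B).card
      ≤ ext.card + 4 * J.card := by
    have hone : ∀ b : Fin 2, (B.filter fun s => X.perm b s ∉ B).card ≤
        (Finset.univ.filter fun s => ExtCut X g U s b).card + 2 * J.card := by
      intro b
      have hsub : (B.filter fun s => X.perm b s ∉ B) ⊆
          (Finset.univ.filter fun s => ExtCut X g U s b) ∪ (J ∪ J.map (X.perm b).symm.toEmbedding) := by
        intro s hs
        rw [Finset.mem_filter, hnotB, hnotB] at hs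
        simp only [Finset.mem_union, Finset.mem_filter, Finset.mem_univ, true_and,
          Finset.mem_map_equiv, Equiv.symm_symm, hJ]
        by_cases h1 : (s, extNode g s (![0, 2] b)) ∈ U
        · by_cases h2 : (X.perm b s, extNode g (X.perm b s) (partner (![0, 2] b))) ∈ U
          · right; right
            have : 0 < a (X.perm b s) := Finset.card_pos.2 ⟨_, mem_slice.2 h2⟩
            omega
          · exact Or.inl ⟨h1, h2⟩
        · right; left
          have : a s < (4 * q) := by
            refine lt_of_le_of_ne (hak s) fun h => h1 ?_
            have : slice U s = Finset.univ := Finset.eq_univ_of_card _ (by simpa using h)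
            rw [← mem_slice, this]; exact Finset.mem_univ _
          omega
      calc _ ≤ _ := Finset.card_le_card hsub
        _ ≤ _ := Finset.card_union_le _ _
        _ ≤ _ := by
          have := Finset.card_union_le J (J.map (X.perm b).symm.toEmbedding)
          rw [Finset.card_map] at this
          omega
    have hsum : ext.card = (Finset.univ.filter fun s => ExtCut X g U s 0).card +
        (Finset.univ.filter fun s => ExtCut X g U s 1).card := by
      rw [hext, Finset.card_filter, Fintype.sum_prod_type, Fin.sum_univ_two, Finset.card_filter,
        Finset.card_filter]
    have := hone 0
    have := hone 1
    omega
  have hexp := X.expansion B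
  have hBcut : min B.card Bᶜ.card ≤ 30000000 * cut := by
    refine hexp.trans (Nat.mul_le_mul_left _ ?_)
    omega
  have hU : U.card ≤ (4 * q) * B.card + ∑ s, min (a s) ((4 * q) - a s) := by
    rw [card_eq_sum_slice, ← Finset.sum_add_sum_compl B]
    refine add_le_add ?_ ?_
    · refine le_of_le_of_eq (Finset.sum_le_card_nsmul _ _ (4 * q) fun s _ => hak s) ?_
      rw [smul_eq_mul, mul_comm]
    · calc ∑ s ∈ Bᶜ, a s ≤ ∑ s ∈ Bᶜ, min (a s) ((4 * q) - a s) := by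
            refine Finset.sum_le_sum fun s hs => ?_
            rw [Finset.mem_compl, hnotB] at hs
            have := hak s
            omega
        _ ≤ _ := Finset.sum_le_sum_of_subset (Finset.subset_univ _)
  have hU' : Uᶜ.card ≤ (4 * q) * Bᶜ.card + ∑ s, min (a s) ((4 * q) - a s) := by
    have hc : ∀ s, (slice Uᶜ s).card = (4 * q) - a s := fun s => by
      rw [slice_compl, Finset.card_compl, Fintype.card_fin]
    rw [card_eq_sum_slice, ← Finset.sum_add_sum_compl Bᶜ]
    simp only [hc]
    refine add_le_add ?_ ?_
    · refine le_of_le_of_eq (Finset.sum_le_card_nsmul _ _ (4 * q) fun s _ => Nat.sub_le _ _) ?_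
      rw [smul_eq_mul, mul_comm]
    · rw [compl_compl]
      calc ∑ s ∈ B, ((4 * q) - a s) ≤ ∑ s ∈ B, min (a s) ((4 * q) - a s) := by
            refine Finset.sum_le_sum fun s hs => ?_
            rw [hnotB] at hs
            have := hak s
            omega
        _ ≤ _ := Finset.sum_le_sum_of_subset (Finset.subset_univ _)
  set m := ∑ s, min (a s) ((4 * q) - a s)
  have hm : m ≤ 4 * cut := le_trans (by nlinarith [show 1 ≤ (4 * q) by omega]) hmsum
  have hfin : min U.card Uᶜ.card ≤ (4 * q) * min B.card Bᶜ.card + m := by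
    rcases le_total B.card Bᶜ.card with h | h
    · rw [min_eq_left h]; exact (min_le_left _ _).trans hU
    · rw [min_eq_right h]; exact (min_le_right _ _).trans hU'
  calc min U.card Uᶜ.card ≤ (4 * q) * (30000000 * cut) + 4 * cut :=
        hfin.trans (add_le_add (Nat.mul_le_mul_left _ hBcut) hm)
    _ ≤ 40000000 * (4 * q) * cut := by nlinarith [Nat.zero_le cut, Nat.mul_le_mul_right cut (show 1 ≤ (4 * q) by omega)]

/-- The set of nodes reachable from a given one has an empty cut, so isoperimetry leaves nothing
outside it. -/
theorem substitution_connected [Nonempty W] (hq : 3 ≤ q) (g : W → Fin 4 → Fin q) :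
    (X.substitution g).graph.Connected := by
  classical
  have : Nonempty (Fin (4 * q)) := ⟨⟨0, by omega⟩⟩
  rw [SimpleGraph.connected_iff]
  refine ⟨fun u v => ?_, inferInstance⟩
  by_contra hne
  set U : Finset (W × Fin (4 * q)) :=
    Finset.univ.filter fun w => (X.substitution g).graph.Reachable u w with hU
  have h0 : cutSize (X.substitution g).graph U = 0 := by
    rw [cutSize_eq, Finset.card_eq_zero, Finset.filter_eq_empty_iff]
    rintro ⟨x, y⟩ - ⟨hx, hy, hadj⟩
    rw [hU, Finset.mem_filter] at hx hy
    exact hy ⟨Finset.mem_univ _, hx.2.trans hadj.reachable⟩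
  have h1 := min_card_le_cutSize X hq g U
  rw [h0, mul_zero] at h1
  have hu : 0 < U.card := Finset.card_pos.2 ⟨u, by simp [hU]⟩
  have hv : 0 < Uᶜ.card := Finset.card_pos.2 ⟨v, by simpa [hU] using hne⟩
  omega

lemma bddBelow_cutConductance {V : Type} [Fintype V] (G : SimpleGraph V) :
    BddBelow (Set.range fun U : {U : Finset V // U.Nonempty ∧ U ≠ Finset.univ} =>
      cutConductance G U.1) :=
  ⟨0, by rintro _ ⟨U, rfl⟩; exact div_nonneg (Nat.cast_nonneg _) (Nat.cast_nonneg _)⟩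

lemma exists_cut [Nonempty W] (hq : 3 ≤ q) :
    Nonempty {U : Finset (W × Fin (4 * q)) // U.Nonempty ∧ U ≠ Finset.univ} := by
  have s := Classical.arbitrary W
  refine ⟨{(s, ⟨0, by omega⟩)}, by simp, fun h => ?_⟩
  have : (s, (⟨1, by omega⟩ : Fin (4 * q))) ∈ ({(s, ⟨0, by omega⟩)} : Finset (W × Fin (4 * q))) := by
    rw [h]; exact Finset.mem_univ _
  simp at this

theorem conductance_ge [Nonempty W] (hq : 3 ≤ q) (g : W → Fin 4 → Fin q) :
    1 / (40000000 * (4 * q : ℝ) ^ 2) ≤ conductance (X.substitution g).graph := by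
  classical
  have := exists_cut (W := W) hq
  refine le_ciInf fun ⟨U, hU, hU'⟩ => ?_
  have h := min_card_le_cutSize X hq g U
  have hpos : 0 < min U.card Uᶜ.card := by
    refine lt_min (Finset.card_pos.2 hU) (Finset.card_pos.2 ?_)
    rw [Finset.nonempty_iff_ne_empty, Ne, Finset.compl_eq_empty_iff]
    exact hU'
  rw [cutConductance_eq, vol_substitution, vol_substitution, Nat.mul_min_mul_left]
  rw [div_le_div_iff₀ (by positivity) (by
    have : 0 < (4 * q - 1) * min U.card Uᶜ.card := Nat.mul_pos (by omega) hpos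
    convert (Nat.cast_pos (α := ℝ)).2 this)]
  rw [one_mul]
  have h1 : (4 * q - 1) * min U.card Uᶜ.card ≤
      (4 * q) * (40000000 * (4 * q) * cutSize (X.substitution g).graph U) :=
    Nat.mul_le_mul (Nat.sub_le _ _) h
  have h2 : (((4 * q - 1) * min U.card Uᶜ.card : ℕ) : ℝ) ≤
      (((4 * q) * (40000000 * (4 * q) * cutSize (X.substitution g).graph U) : ℕ) : ℝ) :=
    Nat.cast_le.2 h1
  refine le_trans (le_of_eq ?_) (h2.trans (le_of_eq ?_))
  · norm_num
  · push_cast; ring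

/-- The test set is a single clique: at most four edges leave it, and its volume is k(k - 1) ≥ k²/2.
-/
theorem conductance_le (hW : 2 ≤ Fintype.card W) (hq : 3 ≤ q) (g : W → Fin 4 → Fin q) :
    conductance (X.substitution g).graph ≤ 8 / (4 * q : ℝ) ^ 2 := by
  classical
  have : Nonempty W := Fintype.card_pos_iff.1 (by omega)
  have s := Classical.arbitrary W
  set U : Finset (W × Fin (4 * q)) := Finset.univ.filter fun v => v.1 = s with hU
  have hUc : U.card = 4 * q := by
    have : U = ({s} : Finset W) ×ˢ (Finset.univ : Finset (Fin (4 * q))) := by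
      ext v; simp only [hU, Finset.mem_filter, Finset.mem_product, Finset.mem_univ, Finset.mem_singleton,
        true_and, and_true]
    rw [this, Finset.card_product]; simp
  have hUc' : 4 * q ≤ Uᶜ.card := by
    rw [Finset.card_compl, hUc, Fintype.card_prod, Fintype.card_fin]
    have : 2 * (4 * q) ≤ Fintype.card W * (4 * q) := Nat.mul_le_mul_right _ hW
    omega
  have hne : U.Nonempty := Finset.card_pos.1 (by omega)
  have hne' : U ≠ Finset.univ := by
    intro h; rw [h] at hUc'; simp at hUc'; omega
  refine (ciInf_le (bddBelow_cutConductance _) ⟨U, hne, hne'⟩).trans ?_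
  have hcut : cutSize (X.substitution g).graph U ≤ 4 := by
    have := Finset.card_le_card_of_injOn (t := (Finset.univ : Finset (Fin 4)))
      (s := Finset.univ.filter fun e : (W × Fin (4 * q)) × (W × Fin (4 * q)) =>
        e.1 ∈ U ∧ e.2 ∉ U ∧ (X.substitution g).graph.Adj e.1 e.2)
      (fun e => block e.1.2) (fun _ _ => Finset.mem_univ _) (by
        have key : ∀ e : (W × Fin (4 * q)) × (W × Fin (4 * q)),
            e ∈ Finset.univ.filter (fun e : (W × Fin (4 * q)) × (W × Fin (4 * q)) =>
              e.1 ∈ U ∧ e.2 ∉ U ∧ (X.substitution g).graph.Adj e.1 e.2) →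
            e = ((s, extNode g s (block e.1.2)), (X.step (block e.1.2) s,
              extNode g (X.step (block e.1.2) s) (partner (block e.1.2)))) := by
          rintro ⟨⟨a, i⟩, ⟨b, l⟩⟩ he
          simp only [Finset.mem_filter, hU, Finset.mem_univ, true_and] at he
          obtain ⟨rfl, h2, h3⟩ := he
          rcases (substitution_adj_iff X g _ _).1 h3 with ⟨h4, -⟩ | ⟨j, h4, h5, h6⟩
          · exact absurd h4.symm h2
          · dsimp only at h4 h5 h6 ⊢
            have hj : block i = j := by rw [h5, block_extNode]
            rw [hj, ← h4, ← h5, ← h6]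
        intro e he e' he' hb
        dsimp only at hb
        rw [key e he, key e' he', hb])
    rw [cutSize_eq]
    simpa using this
  rw [cutConductance_eq, vol_substitution, vol_substitution, Nat.mul_min_mul_left, hUc,
    min_eq_left hUc']
  have hq' : (12 : ℝ) ≤ 4 * q := by
    have : (3 : ℝ) ≤ q := by exact_mod_cast hq
    linarith
  have e : (((4 * q - 1) * (4 * q) : ℕ) : ℝ) = (4 * q - 1) * (4 * q) := by
    rw [Nat.cast_mul, Nat.cast_sub (by omega)]; push_cast; ring
  rw [e, div_le_div_iff₀ (by nlinarith) (by positivity)]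
  have : (cutSize (X.substitution g).graph U : ℝ) ≤ 4 := by exact_mod_cast hcut
  nlinarith [mul_le_mul_of_nonneg_right this (sq_nonneg (4 * q : ℝ))]

end ConductanceBounds

/-! ### The cost of finding an external edge -/

section Trails

/-- The message sent over a half-edge in round `t`. -/
def sentOver {V : Type} {d : ℕ} (snd : V → List (PortMsgs d) → PortMsgs d)
    (L : V × Fin d → V × Fin d) (t : ℕ) (h : V × Fin d) : Option Msg :=
  snd h.1 (run snd L t h.1) h.2

/-- The index of the pair to which an external node belongs. -/
def pairOf : Fin 4 → Fin 2 := ![0, 0, 1, 1]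

/-- The first node of a pair. -/
def firstOf : Fin 2 → Fin 4 := ![0, 2]

lemma pairOf_partner (j : Fin 4) : pairOf (partner j) = pairOf j := by revert j; decide

lemma pairOf_firstOf (b : Fin 2) : pairOf (firstOf b) = b := by revert b; decide

lemma eq_firstOf {j : Fin 4} {b : Fin 2} (h : pairOf j = b) :
    j = firstOf b ∨ j = partner (firstOf b) := by revert j b; decide

variable {W : Type} [Fintype W] [DecidableEq W] (X : CycleExpander W) {q : ℕ}

/-- A set of cliques that is closed along the edges of the pairs `b`. -/
def TrailClosed (b : Fin 2) (O : Finset W) : Prop :=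
  ∀ s j, pairOf j = b → (X.step j s ∈ O ↔ s ∈ O)

/-- All pairs are cut except the pairs `b` in the cliques of `O`. -/
def cutOutside (b : Fin 2) (O : Finset W) : W → Fin 4 → Prop := fun s j => ¬ (s ∈ O ∧ pairOf j = b)

variable {X}

/-- When the pairs of a trail are left uncut, their positions leave no trace in the matching.
Closure of `O` ensures that the far ends of the cut pairs are cut as well. -/
lemma link_cutOutside_congr {b : Fin 2} {O : Finset W} (hO : TrailClosed X b O)
    {g g' : W → Fin 4 → Fin q} (hg : ∀ s j, cutOutside b O s j → g s j = g' s j) :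
    link X g (cutOutside b O) = link X g' (cutOutside b O) := by
  have hp : ∀ s j, cutOutside b O s j → cutOutside b O s (partner j) := by
    intro s j h; rw [cutOutside, pairOf_partner]; exact h
  have hs : ∀ s j, cutOutside b O s j → cutOutside b O (X.step j s) (partner j) := by
    rintro s j h ⟨h1, h2⟩
    rw [pairOf_partner] at h2
    exact h ⟨(hO s j h2).1 h1, h2⟩
  have hn : ∀ s j, cutOutside b O s j → extNode g s j = extNode g' s j := by
    intro s j h; rw [extNode, hg s j h, extNode]
  have hcut : ∀ s i l, IsCut g (cutOutside b O) s i l ↔ IsCut g' (cutOutside b O) s i l := by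
    intro s i l
    constructor
    · rintro ⟨h1, h2, h3⟩
      exact ⟨h1, hn _ _ h1 ▸ h2, hn _ _ (hp _ _ h1) ▸ h3⟩
    · rintro ⟨h1, h2, h3⟩
      exact ⟨h1, (hn _ _ h1).symm ▸ h2, (hn _ _ (hp _ _ h1)).symm ▸ h3⟩
  funext h
  by_cases hc : IsCut g (cutOutside b O) h.1.1 h.1.2 (dir h)
  · have hc' := (hcut _ _ _).1 hc
    have e1 := eq_extHalfEdge_of_isCut hc
    have e2 := eq_extHalfEdge_of_isCut hc'
    rw [e1, link_extHalfEdge X hc.1, ← e1]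
    conv_rhs => rw [e2, link_extHalfEdge X hc.1]
    have h1 := hs _ _ hc.1
    have h2 := hp _ _ h1
    refine halfEdge_ext ?_ ?_
    · exact Prod.ext rfl (hn _ _ h1)
    · rw [extHalfEdge, extHalfEdge, dir_halfEdge, dir_halfEdge, hn _ _ h2]
  · rw [link_of_not_isCut X hc, link_of_not_isCut X (fun h => hc ((hcut _ _ _).2 h))]

/-- As long as nothing is sent along the pairs `b` of `O`, it makes no difference whether these
pairs are cut. -/
lemma run_eq_run_cutOutside {b : Fin 2} {O : Finset W} (hO : TrailClosed X b O)
    (snd : W × Fin (4 * q) → List (PortMsgs (4 * q - 1)) → PortMsgs (4 * q - 1))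
    (g : W → Fin 4 → Fin q) (T : ℕ)
    (hT : ∀ t < T, ∀ s ∈ O, ∀ j, pairOf j = b →
      sentOver snd (link X g (cutOutside b O)) t (extHalfEdge g s j) = none)
    (t : ℕ) (ht : t ≤ T) (v : W × Fin (4 * q)) :
    run snd (link X g fun _ _ => True) t v = run snd (link X g (cutOutside b O)) t v := by
  induction t generalizing v with
  | zero => rfl
  | succ t ih =>
    have ih' := fun v => ih (by omega) v
    rw [run, run, ih' v]
    congr 1
    funext p
    rw [ih']
    change sentOver snd (link X g (cutOutside b O)) t (link X g (fun _ _ => True) (v, p)) =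
      sentOver snd (link X g (cutOutside b O)) t (link X g (cutOutside b O) (v, p))
    by_cases hc : IsCut g (fun _ _ => True) v.1 v.2 (dir (v, p))
    · have e := eq_extHalfEdge_of_isCut (h := (v, p)) hc
      set s := v.1
      set j := block v.2
      rw [e, link_extHalfEdge X trivial]
      change _ = sentOver snd _ t (link X g (cutOutside b O) (extHalfEdge g s j))
      by_cases hin : cutOutside b O s j
      · rw [link_extHalfEdge X hin]
      · have hin' : s ∈ O ∧ pairOf j = b := not_not.1 hin
        -- The two matchings connect this half-edge to different half-edges, but both of these
        -- belong to pairs `b` of `O` and are silent, so nothing is received either way.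
        rw [hT t (by omega) _ ((hO s j hin'.2).2 hin'.1) _ (by rw [pairOf_partner, hin'.2])]
        have e2 : link X g (cutOutside b O) (extHalfEdge g s j) = extHalfEdge g s (partner j) := by
          rw [link_of_not_isCut]
          · refine halfEdge_ext ?_ ?_
            · exact Prod.ext rfl (dir_halfEdge _ _ _)
            · rw [dir_halfEdge, extHalfEdge, extHalfEdge, dir_halfEdge, partner_partner]; rfl
          · rw [extHalfEdge, dir_halfEdge]
            exact fun h => hin (isCut_extNode.1 h)
        rw [e2, hT t (by omega) _ hin'.1 _ (by rw [pairOf_partner, hin'.2])]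
    · rw [link_of_not_isCut X (h := (v, p)) hc, link_of_not_isCut]
      exact fun h => hc ⟨trivial, h.2.1, h.2.2⟩

/-- The number of messages that the nodes in the cliques of `O` send in the first `T` rounds. -/
def msgCount (snd : W × Fin (4 * q) → List (PortMsgs (4 * q - 1)) → PortMsgs (4 * q - 1))
    (L : (W × Fin (4 * q)) × Fin (4 * q - 1) → (W × Fin (4 * q)) × Fin (4 * q - 1))
    (O : Finset W) (T : ℕ) : ℕ :=
  ∑ t ∈ Finset.range T, (Finset.univ.filter fun h : (W × Fin (4 * q)) × Fin (4 * q - 1) =>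
    h.1.1 ∈ O ∧ (sentOver snd L t h).isSome).card

lemma msgCount_mono (snd : W × Fin (4 * q) → List (PortMsgs (4 * q - 1)) → PortMsgs (4 * q - 1))
    (L : (W × Fin (4 * q)) × Fin (4 * q - 1) → (W × Fin (4 * q)) × Fin (4 * q - 1))
    (O : Finset W) : Monotone (msgCount snd L O) := by
  intro T T' h
  exact Finset.sum_le_sum_of_subset (Finset.range_mono h)

/-- A message is sent along the pairs `b` of `O` in the first `T` rounds. -/
def Opened (snd : W × Fin (4 * q) → List (PortMsgs (4 * q - 1)) → PortMsgs (4 * q - 1))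
    (L : (W × Fin (4 * q)) × Fin (4 * q - 1) → (W × Fin (4 * q)) × Fin (4 * q - 1))
    (g : W → Fin 4 → Fin q) (b : Fin 2) (O : Finset W) (T : ℕ) : Prop :=
  ∃ t < T, ∃ s ∈ O, ∃ j, pairOf j = b ∧ (sentOver snd L t (extHalfEdge g s j)).isSome

lemma run_eq_of_not_opened {b : Fin 2} {O : Finset W} (hO : TrailClosed X b O)
    {snd : W × Fin (4 * q) → List (PortMsgs (4 * q - 1)) → PortMsgs (4 * q - 1)}
    {g : W → Fin 4 → Fin q} {T : ℕ} (h : ¬ Opened snd (link X g (cutOutside b O)) g b O T)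
    {t : ℕ} (ht : t ≤ T) (v : W × Fin (4 * q)) :
    run snd (link X g fun _ _ => True) t v = run snd (link X g (cutOutside b O)) t v := by
  refine run_eq_run_cutOutside hO snd g T (fun t ht s hs j hj => ?_) t ht v
  by_contra hne
  exact h ⟨t, ht, s, hs, j, hj, Option.isSome_iff_ne_none.2 hne⟩

/-- The first message along these pairs is sent while the two executions still coincide, so it is
sent in both. -/
lemma Opened.uncut {b : Fin 2} {O : Finset W} (hO : TrailClosed X b O)
    {snd : W × Fin (4 * q) → List (PortMsgs (4 * q - 1)) → PortMsgs (4 * q - 1)}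
    {g : W → Fin 4 → Fin q} {T : ℕ} (h : Opened snd (link X g fun _ _ => True) g b O T) :
    Opened snd (link X g (cutOutside b O)) g b O T := by
  by_contra hn
  obtain ⟨t, ht, s, hs, j, hj, hsome⟩ := h
  rw [sentOver, run_eq_of_not_opened hO hn ht.le] at hsome
  exact hn ⟨t, ht, s, hs, j, hj, hsome⟩

/-- What is sent in round `T` depends only on the rounds before it. So the agreement extends one
round beyond the silent ones, which matters when many messages are sent at once. -/
lemma msgCount_eq_of_not_opened {b : Fin 2} {O : Finset W} (hO : TrailClosed X b O)
    {snd : W × Fin (4 * q) → List (PortMsgs (4 * q - 1)) → PortMsgs (4 * q - 1)}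
    {g : W → Fin 4 → Fin q} {T : ℕ} (h : ¬ Opened snd (link X g (cutOutside b O)) g b O T)
    {t : ℕ} (ht : t ≤ T + 1) :
    msgCount snd (link X g fun _ _ => True) O t = msgCount snd (link X g (cutOutside b O)) O t := by
  refine Finset.sum_congr rfl fun t' ht' => ?_
  rw [Finset.mem_range] at ht'
  congr 1
  ext e
  rw [Finset.mem_filter, Finset.mem_filter, sentOver, sentOver,
    run_eq_of_not_opened hO h (show t' ≤ T by omega)]

/-- The pair of positions joined by a half-edge between the two blocks of the pair `b`. -/
def positions (b : Fin 2) (h : (W × Fin (4 * q)) × Fin (4 * q - 1)) (l : Fin (4 * q)) :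
    W × Fin q × Fin q :=
  if block h.1.2 = firstOf b then
    (h.1.1, (finProdFinEquiv.symm h.1.2).2, (finProdFinEquiv.symm l).2)
  else (h.1.1, (finProdFinEquiv.symm l).2, (finProdFinEquiv.symm h.1.2).2)

/-- The positions along which a message is sent in the first `T` rounds. -/
noncomputable def usedPositions
    (snd : W × Fin (4 * q) → List (PortMsgs (4 * q - 1)) → PortMsgs (4 * q - 1))
    (L : (W × Fin (4 * q)) × Fin (4 * q - 1) → (W × Fin (4 * q)) × Fin (4 * q - 1))
    (b : Fin 2) (O : Finset W) (T : ℕ) : Finset (W × Fin q × Fin q) :=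
  (Finset.range T).biUnion fun t =>
    (Finset.univ.filter fun h : (W × Fin (4 * q)) × Fin (4 * q - 1) =>
      h.1.1 ∈ O ∧ (sentOver snd L t h).isSome).image fun h => positions b h (dir h)

lemma card_usedPositions_le
    (snd : W × Fin (4 * q) → List (PortMsgs (4 * q - 1)) → PortMsgs (4 * q - 1))
    (L : (W × Fin (4 * q)) × Fin (4 * q - 1) → (W × Fin (4 * q)) × Fin (4 * q - 1))
    (b : Fin 2) (O : Finset W) (T : ℕ) :
    (usedPositions snd L b O T).card ≤ msgCount snd L O T :=
  Finset.card_biUnion_le.trans (Finset.sum_le_sum fun _ _ => Finset.card_image_le)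

lemma Opened.mem_usedPositions
    {snd : W × Fin (4 * q) → List (PortMsgs (4 * q - 1)) → PortMsgs (4 * q - 1)}
    {L : (W × Fin (4 * q)) × Fin (4 * q - 1) → (W × Fin (4 * q)) × Fin (4 * q - 1)}
    {g : W → Fin 4 → Fin q} {b : Fin 2} {O : Finset W} {T : ℕ} (h : Opened snd L g b O T) :
    ∃ s, (s, g s (firstOf b), g s (partner (firstOf b))) ∈ usedPositions snd L b O T := by
  obtain ⟨t, ht, s, hs, j, hj, hsome⟩ := h
  refine ⟨s, Finset.mem_biUnion.2 ⟨t, Finset.mem_range.2 ht, Finset.mem_image.2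
    ⟨extHalfEdge g s j, Finset.mem_filter.2 ⟨Finset.mem_univ _, hs, hsome⟩, ?_⟩⟩⟩
  have e1 : (extHalfEdge g s j).1 = (s, extNode g s j) := rfl
  have e2 : dir (extHalfEdge g s j) = extNode g s (partner j) := dir_halfEdge _ _ _
  rw [positions, e1, e2]
  dsimp only
  rw [block_extNode]
  rcases eq_firstOf hj with rfl | rfl
  · rw [if_pos rfl]; simp [extNode]
  · rw [if_neg (partner_ne _), partner_partner]; simp [extNode]

variable {ι : Type} [Fintype ι] [DecidableEq ι]

lemma card_eq_eq_mul_le {i i' : ι} (hii : i ≠ i') (a a' : Fin q) :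
    (Finset.univ.filter fun η : ι → Fin q => η i = a ∧ η i' = a').card * q ^ 2 ≤
      Fintype.card (ι → Fin q) := by
  have h1 : (Finset.univ.filter fun η : ι → Fin q => η i = a ∧ η i' = a').card * q ^ 2 =
      ((Finset.univ.filter fun η : ι → Fin q => η i = a ∧ η i' = a') ×ˢ
        (Finset.univ : Finset (Fin q × Fin q))).card := by
    rw [Finset.card_product]; simp [pow_two]
  rw [h1, ← Finset.card_univ]
  refine Finset.card_le_card_of_injOn
    (fun z => Function.update (Function.update z.1 i z.2.1) i' z.2.2)
    (fun _ _ => Finset.mem_coe.2 (Finset.mem_univ _)) ?_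
  rintro ⟨η, c, c'⟩ h ⟨η', e, e'⟩ h' heq
  simp only [Finset.coe_product, Set.mem_prod, Finset.mem_coe, Finset.mem_filter, Finset.mem_univ,
    true_and] at h h'
  have hf := fun x => congrFun heq x
  have hc' : c' = e' := by simpa using hf i'
  have hc : c = e := by simpa [Function.update_of_ne hii] using hf i
  have hη : η = η' := by
    funext x
    by_cases hx' : x = i'
    · rw [hx', h.1.2, h'.1.2]
    by_cases hx : x = i
    · rw [hx, h.1.1, h'.1.1]
    simpa [Function.update_of_ne hx, Function.update_of_ne hx'] using hf x
  rw [hη, hc, hc']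

/-- Replace the coordinates in `K`. -/
def resample {β : Type} (K : ι → Prop) [DecidablePred K] (γ η : ι → β) : ι → β :=
  fun i => if K i then η i else γ i

/-- Exchanging the coordinates in `K` between two independent copies is an involution of the pairs.
-/
lemma sum_resample {β : Type} [Fintype β] (K : ι → Prop) [DecidablePred K] (F : (ι → β) → ℕ) :
    ∑ γ, ∑ η, F (resample K γ η) = Fintype.card (ι → β) * ∑ γ, F γ := by
  have e : ∑ z : (ι → β) × (ι → β), F (resample K z.1 z.2) = ∑ z : (ι → β) × (ι → β), F z.1 := by
    let σ : (ι → β) × (ι → β) ≃ (ι → β) × (ι → β) :=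
      { toFun := fun z => (resample K z.1 z.2, resample K z.2 z.1)
        invFun := fun z => (resample K z.1 z.2, resample K z.2 z.1)
        left_inv := fun z => by
          refine Prod.ext ?_ ?_ <;> funext i <;> simp only [resample] <;> split_ifs <;> rfl
        right_inv := fun z => by
          refine Prod.ext ?_ ?_ <;> funext i <;> simp only [resample] <;> split_ifs <;> rfl }
    exact Equiv.sum_comp σ fun z => F z.1
  rw [← Fintype.sum_prod_type', e, Fintype.sum_prod_type]
  simp [Finset.mul_sum]

/-- The choice function stored at given coordinates. -/
def choiceAt (emb : W × Fin 4 → ι) (γ : ι → Fin q) : W → Fin 4 → Fin q := fun s j => γ (emb (s, j))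

open Classical in
/-- Opening the pairs `b` of `O` requires, on average over the positions of these pairs, on the
order of `q ^ 2` messages inside `O`. -/
lemma sum_opened_le_of_fixed {b : Fin 2} {O : Finset W} (hO : TrailClosed X b O)
    (snd : W × Fin (4 * q) → List (PortMsgs (4 * q - 1)) → PortMsgs (4 * q - 1))
    {emb : W × Fin 4 → ι} (hemb : Function.Injective emb) (T : ℕ) (G : (ι → Fin q) → W → Fin 4 → Fin q)
    (hG : ∀ η η' s j, cutOutside b O s j → G η s j = G η' s j)
    (hG' : ∀ η s j, s ∈ O → pairOf j = b → G η s j = η (emb (s, j))) :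
    q ^ 2 * ∑ η, (if Opened snd (link X (G η) fun _ _ => True) (G η) b O T then 1 else 0) ≤
      4 * ∑ η, msgCount snd (link X (G η) fun _ _ => True) O T := by
  rcases Nat.eq_zero_or_pos q with hq | hq
  · have hq2 : q ^ 2 = 0 := by rw [hq]; rfl
    rw [hq2, zero_mul]; exact Nat.zero_le _
  set nH := Fintype.card (ι → Fin q) with hnH
  have hne : Nonempty (ι → Fin q) := ⟨fun _ => ⟨0, hq⟩⟩
  set η₀ := Classical.arbitrary (ι → Fin q)
  -- The execution with the pairs of `O` uncut is the same for all `η`, so `m` is a deterministic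
  -- function of time, while each used position is the hidden one for at most a fraction 1/q² of the
  -- `η`.
  set Lu := link X (G η₀) (cutOutside b O) with hLu
  have hL : ∀ η, link X (G η) (cutOutside b O) = Lu := fun η =>
    link_cutOutside_congr hO fun s j h => hG _ _ s j h
  set m : ℕ → ℕ := fun T => (usedPositions snd Lu b O T).card with hm
  have hmmsg : ∀ T, m T ≤ msgCount snd Lu O T := fun T => card_usedPositions_le snd Lu b O T
  set op : ℕ → Finset (ι → Fin q) := fun T =>
    Finset.univ.filter fun η => Opened snd Lu (G η) b O T with hop
  have hOmem : ∀ T z, z ∈ usedPositions snd Lu b O T → z.1 ∈ O := by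
    intro T z hz
    simp only [usedPositions, Finset.mem_biUnion, Finset.mem_image, Finset.mem_filter] at hz
    obtain ⟨t, -, h, ⟨-, h1, -⟩, rfl⟩ := hz
    rw [positions]; split_ifs <;> exact h1
  have hcard : ∀ T, (op T).card * q ^ 2 ≤ m T * nH := by
    intro T
    have hsub : op T ⊆ (usedPositions snd Lu b O T).biUnion fun z =>
        Finset.univ.filter fun η : ι → Fin q => η (emb (z.1, firstOf b)) = z.2.1 ∧
          η (emb (z.1, partner (firstOf b))) = z.2.2 := by
      intro η hη
      rw [hop, Finset.mem_filter] at hη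
      obtain ⟨s, hs⟩ := hη.2.mem_usedPositions
      refine Finset.mem_biUnion.2 ⟨_, hs, Finset.mem_filter.2 ⟨Finset.mem_univ _, ?_, ?_⟩⟩
      · exact (hG' η s _ (hOmem T _ hs) (pairOf_firstOf b)).symm
      · exact (hG' η s _ (hOmem T _ hs) (by rw [pairOf_partner, pairOf_firstOf])).symm
    calc (op T).card * q ^ 2
        ≤ (∑ z ∈ usedPositions snd Lu b O T, (Finset.univ.filter fun η : ι → Fin q =>
          η (emb (z.1, firstOf b)) = z.2.1 ∧
          η (emb (z.1, partner (firstOf b))) = z.2.2).card) * q ^ 2 :=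
          Nat.mul_le_mul_right _ ((Finset.card_le_card hsub).trans Finset.card_biUnion_le)
      _ = ∑ z ∈ usedPositions snd Lu b O T, (Finset.univ.filter fun η : ι → Fin q =>
          η (emb (z.1, firstOf b)) = z.2.1 ∧
          η (emb (z.1, partner (firstOf b))) = z.2.2).card * q ^ 2 := Finset.sum_mul _ _ _
      _ ≤ m T * nH := Finset.sum_le_card_nsmul _ _ _ fun z _ => card_eq_eq_mul_le (fun h => by
          have := congrArg Prod.snd (hemb h)
          exact partner_ne _ this.symm) _ _
  have hmsg : ∀ T t η, t ≤ T + 1 → η ∉ op T →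
      m t ≤ msgCount snd (link X (G η) fun _ _ => True) O t := by
    intro T t η ht hη
    rw [hop, Finset.mem_filter, not_and] at hη
    have := hη (Finset.mem_univ _)
    rw [← hL η] at this
    rw [msgCount_eq_of_not_opened hO this ht, hL]
    exact hmmsg t
  have hle : ∑ η, (if Opened snd (link X (G η) fun _ _ => True) (G η) b O T then 1 else 0) ≤
      (op T).card := by
    rw [← Finset.card_filter]
    refine Finset.card_le_card fun η hη => ?_
    rw [Finset.mem_filter] at hη
    refine Finset.mem_filter.2 ⟨Finset.mem_univ _, ?_⟩
    have := hη.2.uncut hO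
    rwa [hL] at this
  -- As long as at most q²/2 positions are used, at least half of the `η` remain unopened.
  have half : ∀ t, 2 * m t ≤ q ^ 2 → nH ≤ 2 * (op t)ᶜ.card := by
    intro t ht
    have h1 := hcard t
    have h2 : (op t).card + (op t)ᶜ.card = nH := by rw [Finset.card_add_card_compl]
    have h3 : 2 * (op t).card * q ^ 2 ≤ nH * q ^ 2 := by nlinarith
    have h4 := Nat.le_of_mul_le_mul_right h3 (by positivity)
    omega
  have hsum : ∀ t t', t' ≤ t + 1 → t' ≤ T → (op t)ᶜ.card * m t' ≤
      ∑ η, msgCount snd (link X (G η) fun _ _ => True) O T := by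
    intro t t' h1 h2
    calc (op t)ᶜ.card * m t' = ∑ η ∈ (op t)ᶜ, m t' := by simp
      _ ≤ ∑ η ∈ (op t)ᶜ, msgCount snd (link X (G η) fun _ _ => True) O T := by
          refine Finset.sum_le_sum fun η hη => ?_
          exact (hmsg t t' η h1 (Finset.mem_compl.1 hη)).trans (msgCount_mono _ _ _ h2)
      _ ≤ _ := Finset.sum_le_sum_of_subset (Finset.subset_univ _)
  refine (Nat.mul_le_mul_left _ hle).trans ?_
  by_cases hcase : 2 * m T ≤ q ^ 2
  · have h1 := half T hcase
    have h2 := hsum T T (by omega) le_rfl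
    have h3 := hcard T
    nlinarith [Nat.mul_le_mul_right (m T) h1]
  -- Let `t + 1` be the first time with more than q²/2 positions used. At time `t` half of the `η`
  -- are unopened, and these still send everything that the uncut execution sends up to time `t +
  -- 1`. The two halves give the constant 4.
  · have hex : ∃ t, ¬ 2 * m t ≤ q ^ 2 := ⟨T, hcase⟩
    have hspec := Nat.find_spec hex
    have hT : Nat.find hex ≤ T := Nat.find_le hcase
    rcases hf : Nat.find hex with _ | t
    · rw [hf] at hspec
      simp [hm, usedPositions] at hspec
    · rw [hf] at hspec hT
      have hlt : 2 * m t ≤ q ^ 2 := not_not.1 (Nat.find_min hex (m := t) (by omega))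
      have h1 := half t hlt
      have h2 := hsum t (t + 1) le_rfl hT
      have h3 : (op T).card ≤ nH := Finset.card_le_univ _
      have h4 : q ^ 2 ≤ 2 * m (t + 1) := by omega
      calc q ^ 2 * (op T).card ≤ (2 * m (t + 1)) * (2 * (op t)ᶜ.card) :=
            Nat.mul_le_mul h4 (h3.trans h1)
        _ = 4 * ((op t)ᶜ.card * m (t + 1)) := by ring
        _ ≤ _ := Nat.mul_le_mul_left _ h2

-- The coordinates outside the pairs of `O` are frozen, the fixed case is applied to the remaining
-- ones, and the result is averaged.
open Classical in
lemma sum_opened_le {b : Fin 2} {O : Finset W} (hO : TrailClosed X b O)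
    (snd : W × Fin (4 * q) → List (PortMsgs (4 * q - 1)) → PortMsgs (4 * q - 1))
    {emb : W × Fin 4 → ι} (hemb : Function.Injective emb) (T : ℕ) :
    q ^ 2 * ∑ γ, (if Opened snd (link X (choiceAt emb γ) fun _ _ => True)
        (choiceAt emb γ) b O T then 1 else 0) ≤
      4 * ∑ γ, msgCount snd (link X (choiceAt emb γ) fun _ _ => True) O T := by
  rcases isEmpty_or_nonempty (ι → Fin q) with hE | hE
  · simp
  set K : ι → Prop := fun i => ∃ s j, emb (s, j) = i ∧ s ∈ O ∧ pairOf j = b with hK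
  have hKe : ∀ s j, K (emb (s, j)) ↔ s ∈ O ∧ pairOf j = b := by
    intro s j
    constructor
    · rintro ⟨s', j', h, h'⟩
      obtain ⟨rfl, rfl⟩ := Prod.mk.inj (hemb h)
      exact h'
    · exact fun h => ⟨s, j, rfl, h⟩
  have h1 : ∀ γ : ι → Fin q, _ := fun γ => sum_opened_le_of_fixed hO snd hemb T
    (fun η => choiceAt emb (resample K γ η))
    (fun η η' s j h => by
      have : ¬ K (emb (s, j)) := fun hk => h ((hKe s j).1 hk)
      simp only [choiceAt, resample, if_neg this])
    (fun η s j hs hj => by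
      simp only [choiceAt, resample, if_pos ((hKe s j).2 ⟨hs, hj⟩)])
  have h2 := Finset.sum_le_sum fun γ (_ : γ ∈ Finset.univ) => h1 γ
  rw [← Finset.mul_sum, ← Finset.mul_sum] at h2
  rw [sum_resample K (fun γ => if Opened snd (link X (choiceAt emb γ) fun _ _ => True)
        (choiceAt emb γ) b O T then 1 else 0),
    sum_resample K (fun γ => msgCount snd (link X (choiceAt emb γ) fun _ _ => True) O T)] at h2
  have hpos : 0 < Fintype.card (ι → Fin q) := Fintype.card_pos
  refine Nat.le_of_mul_le_mul_left ?_ hpos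
  calc _ = q ^ 2 * (Fintype.card (ι → Fin q) * ∑ γ, (if Opened snd (link X (choiceAt emb γ)
        fun _ _ => True) (choiceAt emb γ) b O T then 1 else 0)) := by ring
    _ ≤ _ := h2
    _ = _ := by ring

end Trails

/-! ### Random executions: splicing and reindexing -/

section Samples

/-- The random data of a node: a position, an ID and a random bit string. -/
abbrev NodeData (q M : ℕ) : Type := (Fin q × Fin M) × (ℕ → Bool)

/-- The random data of all nodes. -/
abbrev Sample (W : Type) (q M : ℕ) : Type := W × Fin (4 * q) → NodeData q M

variable {W : Type} [Fintype W] [DecidableEq W] (A : Algorithm) (X : CycleExpander W) {q M : ℕ}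
  (ν : Fin 4 → Fin (4 * q))

/-- The positions of the external nodes are stored at the nodes `ν j` of the cliques. -/
def choiceOf (ω : Sample W q M) : W → Fin 4 → Fin q := fun s j => (ω (s, ν j)).1.1

/-- The ID of a node. -/
def idOf (ω : Sample W q M) (v : W × Fin (4 * q)) : ℕ := (ω v).1.2.val + 1

/-- What the nodes send. -/
def sendOf (ω : Sample W q M) (v : W × Fin (4 * q)) :
    List (PortMsgs (4 * q - 1)) → PortMsgs (4 * q - 1) :=
  A.send (Fintype.card (W × Fin (4 * q))) (idOf ω v) (4 * q - 1) (ω v).2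

/-- The matching of the half-edges. -/
noncomputable def linkOf (ω : Sample W q M) :
    (W × Fin (4 * q)) × Fin (4 * q - 1) → (W × Fin (4 * q)) × Fin (4 * q - 1) :=
  link X (choiceOf ν ω) fun _ _ => True

/-- The messages received in the first `t` rounds. -/
noncomputable def history (ω : Sample W q M) (t : ℕ) (v : W × Fin (4 * q)) :
    List (PortMsgs (4 * q - 1)) :=
  run (sendOf A ω) (linkOf X ν ω) t v

/-- The message sent over a half-edge in round `t`. -/
noncomputable def message (ω : Sample W q M) (t : ℕ) (h : (W × Fin (4 * q)) × Fin (4 * q - 1)) :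
    Option Msg :=
  sendOf A ω h.1 (history A X ν ω t h.1) h.2

/-- The leader flag of a node after `t` rounds. -/
noncomputable def raised (ω : Sample W q M) (t : ℕ) (v : W × Fin (4 * q)) : Bool :=
  A.flag (Fintype.card (W × Fin (4 * q))) (idOf ω v) (4 * q - 1) (ω v).2 (history A X ν ω t v)

/-- The execution solves leader election, with leader `l`. -/
def ElectsAt (ω : Sample W q M) (l : W × Fin (4 * q)) : Prop :=
  ∃ T, ∀ t ≥ T, (∀ h, message A X ν ω t h = none) ∧ ∀ v, raised A X ν ω t v = true ↔ v = l

/-- From some round on, the nodes with raised flags are those in `S`. -/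
def LeadersAre (ω : Sample W q M) (S : Finset (W × Fin (4 * q))) : Prop :=
  ∃ T, ∀ t ≥ T, ∀ v, raised A X ν ω t v = true ↔ v ∈ S

/-- A message passes over the `j`-th external edge of the clique of `s`. -/
def UsedEdge (ω : Sample W q M) (s : W) (j : Fin 4) : Prop :=
  ∃ t, (message A X ν ω t (extHalfEdge (choiceOf ν ω) s j)).isSome ∨
    (message A X ν ω t (extHalfEdge (choiceOf ν ω) (X.step j s) (partner j))).isSome

/-- A message passes over some external edge of the clique of `s`. -/
def Touched (ω : Sample W q M) (s : W) : Prop := ∃ j, UsedEdge A X ν ω s j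

variable {A X ν}

lemma LeadersAre.unique {ω : Sample W q M} {S S' : Finset (W × Fin (4 * q))}
    (h : LeadersAre A X ν ω S) (h' : LeadersAre A X ν ω S') : S = S' := by
  obtain ⟨T, hT⟩ := h
  obtain ⟨T', hT'⟩ := h'
  ext v
  rw [← hT (max T T') (le_max_left _ _) v, hT' (max T T') (le_max_right _ _) v]

lemma ElectsAt.leadersAre {ω : Sample W q M} {l : W × Fin (4 * q)} (h : ElectsAt A X ν ω l) :
    LeadersAre A X ν ω {l} := by
  obtain ⟨T, hT⟩ := h
  exact ⟨T, fun t ht v => by rw [(hT t ht).2 v, Finset.mem_singleton]⟩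

lemma ElectsAt.unique {ω : Sample W q M} {l l' : W × Fin (4 * q)} (h : ElectsAt A X ν ω l)
    (h' : ElectsAt A X ν ω l') : l = l' :=
  Finset.singleton_injective (h.leadersAre.unique h'.leadersAre)

lemma usedEdge_step {ω : Sample W q M} {s : W} {j : Fin 4} :
    UsedEdge A X ν ω (X.step j s) (partner j) ↔ UsedEdge A X ν ω s j := by
  simp only [UsedEdge, X.step_partner, partner_partner]
  exact exists_congr fun t => or_comm

lemma message_eq_sentOver (ω : Sample W q M) (t : ℕ)
    (h : (W × Fin (4 * q)) × Fin (4 * q - 1)) :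
    message A X ν ω t h = sentOver (sendOf A ω) (linkOf X ν ω) t h := rfl

lemma extHalfEdge_congr {g g' : W → Fin 4 → Fin q} {s : W} (h : ∀ j, g s j = g' s j) (j : Fin 4) :
    extHalfEdge g s j = extHalfEdge g' s j := by
  have hn : ∀ j, extNode g s j = extNode g' s j := fun j => by rw [extNode, h j, extNode]
  refine halfEdge_ext (Prod.ext rfl (hn j)) ?_
  rw [extHalfEdge, extHalfEdge, dir_halfEdge, dir_halfEdge, hn]

lemma isCut_congr {g g' : W → Fin 4 → Fin q} {s : W} (h : ∀ j, g s j = g' s j)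
    {C : W → Fin 4 → Prop} {i l : Fin (4 * q)} : IsCut g C s i l ↔ IsCut g' C s i l := by
  have hn : ∀ j, extNode g s j = extNode g' s j := fun j => by rw [extNode, h j, extNode]
  rw [IsCut, IsCut, hn, hn]

lemma history_succ (ω : Sample W q M) (t : ℕ) (v : W × Fin (4 * q)) :
    history A X ν ω (t + 1) v =
      (fun p => message A X ν ω t (linkOf X ν ω (v, p))) :: history A X ν ω t v := rfl

/-- Replace the data of the cliques in `D` by those of `ω'`. -/
def splice (D : Finset W) (ω ω' : Sample W q M) : Sample W q M :=
  fun v => if v.1 ∈ D then ω' v else ω v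

/-- No edge across the boundary of `D` is used in `ω` or in `ω'`. -/
def Separates (A : Algorithm) (X : CycleExpander W) (ν : Fin 4 → Fin (4 * q)) (D : Finset W)
    (ω ω' : Sample W q M) : Prop :=
  ∀ s j, (s ∈ D ↔ X.step j s ∈ D) ∨ (¬ UsedEdge A X ν ω s j ∧ ¬ UsedEdge A X ν ω' s j)

lemma choiceOf_splice (D : Finset W) (ω ω' : Sample W q M) (s : W) (j : Fin 4) :
    choiceOf ν (splice D ω ω') s j = choiceOf ν (if s ∈ D then ω' else ω) s j := by
  simp only [choiceOf, splice]; split_ifs <;> rfl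

lemma splice_apply (D : Finset W) (ω ω' : Sample W q M) (v : W × Fin (4 * q)) :
    splice D ω ω' v = (if v.1 ∈ D then ω' else ω) v := by
  simp only [splice]; split_ifs <;> rfl

lemma sendOf_splice (D : Finset W) (ω ω' : Sample W q M) (v : W × Fin (4 * q)) :
    sendOf A (splice D ω ω') v = sendOf A (if v.1 ∈ D then ω' else ω) v := by
  simp only [sendOf, idOf, splice_apply]

/-- No message crosses the boundary of `D` in either sample, so each side replays its own execution
and receives nothing from the other. Colliding IDs do no harm, since executions are defined for all
samples. -/
lemma history_splice {D : Finset W} {ω ω' : Sample W q M} (hD : Separates A X ν D ω ω') (t : ℕ)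
    (v : W × Fin (4 * q)) :
    history A X ν (splice D ω ω') t v = history A X ν (if v.1 ∈ D then ω' else ω) t v := by
  induction t generalizing v with
  | zero => rfl
  | succ t ih =>
    rw [history_succ, history_succ, ih v]
    congr 1
    funext p
    have hmsg : ∀ h, message A X ν (splice D ω ω') t h =
        message A X ν (if h.1.1 ∈ D then ω' else ω) t h := by
      intro h
      rw [message, message, sendOf_splice, ih]
    rw [hmsg]
    set src : W → Sample W q M := fun s => if s ∈ D then ω' else ω with hsrc
    have hch : ∀ s j, choiceOf ν (splice D ω ω') s j = choiceOf ν (src s) s j :=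
      fun s j => choiceOf_splice D ω ω' s j
    change message A X ν (src _) t _ = message A X ν (src v.1) t _
    by_cases hc : IsCut (choiceOf ν (src v.1)) (fun _ _ => True) v.1 v.2 (dir (v, p))
    · have hc' := (isCut_congr (hch v.1)).2 hc
      have e1 := eq_extHalfEdge_of_isCut (h := (v, p)) hc
      have e2 := eq_extHalfEdge_of_isCut (h := (v, p)) hc'
      have l1 : linkOf X ν (src v.1) (v, p) =
          extHalfEdge (choiceOf ν (src v.1)) (X.step (block v.2) v.1) (partner (block v.2)) := by
        conv_lhs => rw [e1]
        exact link_extHalfEdge X trivial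
      have l2 : linkOf X ν (splice D ω ω') (v, p) =
          extHalfEdge (choiceOf ν (src (X.step (block v.2) v.1))) (X.step (block v.2) v.1)
            (partner (block v.2)) := by
        conv_lhs => rw [e2]
        rw [← extHalfEdge_congr (hch _)]
        exact link_extHalfEdge X trivial
      rw [l1, l2]
      change message A X ν (src (X.step (block v.2) v.1)) t _ = _
      -- Either both ends of the external edge take their data from the same sample, or the edge is
      -- silent in both samples and its exact ends are irrelevant.
      rcases hD v.1 (block v.2) with h | ⟨h1, h2⟩
      · have : src (X.step (block v.2) v.1) = src v.1 := by
          simp only [hsrc, h]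
        rw [this]
      · have hnone : ∀ s', message A X ν (src s') t (extHalfEdge (choiceOf ν (src s'))
            (X.step (block v.2) v.1) (partner (block v.2))) = none := by
          intro s'
          have hu : ¬ UsedEdge A X ν (src s') v.1 (block v.2) := by
            simp only [hsrc]; split_ifs
            · exact h2
            · exact h1
          by_contra hne
          exact hu ⟨t, Or.inr (Option.isSome_iff_ne_none.2 hne)⟩
        rw [hnone, hnone]
    · have hc' : ¬ IsCut (choiceOf ν (splice D ω ω')) (fun _ _ => True) v.1 v.2 (dir (v, p)) :=
        fun h => hc ((isCut_congr (hch v.1)).1 h)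
      rw [linkOf, linkOf, link_of_not_isCut X (h := (v, p)) hc,
        link_of_not_isCut X (h := (v, p)) hc']
      rfl

lemma message_splice {D : Finset W} {ω ω' : Sample W q M} (hD : Separates A X ν D ω ω') (t : ℕ)
    (h : (W × Fin (4 * q)) × Fin (4 * q - 1)) :
    message A X ν (splice D ω ω') t h = message A X ν (if h.1.1 ∈ D then ω' else ω) t h := by
  rw [message, message, sendOf_splice, history_splice hD]

lemma raised_splice {D : Finset W} {ω ω' : Sample W q M} (hD : Separates A X ν D ω ω') (t : ℕ)
    (v : W × Fin (4 * q)) :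
    raised A X ν (splice D ω ω') t v = raised A X ν (if v.1 ∈ D then ω' else ω) t v := by
  rw [raised, raised, history_splice hD, idOf, idOf, splice_apply]

lemma usedEdge_splice {D : Finset W} {ω ω' : Sample W q M} (hD : Separates A X ν D ω ω') (s : W)
    (j : Fin 4) :
    UsedEdge A X ν (splice D ω ω') s j ↔ UsedEdge A X ν (if s ∈ D then ω' else ω) s j := by
  set src : W → Sample W q M := fun s => if s ∈ D then ω' else ω with hsrc
  have hm : ∀ t s j, message A X ν (splice D ω ω') t (extHalfEdge (choiceOf ν (splice D ω ω')) s j) =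
      message A X ν (src s) t (extHalfEdge (choiceOf ν (src s)) s j) := by
    intro t s j
    rw [extHalfEdge_congr (fun j => choiceOf_splice D ω ω' s j), message_splice hD]
    rfl
  change _ ↔ UsedEdge A X ν (src s) s j
  rw [UsedEdge, UsedEdge]
  simp only [hm]
  rcases hD s j with h | ⟨h1, h2⟩
  · have : src (X.step j s) = src s := by simp only [hsrc, h]
    rw [this]
  · have hu : ∀ s', ¬ UsedEdge A X ν (src s') s j := by
      intro s'
      simp only [hsrc]; split_ifs
      · exact h2
      · exact h1
    constructor
    · rintro ⟨t, h | h⟩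
      · exact absurd ⟨t, Or.inl h⟩ (hu s)
      · exact absurd ⟨t, Or.inr h⟩ (hu (X.step j s))
    · rintro ⟨t, h⟩
      exact absurd ⟨t, h⟩ (hu s)

lemma Separates.symm {D : Finset W} {ω ω' : Sample W q M} (hD : Separates A X ν D ω ω') :
    Separates A X ν D ω' ω := fun s j => (hD s j).imp id And.symm

lemma usedEdge_splice_or {D : Finset W} {ω ω' : Sample W q M} (hD : Separates A X ν D ω ω')
    (s : W) (j : Fin 4) :
    (UsedEdge A X ν (splice D ω ω') s j ∨ UsedEdge A X ν (splice D ω' ω) s j) ↔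
      (UsedEdge A X ν ω s j ∨ UsedEdge A X ν ω' s j) := by
  rw [usedEdge_splice hD, usedEdge_splice hD.symm]
  split_ifs
  · exact or_comm
  · rfl

/-- The cliques that can be reached from `s` along edges that are used in `ω` or in `ω'`. -/
noncomputable def cluster (A : Algorithm) (X : CycleExpander W) (ν : Fin 4 → Fin (4 * q))
    (ω ω' : Sample W q M) (s : W) : Finset W := by
  classical
  exact Finset.univ.filter fun r => Relation.ReflTransGen
    (fun a b => ∃ j, X.step j a = b ∧ (UsedEdge A X ν ω a j ∨ UsedEdge A X ν ω' a j)) s r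

lemma mem_cluster {ω ω' : Sample W q M} {s r : W} :
    r ∈ cluster A X ν ω ω' s ↔ Relation.ReflTransGen
      (fun a b => ∃ j, X.step j a = b ∧ (UsedEdge A X ν ω a j ∨ UsedEdge A X ν ω' a j)) s r := by
  simp [cluster]

lemma self_mem_cluster (ω ω' : Sample W q M) (s : W) : s ∈ cluster A X ν ω ω' s :=
  mem_cluster.2 Relation.ReflTransGen.refl

lemma separates_cluster (ω ω' : Sample W q M) (s : W) :
    Separates A X ν (cluster A X ν ω ω' s) ω ω' := by
  intro a j
  by_cases hu : UsedEdge A X ν ω a j ∨ UsedEdge A X ν ω' a j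
  · left
    rw [mem_cluster, mem_cluster]
    refine ⟨fun h => h.tail ⟨j, rfl, hu⟩, fun h => h.tail ⟨partner j, X.step_partner j a, ?_⟩⟩
    rwa [usedEdge_step, usedEdge_step]
  · right; exact not_or.1 hu

/-- Exchanging sides affects each edge in both samples at once or not at all, so the union of the
used edges is unchanged. Hence the cluster can be recovered after the exchange. -/
lemma cluster_splice {D : Finset W} {ω ω' : Sample W q M} (hD : Separates A X ν D ω ω') (s : W) :
    cluster A X ν (splice D ω ω') (splice D ω' ω) s = cluster A X ν ω ω' s := by
  ext r
  rw [mem_cluster, mem_cluster]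
  simp only [usedEdge_splice_or hD]

/-- Splicing the cluster of one leader into an execution with another leader yields two
leaders. -/
lemma leadersAre_splice {ω ω' : Sample W q M} {l l' : W × Fin (4 * q)}
    (h : ElectsAt A X ν ω l) (h' : ElectsAt A X ν ω' l')
    (hl : l.1 ∉ cluster A X ν ω ω' l'.1) :
    LeadersAre A X ν (splice (cluster A X ν ω ω' l'.1) ω ω') {l, l'} := by
  obtain ⟨T, hT⟩ := h
  obtain ⟨T', hT'⟩ := h'
  refine ⟨max T T', fun t ht v => ?_⟩
  have h1 := (hT t ((le_max_left _ _).trans ht)).2 v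
  have h2 := (hT' t ((le_max_right _ _).trans ht)).2 v
  rw [raised_splice (separates_cluster ω ω' l'.1), Finset.mem_insert, Finset.mem_singleton]
  split_ifs with hv
  · rw [h2]
    constructor
    · exact Or.inr
    · rintro (rfl | h)
      · exact absurd hv hl
      · exact h
  · rw [h1]
    constructor
    · exact Or.inl
    · rintro (h | rfl)
      · exact h
      · exact absurd (self_mem_cluster _ _ _) hv

/-- If `s` is untouched in `ω`, then a path from `s` uses only edges of `ω'`: each such edge touches
its end in `ω'`, which is therefore untouched in `ω`, and so on. -/
lemma touched_of_mem_cluster {ω ω' : Sample W q M} (hdisj : ∀ s, ¬ (Touched A X ν ω s ∧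
    Touched A X ν ω' s)) {s r : W} (h : r ∈ cluster A X ν ω ω' s) :
    r = s ∨ Touched A X ν ω s ∨ Touched A X ν ω' r := by
  rw [mem_cluster] at h
  by_cases hs : Touched A X ν ω s
  · exact Or.inr (Or.inl hs)
  have : r = s ∨ Touched A X ν ω' r := by
    induction h with
    | refl => exact Or.inl rfl
    | @tail a b _ hab ih =>
      obtain ⟨j, rfl, hu⟩ := hab
      have hna : ¬ Touched A X ν ω a := by
        rcases ih with rfl | ih
        · exact hs
        · exact fun h => hdisj a ⟨h, ih⟩
      right
      rcases hu with hu | hu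
      · exact absurd ⟨j, hu⟩ hna
      · exact ⟨partner j, usedEdge_step.2 hu⟩
  rcases this with h | h
  · exact Or.inl h
  · exact Or.inr (Or.inr h)

/-- Reindex the cliques. -/
def reindex (σ : Equiv.Perm W) (ω : Sample W q M) : Sample W q M := fun v => ω (σ v.1, v.2)

lemma step_comm {σ : Equiv.Perm W} (hσ : ∀ b w, σ (X.perm b w) = X.perm b (σ w)) (j : Fin 4)
    (w : W) : σ (X.step j w) = X.step j (σ w) := by
  have hs : ∀ b w, σ ((X.perm b).symm w) = (X.perm b).symm (σ w) := by
    intro b w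
    rw [Equiv.eq_symm_apply, ← hσ, Equiv.apply_symm_apply]
  fin_cases j
  · exact hσ 0 w
  · exact hs 0 w
  · exact hσ 1 w
  · exact hs 1 w

/-- The action of a permutation of the cliques on half-edges. -/
def reindexHalfEdge (σ : Equiv.Perm W) (h : (W × Fin (4 * q)) × Fin (4 * q - 1)) :
    (W × Fin (4 * q)) × Fin (4 * q - 1) := ((σ h.1.1, h.1.2), h.2)

lemma reindexHalfEdge_ext (σ : Equiv.Perm W) (ω : Sample W q M) (s : W) (j : Fin 4) :
    reindexHalfEdge σ (extHalfEdge (choiceOf ν (reindex σ ω)) s j) =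
      extHalfEdge (choiceOf ν ω) (σ s) j := rfl

/-- All cliques have the same port numbering, so an automorphism that respects the two generators
carries half-edges to half-edges. -/
lemma linkOf_reindex {σ : Equiv.Perm W} (hσ : ∀ b w, σ (X.perm b w) = X.perm b (σ w))
    (ω : Sample W q M) (h : (W × Fin (4 * q)) × Fin (4 * q - 1)) :
    linkOf X ν ω (reindexHalfEdge σ h) = reindexHalfEdge σ (linkOf X ν (reindex σ ω) h) := by
  by_cases hc : IsCut (choiceOf ν (reindex σ ω)) (fun _ _ => True) h.1.1 h.1.2 (dir h)
  · have e := eq_extHalfEdge_of_isCut hc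
    rw [e, reindexHalfEdge_ext, linkOf, linkOf, link_extHalfEdge X trivial,
      link_extHalfEdge X trivial, reindexHalfEdge_ext, step_comm hσ]
  · have hc' : ¬ IsCut (choiceOf ν ω) (fun _ _ => True) (reindexHalfEdge σ h).1.1
        (reindexHalfEdge σ h).1.2 (dir (reindexHalfEdge σ h)) := hc
    rw [linkOf, linkOf, link_of_not_isCut X hc, link_of_not_isCut X hc']
    rfl

lemma history_reindex {σ : Equiv.Perm W} (hσ : ∀ b w, σ (X.perm b w) = X.perm b (σ w))
    (ω : Sample W q M) (t : ℕ) (v : W × Fin (4 * q)) :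
    history A X ν (reindex σ ω) t v = history A X ν ω t (σ v.1, v.2) := by
  induction t generalizing v with
  | zero => rfl
  | succ t ih =>
    rw [history_succ, history_succ, ih v]
    congr 1
    funext p
    have := linkOf_reindex (ν := ν) hσ ω (v, p)
    change linkOf X ν ω ((σ v.1, v.2), p) = _ at this
    rw [this, message, message, ih]
    rfl

lemma message_reindex {σ : Equiv.Perm W} (hσ : ∀ b w, σ (X.perm b w) = X.perm b (σ w))
    (ω : Sample W q M) (t : ℕ) (h : (W × Fin (4 * q)) × Fin (4 * q - 1)) :
    message A X ν (reindex σ ω) t h = message A X ν ω t (reindexHalfEdge σ h) := by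
  rw [message, message, history_reindex hσ]; rfl

lemma raised_reindex {σ : Equiv.Perm W} (hσ : ∀ b w, σ (X.perm b w) = X.perm b (σ w))
    (ω : Sample W q M) (t : ℕ) (v : W × Fin (4 * q)) :
    raised A X ν (reindex σ ω) t v = raised A X ν ω t (σ v.1, v.2) := by
  rw [raised, raised, history_reindex hσ]; rfl

lemma touched_reindex {σ : Equiv.Perm W} (hσ : ∀ b w, σ (X.perm b w) = X.perm b (σ w))
    (ω : Sample W q M) (s : W) :
    Touched A X ν (reindex σ ω) s ↔ Touched A X ν ω (σ s) := by
  simp only [Touched, UsedEdge, message_reindex hσ, reindexHalfEdge_ext, step_comm hσ]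

lemma electsAt_reindex {σ : Equiv.Perm W} (hσ : ∀ b w, σ (X.perm b w) = X.perm b (σ w))
    (ω : Sample W q M) (l : W × Fin (4 * q)) :
    ElectsAt A X ν (reindex σ ω) l ↔ ElectsAt A X ν ω (σ l.1, l.2) := by
  simp only [ElectsAt, message_reindex hσ, raised_reindex hσ]
  refine exists_congr fun T => forall_congr' fun t => imp_congr_right fun _ => and_congr ?_ ?_
  · constructor
    · intro h h'
      have := h ((σ.symm h'.1.1, h'.1.2), h'.2)
      simpa [reindexHalfEdge] using this
    · exact fun h h' => h _
  · constructor
    · intro h v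
      have := h (σ.symm v.1, v.2)
      simp only [Equiv.apply_symm_apply, Prod.mk.eta] at this
      rw [this, Prod.ext_iff, Prod.ext_iff, Equiv.symm_apply_eq]
    · intro h v
      rw [h, Prod.ext_iff, Prod.ext_iff, σ.injective.eq_iff]

lemma idOf_reindex_injective (σ : Equiv.Perm W) (ω : Sample W q M) :
    Function.Injective (idOf (reindex σ ω)) ↔ Function.Injective (idOf ω) := by
  have : idOf (reindex σ ω) = idOf ω ∘ (σ.prodCongr (Equiv.refl (Fin (4 * q)))) := rfl
  rw [this, Equiv.injective_comp]

end Samples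

/-! ### Measurability through countable fibres -/

section DiscreteMeasurable

variable {Ω β γ : Type*} [MeasurableSpace Ω]

/-- A function all of whose fibres are measurable. -/
def DiscreteMeasurable (f : Ω → β) : Prop := ∀ b, MeasurableSet {ω | f ω = b}

/-- A countably valued intermediate result may be treated as a constant on each of its fibres. This
handles message histories without any σ-algebra on them. -/
lemma DiscreteMeasurable.bind [Countable β] {f : Ω → β} (hf : DiscreteMeasurable f)
    {F : β → Ω → γ} (hF : ∀ b, DiscreteMeasurable (F b)) :
    DiscreteMeasurable fun ω => F (f ω) ω := by
  intro c
  have : {ω | F (f ω) ω = c} = ⋃ b, {ω | f ω = b} ∩ {ω | F b ω = c} := by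
    ext ω; simp
  rw [this]
  exact MeasurableSet.iUnion fun b => (hf b).inter (hF b c)

lemma DiscreteMeasurable.const (c : β) : DiscreteMeasurable fun _ : Ω => c :=
  fun _ => MeasurableSet.const _

lemma DiscreteMeasurable.comp [Countable β] {f : Ω → β} (hf : DiscreteMeasurable f) (F : β → γ) :
    DiscreteMeasurable fun ω => F (f ω) :=
  hf.bind (F := fun b _ => F b) fun _ => .const _

lemma DiscreteMeasurable.setOf [Countable β] {f : Ω → β} (hf : DiscreteMeasurable f)
    (p : β → Prop) : MeasurableSet {ω | p (f ω)} := by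
  have := hf.comp p True
  simpa using this

lemma DiscreteMeasurable.pi {ι : Type*} [Countable ι] {f : Ω → ι → β}
    (hf : ∀ i, DiscreteMeasurable fun ω => f ω i) : DiscreteMeasurable f := by
  intro b
  have : {ω | f ω = b} = ⋂ i, {ω | f ω i = b i} := by ext ω; simp [funext_iff]
  rw [this]
  exact MeasurableSet.iInter fun i => hf i (b i)

lemma Measurable.discreteMeasurable [MeasurableSpace β] [MeasurableSingletonClass β] {f : Ω → β}
    (hf : Measurable f) : DiscreteMeasurable f := fun b => hf (measurableSet_singleton b)

end DiscreteMeasurable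

/-! ### Measurability of the events of an execution -/

section Measurability

variable {W : Type} [Fintype W] [DecidableEq W] {A : Algorithm} {X : CycleExpander W} {q M : ℕ}
  {ν : Fin 4 → Fin (4 * q)}

/-- The finite part of the random data. -/
def labels (ω : Sample W q M) : W × Fin (4 * q) → Fin q × Fin M := fun v => (ω v).1

lemma discreteMeasurable_labels : DiscreteMeasurable (labels (W := W) (q := q) (M := M)) := by
  refine DiscreteMeasurable.pi fun v => Measurable.discreteMeasurable ?_
  exact (measurable_pi_apply v).fst

lemma discreteMeasurable_idOf (v : W × Fin (4 * q)) :
    DiscreteMeasurable fun ω : Sample W q M => idOf ω v :=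
  discreteMeasurable_labels.comp fun d => (d v).2.val + 1

lemma discreteMeasurable_choiceOf :
    DiscreteMeasurable fun ω : Sample W q M => choiceOf ν ω :=
  discreteMeasurable_labels.comp fun d s j => (d (s, ν j)).1

lemma discreteMeasurable_message_of_history {t : ℕ} {h : (W × Fin (4 * q)) × Fin (4 * q - 1)}
    (hh : DiscreteMeasurable fun ω : Sample W q M => history A X ν ω t h.1) :
    DiscreteMeasurable fun ω : Sample W q M => message A X ν ω t h := by
  refine (discreteMeasurable_idOf h.1).bind (F := fun i ω => A.send (Fintype.card _) i _
    (ω h.1).2 (history A X ν ω t h.1) h.2) fun i => ?_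
  refine hh.bind (F := fun l ω => A.send (Fintype.card _) i _ (ω h.1).2 l h.2) fun l => ?_
  intro b
  have hm : Measurable fun ω : Sample W q M => (ω h.1).2 := (measurable_pi_apply h.1).snd
  exact hm (A.measurableSet_send _ i _ l h.2 b)

lemma discreteMeasurable_history (t : ℕ) (v : W × Fin (4 * q)) :
    DiscreteMeasurable fun ω : Sample W q M => history A X ν ω t v := by
  induction t generalizing v with
  | zero => exact .const _
  | succ t ih =>
    simp only [history_succ]
    refine (ih v).bind (F := fun l ω => (fun p => message A X ν ω t (linkOf X ν ω (v, p))) :: l)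
      fun l => ?_
    refine DiscreteMeasurable.comp (f := fun ω p => message A X ν ω t (linkOf X ν ω (v, p)))
      (F := fun f => f :: l) (DiscreteMeasurable.pi fun p => ?_)
    refine (discreteMeasurable_choiceOf (ν := ν)).bind
      (F := fun g ω => message A X ν ω t (link X g (fun _ _ => True) (v, p))) fun g => ?_
    exact discreteMeasurable_message_of_history (ih _)

lemma discreteMeasurable_message (t : ℕ) (h : (W × Fin (4 * q)) × Fin (4 * q - 1)) :
    DiscreteMeasurable fun ω : Sample W q M => message A X ν ω t h :=
  discreteMeasurable_message_of_history (discreteMeasurable_history t h.1)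

lemma discreteMeasurable_message_ext (t : ℕ) (s : W) (j : Fin 4) :
    DiscreteMeasurable fun ω : Sample W q M =>
      message A X ν ω t (extHalfEdge (choiceOf ν ω) s j) :=
  (discreteMeasurable_choiceOf (ν := ν)).bind
    (F := fun g ω => message A X ν ω t (extHalfEdge g s j)) fun _ => discreteMeasurable_message _ _

lemma discreteMeasurable_raised (t : ℕ) (v : W × Fin (4 * q)) :
    DiscreteMeasurable fun ω : Sample W q M => raised A X ν ω t v := by
  refine (discreteMeasurable_idOf v).bind (F := fun i ω => A.flag (Fintype.card _) i _
    (ω v).2 (history A X ν ω t v)) fun i => ?_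
  refine (discreteMeasurable_history t v).bind
    (F := fun l ω => A.flag (Fintype.card _) i _ (ω v).2 l) fun l => ?_
  have hm : Measurable fun ω : Sample W q M => (ω v).2 := (measurable_pi_apply v).snd
  have h1 := hm (A.measurableSet_flag (Fintype.card (W × Fin (4 * q))) i (4 * q - 1) l)
  intro b
  cases b
  · convert h1.compl using 1
    ext ω; simp
  · exact h1

lemma measurableSet_electsAt (l : W × Fin (4 * q)) :
    MeasurableSet {ω : Sample W q M | ElectsAt A X ν ω l} := by
  simp only [ElectsAt, Set.ofPred_exists, Set.ofPred_forall, Set.ofPred_and]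
  refine .iUnion fun T => .iInter fun t => .iInter fun _ => .inter (.iInter fun h => ?_)
    (.iInter fun v => ?_)
  · exact discreteMeasurable_message t h none
  · exact (discreteMeasurable_raised t v).setOf fun b => b = true ↔ v = l

lemma measurableSet_leadersAre (S : Finset (W × Fin (4 * q))) :
    MeasurableSet {ω : Sample W q M | LeadersAre A X ν ω S} := by
  simp only [LeadersAre, Set.ofPred_exists, Set.ofPred_forall]
  exact .iUnion fun T => .iInter fun t => .iInter fun _ => .iInter fun v =>
    (discreteMeasurable_raised t v).setOf fun b => b = true ↔ v ∈ S

lemma measurableSet_usedEdge (s : W) (j : Fin 4) :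
    MeasurableSet {ω : Sample W q M | UsedEdge A X ν ω s j} := by
  simp only [UsedEdge, Set.ofPred_exists, Set.ofPred_or]
  exact .iUnion fun t => .union ((discreteMeasurable_message_ext t s j).setOf fun m => m.isSome)
    ((discreteMeasurable_message_ext t _ _).setOf fun m => m.isSome)

lemma measurableSet_touched (s : W) : MeasurableSet {ω : Sample W q M | Touched A X ν ω s} := by
  simp only [Touched, Set.ofPred_exists]
  exact .iUnion fun j => measurableSet_usedEdge s j

lemma measurableSet_idOf_injective :
    MeasurableSet {ω : Sample W q M | Function.Injective (idOf ω)} :=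
  (DiscreteMeasurable.pi discreteMeasurable_idOf).setOf Function.Injective

lemma measurableSet_cluster (s : W) (D : Finset W) :
    MeasurableSet {z : Sample W q M × Sample W q M | cluster A X ν z.1 z.2 s = D} := by
  have hu : DiscreteMeasurable fun (z : Sample W q M × Sample W q M) (e : W × Fin 4) =>
      (UsedEdge A X ν z.1 e.1 e.2 ∨ UsedEdge A X ν z.2 e.1 e.2) := by
    refine DiscreteMeasurable.pi fun e => Measurable.discreteMeasurable ?_
    refine measurable_to_prop ?_
    convert (measurable_fst (measurableSet_usedEdge (A := A) (X := X) (ν := ν) e.1 e.2)).union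
      (measurable_snd (measurableSet_usedEdge (A := A) (X := X) (ν := ν) e.1 e.2)) using 1
    ext z; simp
  have : Countable (W × Fin 4 → Prop) := inferInstance
  have hc := hu.setOf fun U => (∀ r, r ∈ D ↔
    Relation.ReflTransGen (fun a b => ∃ j, X.step j a = b ∧ U (a, j)) s r)
  convert hc using 1
  ext z
  simp only [Set.mem_ofPred_eq, Finset.ext_iff, mem_cluster]
  exact forall_congr' fun r => Iff.comm

end Measurability

/-! ### The law of the random data and its symmetries -/

section Law

instance : IsProbabilityMeasure bitsLaw := by unfold bitsLaw; infer_instance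

instance (V : Type) [Fintype V] : IsProbabilityMeasure (randomLaw V) := by
  unfold randomLaw; infer_instance

/-- The law of the random data of a node: a uniformly random position and ID, and independent
fair bits. -/
noncomputable def nodeLaw (q M : ℕ) [NeZero q] [NeZero M] : Measure (NodeData q M) :=
  (PMF.uniformOfFintype (Fin q × Fin M)).toMeasure.prod bitsLaw

instance (q M : ℕ) [NeZero q] [NeZero M] : IsProbabilityMeasure (nodeLaw q M) := by
  unfold nodeLaw; infer_instance

/-- The law of the random data: the nodes are independent. -/
noncomputable def sampleLaw (W : Type) [Fintype W] (q M : ℕ) [NeZero q] [NeZero M] :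
    Measure (Sample W q M) :=
  Measure.pi fun _ => nodeLaw q M

variable {W : Type} [Fintype W] [DecidableEq W] {q M : ℕ} [NeZero q] [NeZero M]

instance : IsProbabilityMeasure (sampleLaw W q M) := by unfold sampleLaw; infer_instance

/-- Combine labels and random strings. -/
def withBits (d : W × Fin (4 * q) → Fin q × Fin M) (r : W × Fin (4 * q) → ℕ → Bool) :
    Sample W q M := fun v => (d v, r v)

lemma measurable_withBits (d : W × Fin (4 * q) → Fin q × Fin M) : Measurable (withBits d) :=
  measurable_pi_iff.2 fun v => measurable_const.prodMk (measurable_pi_apply v)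

/-- Separates the finite labels from the random bits: labels with distinct IDs are networks, and the
inner integral is then an expectation on that network. -/
lemma lintegral_sampleLaw {F : Sample W q M → ENNReal} (hF : Measurable F) :
    ∫⁻ ω, F ω ∂sampleLaw W q M =
      (Fintype.card (W × Fin (4 * q) → Fin q × Fin M) : ENNReal)⁻¹ *
        ∑ d, ∫⁻ r, F (withBits d r) ∂randomLaw (W × Fin (4 * q)) := by

  have hmp := (measurePreserving_arrowProdEquivProdArrow (Fin q × Fin M) (ℕ → Bool)
    (W × Fin (4 * q)) (fun _ => (PMF.uniformOfFintype (Fin q × Fin M)).toMeasure)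
    fun _ => bitsLaw).symm
  have h1 : ∫⁻ ω, F ω ∂sampleLaw W q M = _ := (hmp.lintegral_comp hF).symm
  have hm : Measurable fun z => F
      ((MeasurableEquiv.arrowProdEquivProdArrow (Fin q × Fin M) (ℕ → Bool) _).symm z) :=
    hF.comp hmp.measurable
  rw [h1, lintegral_prod _ hm.aemeasurable, lintegral_fintype,
    Finset.mul_sum]
  refine Finset.sum_congr rfl fun d _ => ?_
  rw [mul_comm]
  congr 1
  rw [Measure.pi_singleton]
  simp only [PMF.toMeasure_apply_singleton, measurableSet_singleton, PMF.uniformOfFintype_apply]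
  rw [Finset.prod_const, Finset.card_univ, Fintype.card_fun, Nat.cast_pow, ENNReal.inv_pow]

/-- The exchange acts on each node separately, either as a swap of two independent copies or as the
identity. -/
lemma measurePreserving_splice (D : Finset W) :
    MeasurePreserving (fun z : Sample W q M × Sample W q M =>
        (splice D z.1 z.2, splice D z.2 z.1))
      ((sampleLaw W q M).prod (sampleLaw W q M)) ((sampleLaw W q M).prod (sampleLaw W q M)) := by
  have e := measurePreserving_arrowProdEquivProdArrow (NodeData q M) (NodeData q M)
    (W × Fin (4 * q)) (fun _ => nodeLaw q M) fun _ => nodeLaw q M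
  have hs := measurePreserving_pi (fun _ : W × Fin (4 * q) => (nodeLaw q M).prod (nodeLaw q M))
    (fun _ => (nodeLaw q M).prod (nodeLaw q M))
    (f := fun v x => if v.1 ∈ D then Prod.swap x else x) (fun v => by
      by_cases hv : v.1 ∈ D
      · simp only [hv, if_true]; exact Measure.measurePreserving_swap
      · simp only [hv, if_false]; exact MeasurePreserving.id _)
  have := e.comp (hs.comp e.symm)
  unfold sampleLaw
  convert this using 1
  funext z
  refine Prod.ext ?_ ?_ <;> funext v <;>
    simp only [splice, Function.comp, MeasurableEquiv.arrowProdEquivProdArrow,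
      Equiv.arrowProdEquivProdArrow] <;>
    by_cases hv : v.1 ∈ D <;> simp [hv]

lemma measurePreserving_reindex (σ : Equiv.Perm W) :
    MeasurePreserving (reindex (q := q) (M := M) σ) (sampleLaw W q M) (sampleLaw W q M) := by
  have := measurePreserving_arrowCongr' (fun _ : W × Fin (4 * q) => nodeLaw q M)
    (fun _ : W × Fin (4 * q) => nodeLaw q M) (σ.symm.prodCongr (Equiv.refl _))
    (MeasurableEquiv.refl _) (fun _ => MeasurePreserving.id _)
  exact this

end Law

/-! ### Two independent executions -/

section TwoExecutions

variable {W : Type} [Fintype W] [DecidableEq W] (A : Algorithm) (X : CycleExpander W) {q M : ℕ}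
  (ν : Fin 4 → Fin (4 * q))

/-- The IDs are distinct and the execution elects a leader in the clique of `s`. -/
def ElectsIn (ω : Sample W q M) (s : W) : Prop :=
  Function.Injective (idOf ω) ∧ ∃ l, l.1 = s ∧ ElectsAt A X ν ω l

/-- The IDs are distinct and a message passes over some external edge of the clique of `s`. -/
def Active (ω : Sample W q M) (s : W) : Prop :=
  Function.Injective (idOf ω) ∧ Touched A X ν ω s

/-- There are two leaders in different cliques, one of them in the clique of `s`. -/
def TwoLeaders (ω : Sample W q M) (s : W) : Prop :=
  ∃ l l', l.1 ≠ l'.1 ∧ l'.1 = s ∧ LeadersAre A X ν ω {l, l'}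

variable {A X ν}

lemma measurableSet_electsIn (s : W) :
    MeasurableSet {ω : Sample W q M | ElectsIn A X ν ω s} := by
  simp only [ElectsIn, Set.ofPred_and, Set.ofPred_exists]
  exact measurableSet_idOf_injective.inter
    (.iUnion fun l => .inter (MeasurableSet.const _) (measurableSet_electsAt l))

lemma measurableSet_active (s : W) : MeasurableSet {ω : Sample W q M | Active A X ν ω s} := by
  simp only [Active, Set.ofPred_and]
  exact measurableSet_idOf_injective.inter (measurableSet_touched s)

lemma measurableSet_twoLeaders (s : W) :
    MeasurableSet {ω : Sample W q M | TwoLeaders A X ν ω s} := by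
  simp only [TwoLeaders, Set.ofPred_and, Set.ofPred_exists]
  exact .iUnion fun l => .iUnion fun l' => .inter (MeasurableSet.const _)
    (.inter (MeasurableSet.const _) (measurableSet_leadersAre _))

variable [NeZero q] [NeZero M]

/-- Events that are compatible with reindexing have the same probability for all cliques. -/
lemma measure_eq_of_reindex {P : Sample W q M → W → Prop}
    (hm : ∀ s, MeasurableSet {ω | P ω s})
    (hP : ∀ σ : Equiv.Perm W, (∀ b w, σ (X.perm b w) = X.perm b (σ w)) →
      ∀ ω s, P (reindex σ ω) s ↔ P ω (σ s)) (s t : W) :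
    sampleLaw W q M {ω | P ω s} = sampleLaw W q M {ω | P ω t} := by
  obtain ⟨σ, rfl, hσ⟩ := X.transitive s t
  rw [← (measurePreserving_reindex σ).measure_preimage (hm s).nullMeasurableSet]
  congr 1
  ext ω
  exact hP σ hσ ω s

lemma measure_active_eq (s t : W) :
    sampleLaw W q M {ω | Active A X ν ω s} = sampleLaw W q M {ω | Active A X ν ω t} := by
  refine measure_eq_of_reindex (X := X) measurableSet_active (fun σ hσ ω s => ?_) s t
  rw [Active, Active, touched_reindex hσ, idOf_reindex_injective]

lemma measure_electsIn_eq (s t : W) :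
    sampleLaw W q M {ω | ElectsIn A X ν ω s} = sampleLaw W q M {ω | ElectsIn A X ν ω t} := by
  refine measure_eq_of_reindex (X := X) measurableSet_electsIn (fun σ hσ ω s => ?_) s t
  rw [ElectsIn, ElectsIn, idOf_reindex_injective]
  simp only [electsAt_reindex hσ]
  refine and_congr_right fun _ => ⟨?_, ?_⟩
  · rintro ⟨l, rfl, h⟩
    exact ⟨_, rfl, h⟩
  · rintro ⟨l, hl, h⟩
    refine ⟨(s, l.2), rfl, ?_⟩
    rwa [← hl]

lemma card_mul_measure_electsIn_le (s : W) :
    Fintype.card W * sampleLaw W q M {ω | ElectsIn A X ν ω s} ≤ 1 := by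
  have h : ∑ t : W, sampleLaw W q M {ω | ElectsIn A X ν ω t} ≤ 1 := by
    rw [← measure_biUnion_finset (fun a _ b _ hab => ?_) fun t _ => measurableSet_electsIn t]
    · exact prob_le_one
    · refine Set.disjoint_left.2 ?_
      rintro ω ⟨_, l, hl, h⟩ ⟨_, l', hl', h'⟩
      exact hab (by rw [← hl, ← hl', h.unique h'])
  simpa [Finset.sum_congr rfl fun t _ => measure_electsIn_eq (A := A) (X := X) (ν := ν)
    (q := q) (M := M) t s] using h

/-- The eventual set of leaders is unique, so two leaders exclude an election, and they account for
at most two values of `s`. -/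
lemma sum_measure_twoLeaders_le :
    ∑ s : W, sampleLaw W q M {ω | TwoLeaders A X ν ω s} ≤
      2 * sampleLaw W q M {ω | ¬ ∃ s, ElectsIn A X ν ω s} := by
  classical
  have hE : MeasurableSet {ω : Sample W q M | ¬ ∃ s, ElectsIn A X ν ω s} := by
    have h : MeasurableSet {ω : Sample W q M | ∃ s, ElectsIn A X ν ω s} := by
      rw [Set.ofPred_exists]
      exact .iUnion fun s => measurableSet_electsIn s
    exact h.compl
  have h1 : ∑ s : W, sampleLaw W q M {ω | TwoLeaders A X ν ω s} =
      ∫⁻ ω, ∑ s : W, {ω | TwoLeaders A X ν ω s}.indicator 1 ω ∂sampleLaw W q M := by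
    rw [lintegral_finsetSum _ fun s _ => measurable_one.indicator (measurableSet_twoLeaders s)]
    exact Finset.sum_congr rfl fun s _ => (lintegral_indicator_one (measurableSet_twoLeaders s)).symm
  have h2 : 2 * sampleLaw W q M {ω | ¬ ∃ s, ElectsIn A X ν ω s} =
      ∫⁻ ω, 2 * {ω | ¬ ∃ s, ElectsIn A X ν ω s}.indicator 1 ω ∂sampleLaw W q M := by
    rw [lintegral_const_mul _ (measurable_one.indicator hE), lintegral_indicator_one hE]
  rw [h1, h2]
  refine lintegral_mono fun ω => ?_
  simp only [Set.indicator_apply, Set.mem_ofPred_eq, Pi.one_apply]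
  rw [Finset.sum_boole]
  by_cases hne : ∃ s, TwoLeaders A X ν ω s
  · obtain ⟨s₀, l, l', hll, -, hS⟩ := hne
    rw [if_pos]
    · have : Finset.univ.filter (fun s => TwoLeaders A X ν ω s) ⊆
          ({l, l'} : Finset (W × Fin (4 * q))).image Prod.fst := by
        intro s hs
        obtain ⟨m, m', -, rfl, hS'⟩ := (Finset.mem_filter.1 hs).2
        rw [hS.unique hS']
        exact Finset.mem_image_of_mem _ (by simp)
      have hc : (Finset.univ.filter (fun s => TwoLeaders A X ν ω s)).card ≤ 2 :=
        (Finset.card_le_card this).trans (Finset.card_image_le.trans Finset.card_le_two)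
      rw [mul_one]
      exact_mod_cast hc
    · rintro ⟨s, -, m, -, hm⟩
      have := hS.unique hm.leadersAre
      have e1 : l = m := by simpa using this.le (Finset.mem_insert_self l _)
      have e2 : l' = m := by simpa using this.le (by simp : l' ∈ ({l, l'} : Finset _))
      exact hll (by rw [e1, e2])
  · rw [Finset.filter_false_of_mem fun s _ h => hne ⟨s, h⟩]
    simp

/-- The first execution elects a leader outside the cluster of the clique `s` in which the
second execution elects a leader. -/
def ElectApart (A : Algorithm) (X : CycleExpander W) (ν : Fin 4 → Fin (4 * q)) (s : W)
    (z : Sample W q M × Sample W q M) : Prop :=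
  ∃ l l', ElectsAt A X ν z.1 l ∧ ElectsAt A X ν z.2 l' ∧ l'.1 = s ∧
    l.1 ∉ cluster A X ν z.1 z.2 s

/-- The event is split by the value `D` of the cluster. For fixed `D` the exchange along `D`
preserves the measure and maps into an event with two leaders and the same cluster `D`. These images
are disjoint, so summing over `D` loses nothing. -/
lemma measure_electApart_le (s : W) :
    ((sampleLaw W q M).prod (sampleLaw W q M)) {z | ElectApart A X ν s z} ≤
      sampleLaw W q M {ω | TwoLeaders A X ν ω s} := by
  classical
  set μ := sampleLaw W q M
  have hK : ∀ D, MeasurableSet {z : Sample W q M × Sample W q M | cluster A X ν z.1 z.2 s = D} :=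
    fun D => measurableSet_cluster s D
  have hF : MeasurableSet ({ω : Sample W q M | TwoLeaders A X ν ω s} ×ˢ
      (Set.univ : Set (Sample W q M))) := (measurableSet_twoLeaders s).prod .univ
  have h1 : {z : Sample W q M × Sample W q M | ElectApart A X ν s z} ⊆
      ⋃ D ∈ (Finset.univ : Finset (Finset W)),
        (fun z : Sample W q M × Sample W q M => (splice D z.1 z.2, splice D z.2 z.1)) ⁻¹'
          (({ω | TwoLeaders A X ν ω s} ×ˢ Set.univ) ∩ {z | cluster A X ν z.1 z.2 s = D}) := by
    rintro ⟨ω, ω'⟩ ⟨l, l', h, h', rfl, hl⟩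
    refine Set.mem_biUnion (Finset.mem_univ (cluster A X ν ω ω' l'.1)) ⟨⟨?_, trivial⟩, ?_⟩
    · exact ⟨l, l', fun e => hl (e ▸ self_mem_cluster _ _ _), rfl, leadersAre_splice h h' hl⟩
    · exact cluster_splice (separates_cluster ω ω' l'.1) l'.1
  calc (μ.prod μ) {z | ElectApart A X ν s z}
      ≤ ∑ D : Finset W, (μ.prod μ)
          (({ω | TwoLeaders A X ν ω s} ×ˢ Set.univ) ∩ {z | cluster A X ν z.1 z.2 s = D}) := by
        refine (measure_mono h1).trans ((measure_biUnion_finset_le _ _).trans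
          (Finset.sum_le_sum fun D _ => le_of_eq ?_))
        exact (measurePreserving_splice D).measure_preimage (hF.inter (hK D)).nullMeasurableSet
    _ = (μ.prod μ) (⋃ D ∈ (Finset.univ : Finset (Finset W)),
          (({ω | TwoLeaders A X ν ω s} ×ˢ Set.univ) ∩ {z | cluster A X ν z.1 z.2 s = D})) := by
        rw [measure_biUnion_finset (fun D _ D' _ hD => ?_) fun D _ => hF.inter (hK D)]
        refine Set.disjoint_left.2 ?_
        rintro z ⟨_, hz⟩ ⟨_, hz'⟩
        exact hD (hz.symm.trans hz')
    _ ≤ (μ.prod μ) ({ω | TwoLeaders A X ν ω s} ×ˢ Set.univ) :=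
        measure_mono (Set.iUnion₂_subset fun D _ => Set.inter_subset_left)
    _ = μ {ω | TwoLeaders A X ν ω s} := by
        rw [Measure.prod_prod, measure_univ, mul_one]

/-- The terms bound the ways in which a pair of executions can avoid a contradiction: an election
fails or the splice has two leaders (2 + 2 failures), some clique is active in both, both leaders
lie in one clique, or the clique of one leader is active in the other execution. The last two use
that N times the probability of electing in a given clique is at most 1. -/
lemma one_le_of_two_executions (s₀ : W) :
    1 ≤ 4 * sampleLaw W q M {ω | ¬ ∃ s, ElectsIn A X ν ω s} +
      Fintype.card W * sampleLaw W q M {ω | Active A X ν ω s₀} ^ 2 +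
      sampleLaw W q M {ω | ElectsIn A X ν ω s₀} +
      2 * sampleLaw W q M {ω | Active A X ν ω s₀} := by
  set μ := sampleLaw W q M
  set Bad : Set (Sample W q M) := {ω | ¬ ∃ s, ElectsIn A X ν ω s} with hBad
  set a := μ {ω | Active A X ν ω s₀}
  set e := μ {ω | ElectsIn A X ν ω s₀}
  have ha : ∀ s, μ {ω | Active A X ν ω s} = a := fun s => measure_active_eq s s₀
  have he : ∀ s, μ {ω | ElectsIn A X ν ω s} = e := fun s => measure_electsIn_eq s s₀
  have hNe : Fintype.card W * e ≤ 1 := card_mul_measure_electsIn_le s₀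
  let P (U U' : W → Set (Sample W q M)) : Set (Sample W q M × Sample W q M) := ⋃ s, U s ×ˢ U' s
  have hP : ∀ U U' u u', (∀ s, μ (U s) = u) → (∀ s, μ (U' s) = u') →
      (μ.prod μ) (P U U') ≤ Fintype.card W * (u * u') := by
    intro U U' u u' hU hU'
    refine (measure_iUnion_fintype_le _ _).trans (le_of_eq ?_)
    simp [Measure.prod_prod, hU, hU']
  have hcov : (Set.univ : Set (Sample W q M × Sample W q M)) ⊆
      (Bad ×ˢ Set.univ ∪ Set.univ ×ˢ Bad) ∪ (⋃ s, {z | ElectApart A X ν s z}) ∪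
      P (fun s => {ω | Active A X ν ω s}) (fun s => {ω | Active A X ν ω s}) ∪
      P (fun s => {ω | ElectsIn A X ν ω s}) (fun s => {ω | ElectsIn A X ν ω s}) ∪
      (P (fun s => {ω | Active A X ν ω s}) (fun s => {ω | ElectsIn A X ν ω s}) ∪
      P (fun s => {ω | ElectsIn A X ν ω s}) (fun s => {ω | Active A X ν ω s})) := by
    rintro ⟨ω, ω'⟩ -
    by_cases h : ∃ s, ElectsIn A X ν ω s
    swap
    · exact Or.inl (Or.inl (Or.inl (Or.inl (Or.inl ⟨h, trivial⟩))))
    by_cases h' : ∃ s, ElectsIn A X ν ω' s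
    swap
    · exact Or.inl (Or.inl (Or.inl (Or.inl (Or.inr ⟨trivial, h'⟩))))
    obtain ⟨s, hs⟩ := h
    obtain ⟨s', hs'⟩ := h'
    obtain ⟨hJ, l, hl, hel⟩ := id hs
    obtain ⟨hJ', l', hl', hel'⟩ := id hs'
    by_cases hc : l.1 ∈ cluster A X ν ω ω' s'
    swap
    · exact Or.inl (Or.inl (Or.inl (Or.inr (Set.mem_iUnion.2 ⟨s', l, l', hel, hel', hl', hc⟩))))
    by_cases hd : ∃ r, Touched A X ν ω r ∧ Touched A X ν ω' r
    · obtain ⟨r, hr, hr'⟩ := hd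
      exact Or.inl (Or.inl (Or.inr (Set.mem_iUnion.2 ⟨r, ⟨hJ, hr⟩, ⟨hJ', hr'⟩⟩)))
    rcases touched_of_mem_cluster (fun r hr => hd ⟨r, hr⟩) hc with h | h | h
    · refine Or.inl (Or.inr (Set.mem_iUnion.2 ⟨s, hs, ?_⟩))
      rw [← hl, h]; exact hs'
    · exact Or.inr (Or.inl (Set.mem_iUnion.2 ⟨s', ⟨hJ, h⟩, hs'⟩))
    · exact Or.inr (Or.inr (Set.mem_iUnion.2 ⟨s, hs, ⟨hJ', hl ▸ h⟩⟩))
  have hB : (μ.prod μ) (⋃ s, {z | ElectApart A X ν s z}) ≤ 2 * μ Bad :=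
    (measure_iUnion_fintype_le _ _).trans
      ((Finset.sum_le_sum fun s _ => measure_electApart_le s).trans sum_measure_twoLeaders_le)
  have hae : Fintype.card W * (a * e) ≤ a := by
    calc Fintype.card W * (a * e) = a * (Fintype.card W * e) := by ring
      _ ≤ a * 1 := by gcongr
      _ = a := mul_one a
  have hee : Fintype.card W * (e * e) ≤ e := by
    calc Fintype.card W * (e * e) = e * (Fintype.card W * e) := by ring
      _ ≤ e * 1 := by gcongr
      _ = e := mul_one e
  calc (1 : ENNReal) = (μ.prod μ) Set.univ := measure_univ.symm
    _ ≤ ((μ Bad + μ Bad) + 2 * μ Bad) + Fintype.card W * (a * a) + Fintype.card W * (e * e) +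
        (Fintype.card W * (a * e) + Fintype.card W * (e * a)) := by
      refine (measure_mono hcov).trans ?_
      refine (measure_union_le _ _).trans (add_le_add ?_ ((measure_union_le _ _).trans
        (add_le_add (hP _ _ _ _ ha he) (hP _ _ _ _ he ha))))
      refine (measure_union_le _ _).trans (add_le_add ?_ (hP _ _ _ _ he he))
      refine (measure_union_le _ _).trans (add_le_add ?_ (hP _ _ _ _ ha ha))
      refine (measure_union_le _ _).trans (add_le_add ?_ hB)
      refine (measure_union_le _ _).trans (le_of_eq ?_)
      rw [Measure.prod_prod, Measure.prod_prod, measure_univ, mul_one, one_mul]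
    _ ≤ ((μ Bad + μ Bad) + 2 * μ Bad) + Fintype.card W * (a * a) + e + (a + a) := by
      gcongr
      rw [mul_comm e a]; exact hae
    _ = _ := by ring

/-- If leader election succeeds with probability at least `31 / 32`, then every clique sends or
receives messages with probability at least `1 / (4 √N)`. -/
lemma measure_active_ge (s : W) (hN : 64 ≤ Fintype.card W)
    (h : sampleLaw W q M {ω | ¬ ∃ s, ElectsIn A X ν ω s} ≤ ENNReal.ofReal (1 / 32)) :
    1 / (4 * √(Fintype.card W)) ≤ (sampleLaw W q M).real {ω | Active A X ν ω s} := by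
  have h1 := one_le_of_two_executions (A := A) (X := X) (ν := ν) (q := q) (M := M) s
  have h2 := card_mul_measure_electsIn_le (A := A) (X := X) (ν := ν) (q := q) (M := M) s
  set μ := sampleLaw W q M
  have hfin : ∀ S : Set (Sample W q M), μ S ≠ ⊤ := fun S => measure_ne_top _ _
  set a := μ.real {ω | Active A X ν ω s} with ha
  set e := μ.real {ω | ElectsIn A X ν ω s} with he
  set b := μ.real {ω | ¬ ∃ s, ElectsIn A X ν ω s} with hb
  have ea : μ {ω | Active A X ν ω s} = ENNReal.ofReal a := (ENNReal.ofReal_toReal (hfin _)).symm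
  have ee : μ {ω | ElectsIn A X ν ω s} = ENNReal.ofReal e := (ENNReal.ofReal_toReal (hfin _)).symm
  have eb : μ {ω | ¬ ∃ s, ElectsIn A X ν ω s} = ENNReal.ofReal b :=
    (ENNReal.ofReal_toReal (hfin _)).symm
  have ha0 : 0 ≤ a := measureReal_nonneg
  have he0 : 0 ≤ e := measureReal_nonneg
  have hb0 : 0 ≤ b := measureReal_nonneg
  set N : ℝ := ((Fintype.card W : ℕ) : ℝ) with hNdef
  have hN' : (64 : ℝ) ≤ N := by rw [hNdef]; exact_mod_cast hN
  rw [eb, ENNReal.ofReal_le_ofReal_iff (by norm_num)] at h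
  have eN : (Fintype.card W : ENNReal) = ENNReal.ofReal N := by simp [hNdef]
  rw [ee, eN, ← ENNReal.ofReal_mul (by positivity), ENNReal.ofReal_le_one] at h2
  have h1' : 1 ≤ 4 * b + N * a ^ 2 + e + 2 * a := by
    rw [← ENNReal.one_le_ofReal, ENNReal.ofReal_add (by positivity) (by positivity),
      ENNReal.ofReal_add (by positivity) (by positivity),
      ENNReal.ofReal_add (by positivity) (by positivity),
      ENNReal.ofReal_mul (by positivity), ENNReal.ofReal_mul (by positivity),
      ENNReal.ofReal_mul (by positivity), ENNReal.ofReal_pow ha0, ← ea, ← eb, ← ee, ← eN]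
    simpa using h1
  -- Otherwise the right-hand side is at most 1/8 + 1/16 + 1/64 + 1/16 < 1.
  by_contra hlt
  rw [not_le] at hlt
  have hr : 8 ≤ √N := by
    rw [show (8 : ℝ) = √(8 ^ 2) by rw [Real.sqrt_sq (by norm_num)]]
    exact Real.sqrt_le_sqrt (by linarith)
  have hra : √N * a < 1 / 4 := by
    rw [lt_div_iff₀ (by positivity)] at hlt
    linarith
  have hNa : N * a ^ 2 ≤ 1 / 16 := by
    have : N * a ^ 2 = (√N * a) ^ 2 := by rw [mul_pow, Real.sq_sqrt (by linarith)]
    rw [this]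
    have h0 : 0 ≤ √N * a := by positivity
    nlinarith
  have h8a : 8 * a ≤ √N * a := by gcongr
  have h64e : 64 * e ≤ N * e := by gcongr
  linarith

end TwoExecutions

/-! ### The number of messages sent in a clique -/

section Load

variable {W : Type} [Fintype W] [DecidableEq W] {A : Algorithm} {X : CycleExpander W} {q M : ℕ}
  {ν : Fin 4 → Fin (4 * q)}

/-- The orbit of a clique under one of the two permutations. -/
def trail (X : CycleExpander W) (b : Fin 2) (s : W) : Finset W :=
  (Finset.range 15).image fun i => (X.perm b ^ i) s

lemma mem_trail {b : Fin 2} {s r : W} : r ∈ trail X b s ↔ (X.perm b).SameCycle s r := by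
  rw [trail, Finset.mem_image]
  constructor
  · rintro ⟨i, -, rfl⟩
    exact ⟨i, by simp⟩
  · rintro ⟨z, rfl⟩
    have h15 : (0 : ℤ) < 15 := by norm_num
    have h0 := Int.emod_nonneg z h15.ne'
    refine ⟨(z % 15).toNat, Finset.mem_range.2 ?_, ?_⟩
    · have := Int.emod_lt_of_pos z h15
      omega
    · rw [zpow_eq_zpow_emod' z (X.pow_eq_one b), ← zpow_natCast, Int.toNat_of_nonneg h0]
      rfl

lemma card_trail_le (b : Fin 2) (s : W) : (trail X b s).card ≤ 15 :=
  Finset.card_image_le.trans (by simp)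

lemma trailClosed_trail (b : Fin 2) (s : W) : TrailClosed X b (trail X b s) := by
  intro r j hj
  rw [mem_trail, mem_trail]
  subst hj
  fin_cases j
  · exact Equiv.Perm.sameCycle_apply_right
  · exact Equiv.Perm.sameCycle_symm_apply_right
  · exact Equiv.Perm.sameCycle_apply_right
  · exact Equiv.Perm.sameCycle_symm_apply_right

/-- A message entering over an external edge is sent by the neighbouring clique, which lies on the
same trail. -/
lemma Touched.exists_opened {ω : Sample W q M} {s : W} (h : Touched A X ν ω s) :
    ∃ b T, Opened (sendOf A ω) (linkOf X ν ω) (choiceOf ν ω) b (trail X b s) T := by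
  obtain ⟨j, t, h⟩ := h
  have hs : s ∈ trail X (pairOf j) s := mem_trail.2 (Equiv.Perm.SameCycle.refl _ _)
  refine ⟨pairOf j, t + 1, t, t.lt_succ_self, ?_⟩
  rcases h with h | h
  · exact ⟨s, hs, j, rfl, h⟩
  · exact ⟨X.step j s, (trailClosed_trail _ s s j rfl).2 hs, partner j, pairOf_partner j, h⟩

/-- The number of messages sent by the nodes of the clique of `s`, possibly `∞`. -/
noncomputable def load (A : Algorithm) (X : CycleExpander W) (ν : Fin 4 → Fin (4 * q))
    (ω : Sample W q M) (s : W) : ENNReal :=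
  ∑' t : ℕ, ∑ i : Fin (4 * q), ∑ p : Fin (4 * q - 1),
    if (message A X ν ω t ((s, i), p)).isSome then 1 else 0

lemma msgCount_le_sum_load (ω : Sample W q M) (O : Finset W) (T : ℕ) :
    (msgCount (sendOf A ω) (linkOf X ν ω) O T : ENNReal) ≤ ∑ s ∈ O, load A X ν ω s := by
  classical
  have h : ∀ t, ((Finset.univ.filter fun h : (W × Fin (4 * q)) × Fin (4 * q - 1) =>
      h.1.1 ∈ O ∧ (sentOver (sendOf A ω) (linkOf X ν ω) t h).isSome).card : ENNReal) =
      ∑ s ∈ O, ∑ i : Fin (4 * q), ∑ p : Fin (4 * q - 1),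
        if (message A X ν ω t ((s, i), p)).isSome then 1 else 0 := by
    intro t
    rw [Finset.card_filter, Nat.cast_sum, Fintype.sum_prod_type, Fintype.sum_prod_type,
      ← Finset.sum_subset (Finset.subset_univ O)]
    · refine Finset.sum_congr rfl fun s hs => Finset.sum_congr rfl fun i _ =>
        Finset.sum_congr rfl fun p _ => ?_
      simp only [hs, true_and, Nat.cast_ite, Nat.cast_one, Nat.cast_zero]
      rfl
    · intro s _ hs
      simp [hs]
  rw [msgCount, Nat.cast_sum, Finset.sum_congr rfl fun t _ => h t, Finset.sum_comm]
  exact Finset.sum_le_sum fun s _ => ENNReal.sum_le_tsum _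

lemma measurable_load (s : W) : Measurable fun ω : Sample W q M => load A X ν ω s := by
  refine Measurable.tsum fun t => Finset.measurable_fun_sum _ fun i _ =>
    Finset.measurable_fun_sum _ fun p _ => Measurable.ite ?_ measurable_const measurable_const
  exact (discreteMeasurable_message t _).setOf fun m => m.isSome

lemma load_reindex {σ : Equiv.Perm W} (hσ : ∀ b w, σ (X.perm b w) = X.perm b (σ w))
    (ω : Sample W q M) (s : W) : load A X ν (reindex σ ω) s = load A X ν ω (σ s) := by
  simp only [load, message_reindex hσ]; rfl

variable [NeZero q] [NeZero M]

/-- The number of messages sent by the nodes of the clique of `s`, in expectation over the samples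
with distinct IDs. -/
noncomputable def expectedLoad (M : ℕ) [NeZero M] (A : Algorithm) (X : CycleExpander W)
    (ν : Fin 4 → Fin (4 * q)) (s : W) : ENNReal :=
  ∫⁻ ω in {ω : Sample W q M | Function.Injective (idOf ω)}, load A X ν ω s ∂sampleLaw W q M

lemma expectedLoad_eq (s t : W) : expectedLoad M A X ν s = expectedLoad M A X ν t := by
  obtain ⟨σ, rfl, hσ⟩ := X.transitive s t
  have hJ : MeasurableSet {ω : Sample W q M | Function.Injective (idOf ω)} :=
    measurableSet_idOf_injective
  rw [expectedLoad, expectedLoad, ← lintegral_indicator hJ, ← lintegral_indicator hJ,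
    ← (measurePreserving_reindex σ).lintegral_comp ((measurable_load s).indicator hJ)]
  refine lintegral_congr fun ω => ?_
  classical
  simp only [Set.indicator_apply, Set.mem_ofPred_eq, idOf_reindex_injective, load_reindex hσ]

lemma measurableSet_opened (b : Fin 2) (O : Finset W) (T : ℕ) :
    MeasurableSet {ω : Sample W q M |
      Opened (sendOf A ω) (linkOf X ν ω) (choiceOf ν ω) b O T} := by
  simp only [Opened, ← message_eq_sentOver, Set.ofPred_exists, Set.ofPred_and]
  exact .iUnion fun t => .inter (.const _) (.iUnion fun s => .inter (.const _) (.iUnion fun j =>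
    .inter (.const _) ((discreteMeasurable_message_ext t s j).setOf fun m => m.isSome)))

lemma measurable_msgCount (O : Finset W) (T : ℕ) : Measurable fun ω : Sample W q M =>
    (msgCount (sendOf A ω) (linkOf X ν ω) O T : ENNReal) := by
  have h : ∀ ω : Sample W q M, (msgCount (sendOf A ω) (linkOf X ν ω) O T : ENNReal) =
      ∑ t ∈ Finset.range T, ∑ h : (W × Fin (4 * q)) × Fin (4 * q - 1),
        if h.1.1 ∈ O ∧ (message A X ν ω t h).isSome then 1 else 0 := by
    intro ω
    rw [msgCount, Nat.cast_sum]
    refine Finset.sum_congr rfl fun t _ => ?_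
    rw [Finset.card_filter, Nat.cast_sum]
    refine Finset.sum_congr rfl fun h _ => ?_
    rw [Nat.cast_ite, Nat.cast_one, Nat.cast_zero]
    rfl
  simp only [h]
  refine Finset.measurable_fun_sum _ fun t _ => Finset.measurable_fun_sum _ fun h _ => ?_
  have hms : MeasurableSet {ω : Sample W q M | h.1.1 ∈ O ∧ (message A X ν ω t h).isSome} :=
    .inter (.const _) ((discreteMeasurable_message t h).setOf fun m => m.isSome)
  exact Measurable.ite hms measurable_const measurable_const

open Classical in
/-- Averaging over the positions for fixed IDs and random strings. -/
lemma measure_opened_le {b : Fin 2} {O : Finset W} (hO : TrailClosed X b O)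
    (hν : Function.Injective ν) (T : ℕ) :
    q ^ 2 * sampleLaw W q M ({ω | Opened (sendOf A ω) (linkOf X ν ω) (choiceOf ν ω) b O T} ∩
        {ω | Function.Injective (idOf ω)}) ≤
      4 * ∑ s ∈ O, expectedLoad M A X ν s := by
  have hJ : MeasurableSet {ω : Sample W q M | Function.Injective (idOf ω)} :=
    measurableSet_idOf_injective
  have hOp : MeasurableSet {ω : Sample W q M |
      Opened (sendOf A ω) (linkOf X ν ω) (choiceOf ν ω) b O T} := measurableSet_opened b O T
  have hcount : Measurable fun ω : Sample W q M =>
      (msgCount (sendOf A ω) (linkOf X ν ω) O T : ENNReal) := measurable_msgCount O T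
  have key : q ^ 2 * sampleLaw W q M
        ({ω | Opened (sendOf A ω) (linkOf X ν ω) (choiceOf ν ω) b O T} ∩
          {ω | Function.Injective (idOf ω)}) ≤
      4 * ∫⁻ ω in {ω : Sample W q M | Function.Injective (idOf ω)},
        (msgCount (sendOf A ω) (linkOf X ν ω) O T : ENNReal) ∂sampleLaw W q M := by
    rw [← lintegral_indicator_one (hOp.inter hJ), ← lintegral_indicator hJ,
      lintegral_sampleLaw (measurable_one.indicator (hOp.inter hJ)),
      lintegral_sampleLaw (hcount.indicator hJ), mul_left_comm, mul_left_comm (4 : ENNReal)]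
    refine mul_le_mul' le_rfl ?_
    let V := W × Fin (4 * q)
    let E : (V → Fin q × Fin M) ≃ (V → Fin q) × (V → Fin M) := Equiv.arrowProdEquivProdArrow _ _ _
    rw [← E.symm.sum_comp, ← E.symm.sum_comp, Fintype.sum_prod_type_right,
      Fintype.sum_prod_type_right, Finset.mul_sum, Finset.mul_sum]
    refine Finset.sum_le_sum fun ids _ => ?_
    have m1 : ∀ γ : V → Fin q, Measurable fun r => (({ω : Sample W q M |
        Opened (sendOf A ω) (linkOf X ν ω) (choiceOf ν ω) b O T} ∩
        {ω | Function.Injective (idOf ω)}).indicator 1 (withBits (E.symm (γ, ids)) r) : ENNReal) :=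
      fun γ => (measurable_one.indicator (hOp.inter hJ)).comp (measurable_withBits _)
    have m2 : ∀ γ : V → Fin q, Measurable fun r => {ω : Sample W q M |
        Function.Injective (idOf ω)}.indicator (fun ω => (msgCount (sendOf A ω) (linkOf X ν ω) O T :
        ENNReal)) (withBits (E.symm (γ, ids)) r) :=
      fun γ => (hcount.indicator hJ).comp (measurable_withBits _)
    rw [← lintegral_finsetSum _ fun γ _ => m1 γ, ← lintegral_finsetSum _ fun γ _ => m2 γ,
      ← lintegral_const_mul _ (Finset.measurable_fun_sum _ fun γ _ => m1 γ),
      ← lintegral_const_mul _ (Finset.measurable_fun_sum _ fun γ _ => m2 γ)]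
    refine lintegral_mono fun r => ?_
    -- Whether the IDs collide depends on `ids` alone, so the averaging over positions is not
    -- disturbed by the restriction; colliding IDs contribute zero to the left-hand side.
    by_cases hinj : Function.Injective fun v => (ids v).val + 1
    · have h := sum_opened_le hO (fun v => A.send (Fintype.card V) ((ids v).val + 1) (4 * q - 1)
        (r v)) (emb := fun e : W × Fin 4 => ((e.1, ν e.2) : V)) (fun e e' h => by
          rw [Prod.mk.injEq] at h
          exact Prod.ext h.1 (hν h.2)) T
      have h' := (Nat.cast_le (α := ENNReal)).2 h
      push_cast at h'
      refine le_trans (le_of_eq ?_) (h'.trans (le_of_eq ?_))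
      · congr 1
        refine Finset.sum_congr rfl fun γ _ => ?_
        have hi : Function.Injective (idOf (withBits (E.symm (γ, ids)) r)) := hinj
        simp only [Set.indicator_apply, Set.mem_inter_iff, Set.mem_ofPred_eq, hi, and_true,
          Pi.one_apply]
        rfl
      · congr 1
        refine Finset.sum_congr rfl fun γ _ => ?_
        have hi : Function.Injective (idOf (withBits (E.symm (γ, ids)) r)) := hinj
        simp only [Set.indicator_apply, Set.mem_ofPred_eq, hi, if_true]
        rfl
    · have hz : ∀ γ, (({ω : Sample W q M |
          Opened (sendOf A ω) (linkOf X ν ω) (choiceOf ν ω) b O T} ∩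
          {ω | Function.Injective (idOf ω)}).indicator 1 (withBits (E.symm (γ, ids)) r) : ENNReal)
          = 0 := fun γ => Set.indicator_of_notMem (fun h => hinj h.2) _
      simp [hz]
  refine key.trans ?_
  gcongr
  calc ∫⁻ ω in {ω : Sample W q M | Function.Injective (idOf ω)},
        (msgCount (sendOf A ω) (linkOf X ν ω) O T : ENNReal) ∂sampleLaw W q M
      ≤ ∫⁻ ω in {ω : Sample W q M | Function.Injective (idOf ω)},
        ∑ s ∈ O, load A X ν ω s ∂sampleLaw W q M :=
        lintegral_mono fun ω => msgCount_le_sum_load ω O T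
    _ = _ := lintegral_finsetSum _ fun s _ => measurable_load s

/-- Each of the two trails through `s` has at most 15 cliques, all with the same expected load;
2·4·15 = 120. -/
lemma measure_active_le (hν : Function.Injective ν) (s : W) :
    q ^ 2 * sampleLaw W q M {ω | Active A X ν ω s} ≤ 120 * expectedLoad M A X ν s := by
  set J : Set (Sample W q M) := {ω | Function.Injective (idOf ω)} with hJ
  let U (b : Fin 2) (T : ℕ) : Set (Sample W q M) :=
    {ω | Opened (sendOf A ω) (linkOf X ν ω) (choiceOf ν ω) b (trail X b s) T} ∩ J
  have hU : ∀ b, Monotone (U b) := by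
    rintro b T T' h ω ⟨⟨t, ht, h1⟩, h2⟩
    exact ⟨⟨t, ht.trans_le h, h1⟩, h2⟩
  have hb : ∀ b, q ^ 2 * sampleLaw W q M (⋃ T, U b T) ≤ 60 * expectedLoad M A X ν s := by
    intro b
    rw [(hU b).measure_iUnion, ENNReal.mul_iSup]
    refine iSup_le fun T => (measure_opened_le (trailClosed_trail b s) hν T).trans ?_
    rw [Finset.sum_congr rfl fun t _ => expectedLoad_eq t s, Finset.sum_const, nsmul_eq_mul,
      ← mul_assoc]
    gcongr
    have := card_trail_le (X := X) b s
    have h60 : 4 * (trail X b s).card ≤ 60 := by omega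
    exact_mod_cast h60
  have hsub : {ω | Active A X ν ω s} ⊆ (⋃ T, U 0 T) ∪ ⋃ T, U 1 T := by
    rintro ω ⟨h1, h2⟩
    obtain ⟨b, T, h⟩ := h2.exists_opened
    fin_cases b
    · exact Or.inl (Set.mem_iUnion.2 ⟨T, h, h1⟩)
    · exact Or.inr (Set.mem_iUnion.2 ⟨T, h, h1⟩)
  calc q ^ 2 * sampleLaw W q M {ω | Active A X ν ω s}
      ≤ q ^ 2 * (sampleLaw W q M (⋃ T, U 0 T) + sampleLaw W q M (⋃ T, U 1 T)) := by
        gcongr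
        exact (measure_mono hsub).trans (measure_union_le _ _)
    _ ≤ 60 * expectedLoad M A X ν s + 60 * expectedLoad M A X ν s := by
        rw [mul_add]; exact add_le_add (hb 0) (hb 1)
    _ = _ := by rw [← add_mul]; norm_num

/-- The expected number of messages over the samples with distinct IDs. -/
lemma sum_expectedLoad_ge (hν : Function.Injective ν) (hN : 64 ≤ Fintype.card W)
    (h : sampleLaw W q M {ω | ¬ ∃ s, ElectsIn A X ν ω s} ≤ ENNReal.ofReal (1 / 32)) :
    ENNReal.ofReal (√(Fintype.card W) * q ^ 2 / 480) ≤ ∑ s, expectedLoad M A X ν s := by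
  have hne : Nonempty W := Fintype.card_pos_iff.1 (by omega)
  obtain ⟨s⟩ := hne
  have h1 := measure_active_ge s hN h
  have h2 := measure_active_le (A := A) (X := X) (M := M) hν s
  have hN0 : (0 : ℝ) < Fintype.card W := by exact_mod_cast (by omega : 0 < Fintype.card W)
  have h3 : ENNReal.ofReal (q ^ 2 * (1 / (4 * √(Fintype.card W)))) ≤
      120 * expectedLoad M A X ν s := by
    refine le_trans ?_ h2
    rw [ENNReal.ofReal_mul (by positivity), ENNReal.ofReal_pow (by positivity),
      ENNReal.ofReal_natCast]
    gcongr
    exact ENNReal.ofReal_le_of_le_toReal h1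
  rw [Finset.sum_congr rfl fun t _ => expectedLoad_eq t s, Finset.sum_const, nsmul_eq_mul,
    Finset.card_univ]
  -- Summed over the cliques, N·q²/(4√N) = √N·q²/4, and dividing by 120 gives the 480.
  have h4 : ENNReal.ofReal (√(Fintype.card W) * q ^ 2 / 480) * 120 ≤
      Fintype.card W * expectedLoad M A X ν s * 120 := by
    calc ENNReal.ofReal (√(Fintype.card W) * q ^ 2 / 480) * 120
        = Fintype.card W * ENNReal.ofReal (q ^ 2 * (1 / (4 * √(Fintype.card W)))) := by
          rw [show (120 : ENNReal) = ENNReal.ofReal 120 by simp, ← ENNReal.ofReal_mul (by positivity),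
            ← ENNReal.ofReal_natCast (Fintype.card W), ← ENNReal.ofReal_mul (by positivity)]
          congr 1
          have hs : (Fintype.card W : ℝ) = √(Fintype.card W) * √(Fintype.card W) :=
            (Real.mul_self_sqrt hN0.le).symm
          have hp : 0 < √(Fintype.card W : ℝ) := Real.sqrt_pos.2 hN0
          field_simp
          rw [sq, ← hs]
          ring
      _ ≤ Fintype.card W * (120 * expectedLoad M A X ν s) := by gcongr
      _ = _ := by ring
  exact (ENNReal.mul_le_mul_iff_left (by norm_num) (by simp)).1 h4

end Load

/-! ### Collisions of random IDs -/

section Collisions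

variable {W : Type} [Fintype W] [DecidableEq W] {q M : ℕ} [NeZero q] [NeZero M]

lemma measure_idOf_eq_le {v w : W × Fin (4 * q)} (hvw : v ≠ w) :
    sampleLaw W q M {ω | idOf ω v = idOf ω w} ≤ (M : ENNReal)⁻¹ := by
  classical
  have hm : MeasurableSet {ω : Sample W q M | idOf ω v = idOf ω w} :=
    discreteMeasurable_labels.setOf fun d => (d v).2.val + 1 = (d w).2.val + 1
  rw [← lintegral_indicator_one hm, lintegral_sampleLaw (measurable_one.indicator hm)]
  let V := W × Fin (4 * q)
  have hr : ∀ d : V → Fin q × Fin M, ∫⁻ r, {ω : Sample W q M | idOf ω v = idOf ω w}.indicator 1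
      (withBits d r) ∂randomLaw V = if (d v).2 = (d w).2 then (1 : ENNReal) else 0 := by
    intro d
    have : ∀ r, ({ω : Sample W q M | idOf ω v = idOf ω w}.indicator 1 (withBits d r) : ENNReal) =
        if (d v).2 = (d w).2 then (1 : ENNReal) else 0 := by
      intro r
      simp only [Set.indicator_apply, Set.mem_ofPred_eq, Pi.one_apply, idOf, withBits,
        Nat.add_right_cancel_iff, Fin.val_inj]
      split_ifs with h <;> simp [h]
    simp only [this, lintegral_const, measure_univ, mul_one]
  rw [Finset.sum_congr rfl fun d _ => hr d, Finset.sum_boole]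
  -- The ID at `w` is determined by the one at `v`, so overwriting it freely by any of `M` values is
  -- injective.
  have hcard : (Finset.univ.filter fun d : V → Fin q × Fin M => (d v).2 = (d w).2).card * M ≤
      Fintype.card (V → Fin q × Fin M) := by
    refine le_trans (le_of_eq ?_) (Fintype.card_le_of_injective (fun x : {d : V → Fin q × Fin M // (d v).2 = (d w).2} ×
      Fin M => Function.update x.1.1 w ((x.1.1 w).1, x.2)) ?_)
    · rw [Fintype.card_prod, Fintype.card_fin, Fintype.card_subtype]
    rintro ⟨⟨d, hd⟩, m⟩ ⟨⟨d', hd'⟩, m'⟩ h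
    have hw := congrFun h w
    simp only [Function.update_self, Prod.mk.injEq] at hw
    have ho : ∀ u, u ≠ w → d u = d' u := by
      intro u hu
      simpa [Function.update_of_ne hu] using congrFun h u
    have : d = d' := by
      funext u
      by_cases hu : u = w
      · subst hu
        refine Prod.ext hw.1 ?_
        rw [← hd, ← hd', ho v hvw]
      · exact ho u hu
    subst this
    rw [hw.2]
  have hM : (M : ENNReal) ≠ 0 := by exact_mod_cast NeZero.ne M
  rw [ENNReal.le_inv_iff_mul_le, mul_assoc, ENNReal.inv_mul_le_iff]
  · rw [mul_one]; exact_mod_cast hcard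
  · exact_mod_cast Fintype.card_ne_zero
  · exact ENNReal.natCast_ne_top _

lemma measure_not_injective_le :
    sampleLaw W q M {ω | ¬ Function.Injective (idOf ω)} ≤
      (Fintype.card (W × Fin (4 * q)) : ENNReal) ^ 2 * (M : ENNReal)⁻¹ := by
  have hsub : {ω : Sample W q M | ¬ Function.Injective (idOf ω)} ⊆
      ⋃ e : (W × Fin (4 * q)) × (W × Fin (4 * q)), {ω | e.1 ≠ e.2 ∧ idOf ω e.1 = idOf ω e.2} := by
    intro ω hω
    rw [Set.mem_ofPred_eq, Function.Injective] at hω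
    push Not at hω
    obtain ⟨v, w, h, hvw⟩ := hω
    exact Set.mem_iUnion.2 ⟨(v, w), hvw, h⟩
  refine (measure_mono hsub).trans ((measure_iUnion_fintype_le _ _).trans ?_)
  refine (Finset.sum_le_card_nsmul _ _ (M : ENNReal)⁻¹ fun e _ => ?_).trans (le_of_eq ?_)
  · by_cases he : e.1 = e.2
    · simp [he]
    · exact (measure_mono fun ω h => h.2).trans (measure_idOf_eq_le he)
  · rw [nsmul_eq_mul, Finset.card_univ, Fintype.card_prod, Nat.cast_mul, sq]

end Collisions

/-! ### From samples to networks -/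

section Networks

variable {W : Type} [Fintype W] [DecidableEq W] (X : CycleExpander W) {q M : ℕ}
  (ν : Fin 4 → Fin (4 * q))

/-- The external nodes given by the labels. -/
def choiceOfLabels (d : W × Fin (4 * q) → Fin q × Fin M) : W → Fin 4 → Fin q :=
  fun s j => (d (s, ν j)).1

/-- The network given by labels with distinct IDs. -/
noncomputable def networkOf [Nonempty W] (hq : 3 ≤ q) (hM : M = Fintype.card (W × Fin (4 * q)) ^ 4)
    (d : W × Fin (4 * q) → Fin q × Fin M)
    (hd : Function.Injective fun v => (d v).2.val + 1) : Network (W × Fin (4 * q)) :=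
  matchedNetwork (X.substitution (choiceOfLabels ν d)).graph
    (substitution_connected X hq (choiceOfLabels ν d))
    (link X (choiceOfLabels ν d) fun _ _ => True)
    (substitution_adj_iff_link X (choiceOfLabels ν d))
    (link_fst_injective X (choiceOfLabels ν d)) (fun v => (d v).2.val + 1) hd
    (fun v => Finset.mem_Icc.2 ⟨by omega, hM ▸ (d v).2.isLt⟩)

variable {X ν} [Nonempty W] {hq : 3 ≤ q} {hM : M = Fintype.card (W × Fin (4 * q)) ^ 4}
  {d : W × Fin (4 * q) → Fin q × Fin M} {hd : Function.Injective fun v => (d v).2.val + 1}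
  {A : Algorithm}

lemma received_networkOf (r : W × Fin (4 * q) → ℕ → Bool) (t : ℕ) (v : W × Fin (4 * q)) :
    received A (networkOf X ν hq hM d hd) r t v = history A X ν (withBits d r) t v :=
  received_matchedNetwork _ _ _ _ _ _ _ _
    (link_link X (fun _ _ _ => trivial) fun _ _ _ => trivial) A r t v

lemma sent_networkOf (r : W × Fin (4 * q) → ℕ → Bool) (t : ℕ) (v : W × Fin (4 * q))
    (p : Fin (4 * q - 1)) :
    sent A (networkOf X ν hq hM d hd) r t v p = message A X ν (withBits d r) t (v, p) :=
  congrFun (congrArg (A.send (Fintype.card (W × Fin (4 * q))) ((d v).2.val + 1) (4 * q - 1) (r v))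
    (received_networkOf r t v)) p

lemma flagAt_networkOf (r : W × Fin (4 * q) → ℕ → Bool) (t : ℕ) (v : W × Fin (4 * q)) :
    flagAt A (networkOf X ν hq hM d hd) r t v = raised A X ν (withBits d r) t v :=
  congrArg (A.flag (Fintype.card (W × Fin (4 * q))) ((d v).2.val + 1) (4 * q - 1) (r v))
    (received_networkOf r t v)

lemma electsLeader_networkOf (r : W × Fin (4 * q) → ℕ → Bool) :
    ElectsLeader A (networkOf X ν hq hM d hd) r ↔ ∃ l, ElectsAt A X ν (withBits d r) l := by
  rw [ElectsLeader, exists_comm]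
  refine exists_congr fun l => exists_congr fun T => forall_congr' fun t =>
    imp_congr_right fun _ => and_congr ?_ ?_
  · exact ⟨fun h h' => (sent_networkOf r t h'.1 h'.2).symm.trans (h h'.1 h'.2),
      fun h v p => (sent_networkOf r t v p).trans (h (v, p))⟩
  · simp only [flagAt_networkOf]

lemma messageCount_networkOf (r : W × Fin (4 * q) → ℕ → Bool) :
    messageCount A (networkOf X ν hq hM d hd) r = ∑ s, load A X ν (withBits d r) s := by
  simp only [load]
  rw [← Summable.tsum_finsetSum fun _ _ => ENNReal.summable]
  refine tsum_congr fun t => ?_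
  rw [← Fintype.sum_prod_type']
  refine Finset.sum_congr rfl fun v _ => ?_
  refine Finset.sum_congr rfl fun (p : Fin (4 * q - 1)) _ => ?_
  rw [sent_networkOf]

variable [NeZero q] [NeZero M]

/-- For each choice of labels with distinct IDs the failure probability over the bits is at most δ,
by hypothesis on that network. -/
lemma measure_not_electsIn_le (hq : 3 ≤ q) (hM : M = Fintype.card (W × Fin (4 * q)) ^ 4) {δ : ℝ}
    (hA : ∀ net : Network (W × Fin (4 * q)), 1 - δ ≤ successProb A net) :
    sampleLaw W q M {ω | ¬ ∃ s, ElectsIn A X ν ω s} ≤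
      sampleLaw W q M {ω | ¬ Function.Injective (idOf ω)} + ENNReal.ofReal δ := by
  have hE : MeasurableSet {ω : Sample W q M | ∃ l, ElectsAt A X ν ω l} := by
    rw [Set.ofPred_exists]
    exact .iUnion fun l => measurableSet_electsAt l
  have hB : MeasurableSet ({ω : Sample W q M | Function.Injective (idOf ω)} ∩
      {ω : Sample W q M | ∃ l, ElectsAt A X ν ω l}ᶜ) := measurableSet_idOf_injective.inter hE.compl
  have hsub : {ω : Sample W q M | ¬ ∃ s, ElectsIn A X ν ω s} ⊆
      {ω | ¬ Function.Injective (idOf ω)} ∪ ({ω : Sample W q M | Function.Injective (idOf ω)} ∩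
      {ω : Sample W q M | ∃ l, ElectsAt A X ν ω l}ᶜ) := by
    intro ω hω
    by_cases hJ : Function.Injective (idOf ω)
    · exact Or.inr ⟨hJ, fun ⟨l, hl⟩ => hω ⟨l.1, hJ, l, rfl, hl⟩⟩
    · exact Or.inl hJ
  refine (measure_mono hsub).trans ((measure_union_le _ _).trans (add_le_add le_rfl ?_))
  rw [← lintegral_indicator_one hB, lintegral_sampleLaw (measurable_one.indicator hB)]
  have hle : ∀ d : W × Fin (4 * q) → Fin q × Fin M, ∫⁻ r,
      (({ω : Sample W q M | Function.Injective (idOf ω)} ∩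
        {ω : Sample W q M | ∃ l, ElectsAt A X ν ω l}ᶜ).indicator 1 (withBits d r) : ENNReal)
        ∂randomLaw (W × Fin (4 * q)) ≤ ENNReal.ofReal δ := by
    intro d
    by_cases hd : Function.Injective fun v => (d v).2.val + 1
    · set net := networkOf X ν hq hM d hd with hnet
      have hS : {r | ElectsLeader A net r} =
          withBits d ⁻¹' {ω : Sample W q M | ∃ l, ElectsAt A X ν ω l} := by
        ext r
        exact electsLeader_networkOf r
      have hSm : MeasurableSet {r | ElectsLeader A net r} := hS ▸ measurable_withBits d hE
      calc ∫⁻ r, (({ω : Sample W q M | Function.Injective (idOf ω)} ∩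
            {ω : Sample W q M | ∃ l, ElectsAt A X ν ω l}ᶜ).indicator 1 (withBits d r) : ENNReal)
            ∂randomLaw (W × Fin (4 * q))
          ≤ ∫⁻ r, {r | ElectsLeader A net r}ᶜ.indicator 1 r ∂randomLaw (W × Fin (4 * q)) := by
            refine lintegral_mono fun r => ?_
            by_cases hr : ElectsLeader A net r
            · rw [Set.indicator_of_notMem fun h => h.2 ((electsLeader_networkOf r).1 hr)]
              exact zero_le
            · rw [Set.indicator_of_mem (s := {r | ElectsLeader A net r}ᶜ) hr]
              exact Set.indicator_le_self _ _ _
        _ = randomLaw (W × Fin (4 * q)) {r | ElectsLeader A net r}ᶜ :=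
            lintegral_indicator_one hSm.compl
        _ ≤ ENNReal.ofReal δ := by
            have h1 := hA net
            have h2 := probReal_compl_eq_one_sub (μ := randomLaw (W × Fin (4 * q))) hSm
            rw [successProb] at h1
            rw [← ENNReal.ofReal_toReal (measure_ne_top (randomLaw (W × Fin (4 * q)))
              {r | ElectsLeader A net r}ᶜ)]
            refine ENNReal.ofReal_le_ofReal ?_
            change (randomLaw (W × Fin (4 * q))).real _ ≤ δ
            linarith
    · have : ∀ r, (({ω : Sample W q M | Function.Injective (idOf ω)} ∩
          {ω : Sample W q M | ∃ l, ElectsAt A X ν ω l}ᶜ).indicator 1 (withBits d r) : ENNReal) = 0 :=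
        fun r => Set.indicator_of_notMem (fun h => hd h.1) _
      rw [lintegral_congr this, lintegral_zero]
      exact zero_le
  calc _ ≤ (Fintype.card (W × Fin (4 * q) → Fin q × Fin M) : ENNReal)⁻¹ *
        (Fintype.card (W × Fin (4 * q) → Fin q × Fin M) * ENNReal.ofReal δ) := by
        gcongr
        refine (Finset.sum_le_card_nsmul _ _ _ fun d _ => hle d).trans (le_of_eq ?_)
        rw [nsmul_eq_mul, Finset.card_univ]
    _ = ENNReal.ofReal δ := by
        rw [← mul_assoc, ENNReal.inv_mul_cancel, one_mul]
        · exact_mod_cast Fintype.card_ne_zero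
        · exact ENNReal.natCast_ne_top _

lemma exists_expectedMessages_ge (hq : 3 ≤ q) (hM : M = Fintype.card (W × Fin (4 * q)) ^ 4)
    (hpos : ∑ s, expectedLoad M A X ν s ≠ 0) :
    ∃ d hd, ∑ s, expectedLoad M A X ν s ≤ expectedMessages A (networkOf X ν hq hM d hd) := by
  have hJ : MeasurableSet {ω : Sample W q M | Function.Injective (idOf ω)} :=
    measurableSet_idOf_injective
  have hm : Measurable fun ω : Sample W q M => ∑ s, load A X ν ω s :=
    Finset.measurable_fun_sum _ fun s _ => measurable_load s
  set x : (W × Fin (4 * q) → Fin q × Fin M) → ENNReal := fun d =>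
    ∫⁻ r, {ω : Sample W q M | Function.Injective (idOf ω)}.indicator
      (fun ω => ∑ s, load A X ν ω s) (withBits d r) ∂randomLaw (W × Fin (4 * q)) with hx
  have hsum : ∑ s, expectedLoad M A X ν s =
      (Fintype.card (W × Fin (4 * q) → Fin q × Fin M) : ENNReal)⁻¹ * ∑ d, x d := by
    simp only [expectedLoad]
    rw [← lintegral_finsetSum _ fun s _ => measurable_load s, ← lintegral_indicator hJ,
      lintegral_sampleLaw (hm.indicator hJ)]
  obtain ⟨d, hmax⟩ := Finite.exists_max x
  have hle : ∑ s, expectedLoad M A X ν s ≤ x d := by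
    rw [hsum]
    calc _ ≤ (Fintype.card (W × Fin (4 * q) → Fin q × Fin M) : ENNReal)⁻¹ *
          (Fintype.card (W × Fin (4 * q) → Fin q × Fin M) * x d) := by
          gcongr
          refine (Finset.sum_le_card_nsmul _ _ _ fun d _ => hmax d).trans (le_of_eq ?_)
          rw [nsmul_eq_mul, Finset.card_univ]
      _ = x d := by
          rw [← mul_assoc, ENNReal.inv_mul_cancel, one_mul]
          · exact_mod_cast Fintype.card_ne_zero
          · exact ENNReal.natCast_ne_top _
  -- Labels with colliding IDs contribute zero, so the maximum, being positive, is attained at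
  -- distinct IDs.
  have hd : Function.Injective fun v => (d v).2.val + 1 := by
    by_contra hd
    have h0 : ∀ r, {ω : Sample W q M | Function.Injective (idOf ω)}.indicator
        (fun ω => ∑ s, load A X ν ω s) (withBits d r) = 0 :=
      fun r => Set.indicator_of_notMem hd _
    refine hpos (le_antisymm (hle.trans ?_) zero_le)
    simp [hx, h0]
  refine ⟨d, hd, hle.trans (lintegral_mono fun r => ?_)⟩
  rw [messageCount_networkOf]
  exact Set.indicator_le_self _ _ _

end Networks

/-- Every substitution pattern carries a network on which the algorithm sends many messages. -/
theorem exists_network_expectedMessages_ge {W : Type} [Fintype W] [DecidableEq W]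
    (X : CycleExpander W) {q : ℕ} (hq : 3 ≤ q) (hN : 64 ≤ Fintype.card W) {A : Algorithm} {δ : ℝ}
    (hδ : δ ≤ 1 / 64) (hA : ∀ net : Network (W × Fin (4 * q)), 1 - δ ≤ successProb A net) :
    ∃ (g : W → Fin 4 → Fin q) (net : Network (W × Fin (4 * q))),
      net.graph = (X.substitution g).graph ∧
      ENNReal.ofReal (√(Fintype.card W) * q ^ 2 / 480) ≤ expectedMessages A net := by
  have : Nonempty W := Fintype.card_pos_iff.1 (by omega)
  have : NeZero q := ⟨by omega⟩
  set n := Fintype.card (W × Fin (4 * q)) with hn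
  have hn64 : 64 ≤ n := by
    rw [hn, Fintype.card_prod, Fintype.card_fin]
    nlinarith
  have : NeZero (n ^ 4) := ⟨by positivity⟩
  -- Any four distinct nodes can store the positions of the external nodes of their clique; storing
  -- them at nodes makes all node data identically distributed.
  let ν : Fin 4 → Fin (4 * q) := Fin.castLE (by omega)
  have hν : Function.Injective ν := Fin.castLE_injective _
  have hcoll : sampleLaw W q (n ^ 4) {ω | ¬ Function.Injective (idOf ω)} ≤
      ENNReal.ofReal (1 / 64) := by
    refine measure_not_injective_le.trans ?_
    rw [← hn, ← ENNReal.ofReal_natCast n, ← ENNReal.ofReal_natCast (n ^ 4),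
      ← ENNReal.ofReal_inv_of_pos (by positivity), ← ENNReal.ofReal_pow (by positivity),
      ← ENNReal.ofReal_mul (by positivity)]
    refine ENNReal.ofReal_le_ofReal ?_
    have h64 : (64 : ℝ) ≤ n := by rw [hn]; exact_mod_cast hn64
    have hpos : (0 : ℝ) < n := by linarith
    push_cast
    rw [show (n : ℝ) ^ 4 = n ^ 2 * n ^ 2 by ring, mul_inv, ← mul_assoc,
      mul_inv_cancel₀ (by positivity), one_mul, one_div]
    gcongr
    nlinarith
  have hfail : sampleLaw W q (n ^ 4) {ω | ¬ ∃ s, ElectsIn A X ν ω s} ≤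
      ENNReal.ofReal (1 / 32) := by
    refine (measure_not_electsIn_le hq rfl hA).trans ((add_le_add hcoll
      (ENNReal.ofReal_le_ofReal hδ)).trans (le_of_eq ?_))
    rw [← ENNReal.ofReal_add (by norm_num) (by norm_num)]
    norm_num
  have hge := sum_expectedLoad_ge hν hN hfail
  have hN0 : (0 : ℝ) < Fintype.card W := by exact_mod_cast (by omega : 0 < Fintype.card W)
  have hq0 : (0 : ℝ) < q := by exact_mod_cast (by omega : 0 < q)
  have hpos : ∑ s, expectedLoad (n ^ 4) A X ν s ≠ 0 := by
    refine (lt_of_lt_of_le (ENNReal.ofReal_pos.2 ?_) hge).ne'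
    have := Real.sqrt_pos.2 hN0
    positivity
  obtain ⟨d, hd, h⟩ := exists_expectedMessages_ge hq rfl hpos
  exact ⟨choiceOfLabels ν d, _, rfl, hge.trans h⟩

/-! ### Choice of the parameters -/

lemma exists_clique_size {α : ℝ} {n : ℕ} (h₁ : 1 / (n : ℝ) ^ 2 < α) (h₂ : α < 1 / 12 ^ 2)
    (hn : 0 < n) :
    ∃ q : ℕ, 3 ≤ q ∧ 4 * q ≤ n ∧ α * (4 * q : ℝ) ^ 2 ≤ 1 ∧ 4 / 9 ≤ α * (4 * q : ℝ) ^ 2 := by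
  have hn' : (0 : ℝ) < n := by exact_mod_cast hn
  have hα : 0 < α := lt_trans (by positivity) h₁
  have hs : 0 < √α := Real.sqrt_pos.2 hα
  have hsq : √α ^ 2 = α := Real.sq_sqrt hα.le
  have h12 : √α < 1 / 12 := by
    rw [Real.sqrt_lt' (by norm_num)]; linarith
  have hsn : 1 / n < √α := by
    rw [Real.lt_sqrt (by positivity), div_pow, one_pow]; exact h₁
  -- This is the largest q with 4q√α ≤ 1. Rounding loses less than 4√α < 1/3, so 4q√α > 2/3, whose
  -- square gives 4/9.
  set q := ⌊1 / (4 * √α)⌋₊ with hq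
  have hle : (q : ℝ) ≤ 1 / (4 * √α) := Nat.floor_le (by positivity)
  have hlt : 1 / (4 * √α) < q + 1 := Nat.lt_floor_add_one _
  rw [le_div_iff₀ (by positivity)] at hle
  rw [div_lt_iff₀ (by positivity)] at hlt
  refine ⟨q, ?_, ?_, ?_, ?_⟩
  · refine Nat.le_floor ?_
    rw [le_div_iff₀ (by positivity)]
    push_cast
    linarith
  · have : (4 * q : ℝ) * √α < n * √α := by
      rw [div_lt_iff₀ hn'] at hsn
      linarith
    have h' := lt_of_mul_lt_mul_right this hs.le
    exact_mod_cast h'.le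
  · rw [← hsq, ← mul_pow]
    exact pow_le_one₀ (by positivity) (by linarith)
  · rw [← hsq, ← mul_pow]
    have : 2 / 3 ≤ √α * (4 * q) := by linarith
    nlinarith

/-- With 1/φ ≤ K·k² and n ≤ N·k, the powers of k combine as 1/2 + 3/2 = 2; K^(3/4) is bounded by K
since K ≥ 1. -/
lemma sqrt_div_rpow_le {n N k φ K : ℝ} (hn : 0 ≤ n) (hk : 0 < k) (hK : 1 ≤ K) (hnN : n ≤ N * k)
    (hφ : 1 / (K * k ^ 2) ≤ φ) : √n / φ ^ (3 / 4 : ℝ) ≤ K * (√N * k ^ 2) := by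
  have hφ0 : 0 < φ := lt_of_lt_of_le (by positivity) hφ
  have hinv : 1 / φ ^ (3 / 4 : ℝ) ≤ K * k ^ (3 / 2 : ℝ) := by
    have h1 : 1 / φ ≤ K * k ^ 2 := by
      rw [div_le_iff₀ (by positivity)] at hφ ⊢
      linarith
    calc 1 / φ ^ (3 / 4 : ℝ) = (1 / φ) ^ (3 / 4 : ℝ) := by
          rw [Real.div_rpow zero_le_one hφ0.le, Real.one_rpow]
      _ ≤ (K * k ^ 2) ^ (3 / 4 : ℝ) := Real.rpow_le_rpow (by positivity) h1 (by norm_num)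
      _ = K ^ (3 / 4 : ℝ) * k ^ (3 / 2 : ℝ) := by
          rw [Real.mul_rpow (by positivity) (by positivity), ← Real.rpow_natCast k 2,
            ← Real.rpow_mul hk.le]
          norm_num
      _ ≤ K ^ (1 : ℝ) * k ^ (3 / 2 : ℝ) := by
          gcongr
          norm_num
      _ = K * k ^ (3 / 2 : ℝ) := by rw [Real.rpow_one]
  have hN : 0 ≤ N := by
    by_contra h
    have := mul_neg_of_neg_of_pos (not_le.1 h) hk
    linarith
  calc √n / φ ^ (3 / 4 : ℝ) = √n * (1 / φ ^ (3 / 4 : ℝ)) := by ring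
    _ ≤ (√N * √k) * (K * k ^ (3 / 2 : ℝ)) := by
        gcongr
        rw [← Real.sqrt_mul hN]
        exact Real.sqrt_le_sqrt hnN
    _ = K * (√N * (k ^ (1 / 2 : ℝ) * k ^ (3 / 2 : ℝ))) := by
        rw [Real.sqrt_eq_rpow k]; ring
    _ = K * (√N * k ^ 2) := by
        rw [← Real.rpow_add hk, ← Real.rpow_natCast k 2]
        norm_num

end LeaderElection

theorem theorem2 :
    ∃ c₁ c₂ c₃ c₄ c₅ : ℝ, 0 < c₁ ∧ 0 < c₂ ∧ 0 < c₃ ∧ 0 < c₄ ∧ 0 < c₅ ∧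
      ∀ A : LeaderElection.Algorithm, A.SucceedsWHP →
        ∀ᶠ n : ℕ in atTop, ∀ α : ℝ, 1 / (n : ℝ) ^ 2 < α → α < 1 / 12 ^ 2 →
          ∃ (N k : ℕ) (H : SimpleGraph (Fin N)) (S : LeaderElection.CliqueSubstitution H k)
            (net : LeaderElection.Network (Fin N × Fin k)),
            (∀ s, (H.neighborSet s).ncard = 4) ∧
            net.graph = S.graph ∧
            c₁ * n ≤ (N * k : ℕ) ∧ ((N * k : ℕ) : ℝ) ≤ c₂ * n ∧
            c₃ * α ≤ LeaderElection.conductance net.graph ∧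
            LeaderElection.conductance net.graph ≤ c₄ * α ∧
            ENNReal.ofReal
                (c₅ * (Real.sqrt n / LeaderElection.conductance net.graph ^ (3 / 4 : ℝ))) ≤
              LeaderElection.expectedMessages A net := by
  set C : ℕ := 5 ^ 9 * Nat.card (LeaderElection.rotGroup (LeaderElection.truncUnit 1))
  -- The constants 1/40000000 and 18 = 8/(4/9) come from the conductance bounds with 4/9 ≤ α·k² ≤ 1;
  -- the 16 in the last one converts q² into k²/16.
  refine ⟨1, 65 * C + 1, 1 / 40000000, 18, 1 / (480 * 16 * 40000000), by norm_num, by positivity,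
    by norm_num, by norm_num, by norm_num, ?_⟩
  rintro A ⟨δ, hδ, hA⟩
  have hδ' : ∀ᶠ n in atTop, δ n ≤ 1 / 64 :=
    (hδ.eventually (gt_mem_nhds (show (0 : ℝ) < 1 / 64 by norm_num))).mono fun _ h => h.le
  obtain ⟨n₀, hn₀⟩ := eventually_atTop.1 hδ'
  filter_upwards [eventually_ge_atTop n₀, eventually_gt_atTop 0] with n hn hn0 α h₁ h₂
  obtain ⟨q, hq, hqn, hα₁, hα₂⟩ := LeaderElection.exists_clique_size h₁ h₂ hn0
  -- The added 64 provides the minimal number of cliques even if n/(4q) is small; since 4q ≤ n it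
  -- costs only a constant factor.
  obtain ⟨N, hmN, hNm, ⟨X⟩⟩ := LeaderElection.exists_cycleExpander (n / (4 * q) + 64)
    (Nat.add_pos_right _ (by norm_num))
  have hNk : n ≤ N * (4 * q) := by
    have h : n < (n / (4 * q) + 1) * (4 * q) := Nat.lt_mul_of_div_lt (Nat.lt_succ_self _) (by omega)
    exact h.le.trans (Nat.mul_le_mul_right _ (by omega))
  have hNk' : N * (4 * q) ≤ (65 * C + 1) * n := by
    calc N * (4 * q) ≤ C * (n / (4 * q) + 64) * (4 * q) := Nat.mul_le_mul_right _ hNm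
      _ = C * (n / (4 * q) * (4 * q) + 64 * (4 * q)) := by ring
      _ ≤ C * (n + 64 * n) := by
          gcongr
          exact Nat.div_mul_le_self _ _
      _ ≤ _ := by nlinarith
  have hN : 64 ≤ Fintype.card (Fin N) := by rw [Fintype.card_fin]; exact (Nat.le_add_left 64 _).trans hmN
  have : Nonempty (Fin N) := Fintype.card_pos_iff.1 (by omega)
  have hcard : Fintype.card (Fin N × Fin (4 * q)) = N * (4 * q) := by simp
  -- The network has at least n ≥ n₀ nodes whatever α is, so the success bound applies uniformly in
  -- α.
  obtain ⟨g, net, hgraph, hmsg⟩ := LeaderElection.exists_network_expectedMessages_ge X hq hN (A := A)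
    (hn₀ _ (hn.trans hNk)) fun net => hcard ▸ hA (Fin N × Fin (4 * q)) net
  have hge := LeaderElection.conductance_ge X hq g
  have hle := LeaderElection.conductance_le X (by omega) hq g
  have hk0 : (0 : ℝ) < 4 * q := by
    have : (0 : ℝ) < q := by exact_mod_cast (by omega : 0 < q)
    positivity
  refine ⟨N, 4 * q, X.graph, X.substitution g, net, X.ncard_neighborSet, hgraph, ?_, ?_, ?_, ?_, ?_⟩
  · rw [one_mul]; exact_mod_cast hNk
  · exact_mod_cast hNk'
  · rw [hgraph]
    refine le_trans ?_ hge
    rw [le_div_iff₀ (by positivity)]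
    linarith
  · rw [hgraph]
    refine hle.trans ?_
    rw [div_le_iff₀ (by positivity)]
    linarith
  · refine le_trans (ENNReal.ofReal_le_ofReal ?_) hmsg
    rw [hgraph]
    have h := LeaderElection.sqrt_div_rpow_le (n := n) (N := N) (k := 4 * q) (K := 40000000) (by positivity) hk0
      (by norm_num) (by exact_mod_cast hNk) hge
    rw [Fintype.card_fin]
    calc _ ≤ 1 / (480 * 16 * 40000000) * (40000000 * (√N * (4 * q : ℝ) ^ 2)) := by gcongr
      _ = √N * q ^ 2 / 480 := by ring
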